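/- Let $K$ be a non-archimedean local field (locally compact, non-discrete, totally disconnected) with Haar-module absolute value $|\cdot|$, ring of integers $\mathfrak D=\{|x|\le 1\}$, residue field of cardinality $q$, and $\mathfrak P^k=\{x:|x|\le q^{-k}\}$ for $k\in\mathbb Z$. Let $dx$ be the Haar measure of $K$ with $|\mathfrak D|=1$, and let $dh^*$ be any Haar measure of the multiplicative group $K^*$ (a constant multiple of $dh/|h|$). Put $\mathfrak D^*=\{h:|h|=1\}$ and write $\nu(\mathfrak D^*)$ for its $dh^*$-measure. *Besov spaces.* Let $\mathcal S_0(K)$ be the space of locally constant, compactly supported functions $K\to\mathbb C$ with integral zero, and $\mathcal S_0'(K)$ its dual. Let $\Phi_k=q^k1_{\mathfrak P^k}-q^{k-1}1_{\mathfrak P^{k-1}}\in\mathcal S_0(K)$ and $(f*\Phi_k)(x)=f(\Phi_k(x-\cdot))$ for $f\in\mathcal S_0'(K)$. For $\alpha\in\mathbb R$ and $1\le s,t\le\infty$, $$\dot B_{\alpha,s,t}(K)=\Big\{f\in\mathcal S_0'(K):\ \|f\|_{\dot B_{\alpha,s,t}}=\Big(\sum_{k\in\mathbb Z}q^{k\alpha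 t}\|f*\Phi_k\|_{L^s(K)}^t\Big)^{1/t}<\infty\Big\},$$ with the supremum over $k$ if $t=\infty$. *Coorbit spaces.* Let $G=K\rtimes K^*$ with $(x,h)(y,k)=(hy+x,hk)$, left Haar measure $dx\,dh^*/|h|$ and modular function $\Delta(x,h)=|h|^{-1}$. It acts on $L^2(K)$ by $(\pi(x,h)g)(y)=|h|^{-1/2}g(h^{-1}(y-x))$; let $W_gf(a)=\langle f\,|\,\pi(a)g\rangle$ for $a\in G$. For $w(x,h)=|h|^{-\alpha-1/2}$ let $Y=L^{s,t}_w$ be the space of measurable $F:G\to\mathbb C$ with $$\|F\|_Y=\Big(\int_{K^*}\|w(\cdot,h)F(\cdot,h)\|_{L^s(K)}^t\,dh^*\Big)^{1/t}<\infty$$ (essential supremum over $h$ if $t=\infty$). With $(L_aF)(b)=F(a^{-1}b)$ and $(R_aF)(b)=F(ba)$, a control weight for $Y$ is a measurable, submultiplicative function $v:G\to(0,\infty)$, bounded on compact sets, with $v(a)\ge\max\{\|L_{a^{\pm1}}\|_{Y\to Y},\|R_a\|_{Y\to Y},\|R_{a^{-1}}\|_{Y\to Y}\,\Delta(a^{-1})\}$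 and $v(a)=v(a^{-1})\Delta(a^{-1})$ for all $a\in G$. A vector $g\in L^2(K)\setminus\{0\}$ is called analyzing (for $v$) if $W_gg\in L^1_v(G)$. For an analyzing vector $g_0$ let $\mathcal H^1_v=\{f\in L^2(K):W_{g_0}f\in L^1_v(G)\}$, with norm $\|W_{g_0}f\|_{L^1_v}$, and let $\mathcal H_v^{1,\sim}$ be the space of continuous conjugate-linear functionals on $\mathcal H^1_v$. For an analyzing vector $g$, let $W_gl(a)=l(\pi(a)g)$ for $l\in\mathcal H_v^{1,\sim}$, and $$Co_g(Y)=\{l\in\mathcal H_v^{1,\sim}:\ W_gl\in Y\},\qquad \|l\|_{Co_g(Y)}=\|W_gl\|_Y .$$ **Theorem.** Let $1\le s,t\le\infty$, $\alpha\in\mathbb R$, $w(x,h)=|h|^{-\alpha-1/2}$ and $Y=L^{s,t}_w$. Control weights $v$ for $Y$ exist. Let $v$ be any control weight for $Y$. Then $\phi=1_{\mathfrak D}-q^{-1}1_{\mathfrak P^{-1}}$ is an analyzing vector, and for all analyzing vectors $g_0$ and $g$ one has $\mathcal S_0(K)\subseteq\mathcal H^1_v$ and $\pi(a)g\in\mathcal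 H^1_v$ for all $a\in G$, and $$\dot B_{\alpha,s,t}(K)=Co_g(L^{s,t}_w)\quad\text{with equivalent norms,}$$ where $l\in\mathcal H_v^{1,\sim}$ is identified with the functional $\psi\mapsto l(\overline\psi)$ in $\mathcal S_0'(K)$; that is, this map is a bijection of $Co_g(L^{s,t}_w)$ onto $\dot B_{\alpha,s,t}(K)$, and there are constants $c,C>0$ with $c\,\|l\|_{\dot B_{\alpha,s,t}}\le\|l\|_{Co_g(L^{s,t}_w)}\le C\,\|l\|_{\dot B_{\alpha,s,t}}$ for all $l\in Co_g(L^{s,t}_w)$. Moreover, for $g=\phi$, $$\|l\|_{Co_\phi(L^{s,t}_w)}=\nu(\mathfrak D^*)^{1/t}\,\|l\|_{\dot B_{\alpha,s,t}}\qquad\text{for all } l\in Co_\phi(L^{s,t}_w)$$ (with $1/\infty=0$); so the norms are equal if the Haar measure of $K^*$ is normalized by $\nu(\mathfrak D^*)=1$. -/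

import Mathlib

open MeasureTheory ValuativeRel Set
open scoped NNReal ENNReal Pointwise

set_option linter.unusedSectionVars false

noncomputable section

namespace LocalFieldWavelet

variable {K : Type*} [Field K] [ValuativeRel K] [TopologicalSpace K]
  [IsNonarchimedeanLocalField K]

/-! ### The local field: absolute value, residue cardinality, fractional ideals -/

/-- The absolute value of the local field `K`: the module `|a|` of the automorphism `x ↦ a x` of
the additive group, i.e. `μ (a • S) = |a| μ S` for every additive Haar measure `μ`, and
`|0| = 0`. -/
def kabs (a : K) : ℝ≥0 :=
  open Classical in if ha : a = 0 then 0 else distribHaarChar K (Units.mk0 a ha)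

variable (K) in
/-- The cardinality `q` of the residue field. -/
def resCard : ℕ := Nat.card 𝓀[K]

variable (K) in
/-- The fractional ideal `𝔓^k = {x : |x| ≤ q^{-k}}`; in particular `𝔓^0 = 𝔇` is the ring of
integers. -/
def fracIdeal (k : ℤ) : Set K := {x | (kabs x : ℝ) ≤ (resCard K : ℝ) ^ (-k)}

variable (K) in
/-- The function `Φ_k = q^k 1_{𝔓^k} - q^{k-1} 1_{𝔓^{k-1}}` on `K`. -/
def besovKernel (k : ℤ) (x : K) : ℂ :=
  (resCard K : ℂ) ^ k * (fracIdeal K k).indicator (fun _ => (1 : ℂ)) x -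
    (resCard K : ℂ) ^ (k - 1) * (fracIdeal K (k - 1)).indicator (fun _ => (1 : ℂ)) x

variable (K) in
/-- The wavelet `φ = 1_𝔇 - q^{-1} 1_{𝔓^{-1}}`. -/
def haarWavelet (x : K) : ℂ :=
  (fracIdeal K 0).indicator (fun _ => (1 : ℂ)) x -
    (resCard K : ℂ)⁻¹ * (fracIdeal K (-1)).indicator (fun _ => (1 : ℂ)) x

/-! ### Auxiliary facts on the local field -/

lemma kabs_units (u : Kˣ) : kabs (u : K) = distribHaarChar K u := by
  simp [kabs]

lemma isCompact_int : IsCompact {x : K | valuation K x ≤ 1} :=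
  IsNonarchimedeanLocalField.isCompact_closedBall K 1

lemma isClopen_int : IsClopen {x : K | valuation K x ≤ 1} :=
  Valuation.isClopen_integer (v := valuation K)

section haar

variable [MeasurableSpace K] [BorelSpace K] (μ : Measure K) [μ.IsAddHaarMeasure] [μ.Regular]

lemma measure_int_ne_zero : μ {x : K | valuation K x ≤ 1} ≠ 0 :=
  (isClopen_int.isOpen.measure_pos μ ⟨0, by simp⟩).ne'

lemma measure_int_ne_top : μ {x : K | valuation K x ≤ 1} ≠ ∞ :=
  (isCompact_int (K := K)).measure_lt_top.ne

end haar

lemma char_le_one_iff (u : Kˣ) : distribHaarChar K u ≤ 1 ↔ valuation K (u : K) ≤ 1 := by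
  borelize K
  let μ : Measure K := Measure.addHaar
  set O : Set K := {x : K | valuation K x ≤ 1} with hO
  have h0 : μ O ≠ 0 := measure_int_ne_zero μ
  have h1 : μ O ≠ ∞ := measure_int_ne_top μ
  constructor
  · intro hle
    by_contra! hv
    have hv' : valuation K ((u⁻¹ : Kˣ) : K) < 1 := by
      rw [Units.val_inv_eq_inv_val, map_inv₀]
      exact inv_lt_one_of_one_lt₀ hv
    have hA : ∀ x ∈ u⁻¹ • O, valuation K x < 1 := by
      rintro _ ⟨y, hy, rfl⟩
      simp only [smul_eq_mul, map_mul]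
      exact mul_lt_one_of_lt_of_le hv' hy
    have hd : Disjoint (u⁻¹ • O) ((1 : K) +ᵥ (u⁻¹ • O)) := by
      rw [Set.disjoint_left]
      rintro x hx ⟨y, hy, hxy⟩
      have e1 := hA x hx
      have e2 := hA y hy
      have : (1 : K) = x - y := by rw [← hxy]; simp
      have e3 : valuation K (1 : K) < 1 := by
        rw [this]
        exact (Valuation.map_sub _ _ _).trans_lt (max_lt e1 e2)
      simp at e3
    have hsub : (u⁻¹ • O) ∪ ((1 : K) +ᵥ (u⁻¹ • O)) ⊆ O := by
      rintro x (hx | ⟨y, hy, rfl⟩)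
      · exact (hA x hx).le
      · exact (Valuation.map_add _ _ _).trans (max_le (by simp) (hA y hy).le)
    have hm : MeasurableSet (u⁻¹ • O) :=
      (isClopen_int.isClosed.smul u⁻¹).measurableSet
    have hle2 := measure_mono (μ := μ) hsub
    rw [measure_union' hd hm, measure_vadd, ← distribHaarChar_mul, ← two_mul, ← mul_assoc] at hle2
    have h3 : (2 : ℝ≥0∞) * (distribHaarChar K u⁻¹ : ℝ≥0∞) ≤ 1 := by
      by_contra! h
      have := ENNReal.mul_lt_mul_left h0 h1 h
      rw [one_mul] at this
      exact absurd hle2 (not_le.2 this)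
    have h4 : (2 : ℝ≥0) * distribHaarChar K u⁻¹ ≤ 1 := by exact_mod_cast h3
    have h5 : distribHaarChar K u * distribHaarChar K u⁻¹ = 1 := by
      rw [← map_mul]; simp
    have h6 : (1 : ℝ≥0) ≤ distribHaarChar K u⁻¹ := by
      calc (1 : ℝ≥0) = distribHaarChar K u * distribHaarChar K u⁻¹ := h5.symm
        _ ≤ 1 * distribHaarChar K u⁻¹ := by gcongr
        _ = _ := one_mul _
    have h7 : (2 : ℝ≥0) * 1 ≤ 1 := (mul_le_mul_right h6 2).trans h4
    norm_num at h7
  · intro hv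
    have hsub : u • O ⊆ O := by
      rintro _ ⟨y, hy, rfl⟩
      simp only [smul_eq_mul, hO, mem_ofPred_eq, map_mul]
      exact mul_le_one' hv hy
    have hle := measure_mono (μ := μ) hsub
    rw [← distribHaarChar_mul] at hle
    by_contra! h
    have h' : (1 : ℝ≥0∞) < distribHaarChar K u := by exact_mod_cast h
    have := ENNReal.mul_lt_mul_left h0 h1 h'
    rw [one_mul] at this
    exact absurd hle (not_le.2 this)

lemma resCard_pos : 0 < resCard K := Nat.card_pos

variable (K) in
/-- A prime element has absolute value `q^{-1}`. -/
lemma exists_char_eq : ∃ u : Kˣ, (distribHaarChar K u : ℝ) = (resCard K : ℝ)⁻¹ := by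
  obtain ⟨p, hp⟩ := IsDiscreteValuationRing.exists_irreducible 𝒪[K]
  have hp0 : (p : K) ≠ 0 := fun h => hp.ne_zero (Subtype.ext h)
  refine ⟨Units.mk0 (p : K) hp0, ?_⟩
  set u : Kˣ := Units.mk0 (p : K) hp0
  borelize K
  let μ : Measure K := Measure.addHaar
  set O : Set K := {x : K | valuation K x ≤ 1} with hO
  have h0 : μ O ≠ 0 := measure_int_ne_zero μ
  have h1 : μ O ≠ ∞ := measure_int_ne_top μ
  let sec : 𝓀[K] → 𝒪[K] := Function.surjInv IsLocalRing.residue_surjective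
  have hsec : ∀ c, IsLocalRing.residue 𝒪[K] (sec c) = c :=
    Function.surjInv_eq IsLocalRing.residue_surjective
  have hmem : ∀ z : 𝒪[K], IsLocalRing.residue 𝒪[K] z = 0 ↔ (z : K) ∈ u • O := by
    intro z
    rw [IsLocalRing.residue_eq_zero_iff, hp.maximalIdeal_eq, Ideal.mem_span_singleton]
    constructor
    · rintro ⟨w, rfl⟩
      exact ⟨(w : K), w.2, by simp [u]⟩
    · rintro ⟨w, hw, hz⟩
      refine ⟨⟨w, hw⟩, Subtype.ext ?_⟩
      rw [← hz]
      simp [u]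
  have hunion : O = ⋃ c : 𝓀[K], ((sec c : K) +ᵥ (u • O)) := by
    ext x
    simp only [mem_iUnion]
    constructor
    · intro hx
      refine ⟨IsLocalRing.residue 𝒪[K] ⟨x, hx⟩, ?_⟩
      rw [Set.mem_vadd_set_iff_neg_vadd_mem]
      have := (hmem (⟨x, hx⟩ - sec (IsLocalRing.residue 𝒪[K] ⟨x, hx⟩))).1
        (by rw [map_sub, hsec, sub_self])
      simpa [sub_eq_add_neg, add_comm] using this
    · rintro ⟨c, _, ⟨y, hy, rfl⟩, rfl⟩
      have h2 : valuation K ((u : K) * y) ≤ 1 := by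
        rw [map_mul]
        exact mul_le_one' p.2 hy
      exact (Valuation.map_add _ _ _).trans (max_le (sec c).2 h2)
  have hdisj : Pairwise (Function.onFun Disjoint fun c : 𝓀[K] => ((sec c : K) +ᵥ (u • O))) := by
    intro c d hcd
    rw [Function.onFun, Set.disjoint_left]
    intro x hx hy
    apply hcd
    have hxO : x ∈ O := hunion ▸ mem_iUnion.2 ⟨c, hx⟩
    have key : ∀ e : 𝓀[K], x ∈ ((sec e : K) +ᵥ (u • O)) →
        IsLocalRing.residue 𝒪[K] ⟨x, hxO⟩ = e := by
      intro e he
      rw [Set.mem_vadd_set_iff_neg_vadd_mem] at he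
      have := (hmem (⟨x, hxO⟩ - sec e)).2 (by simpa [sub_eq_add_neg, add_comm] using he)
      rwa [map_sub, hsec, sub_eq_zero] at this
    rw [← key c hx, ← key d hy]
  have hmeas : MeasurableSet (u • O) := (isClopen_int.isClosed.smul u).measurableSet
  have hcount : μ O = (resCard K : ℝ≥0∞) * (distribHaarChar K u * μ O) := by
    conv_lhs => rw [hunion]
    rw [measure_iUnion hdisj (fun c => hmeas.const_vadd _)]
    simp only [measure_vadd, ← distribHaarChar_mul]
    rw [ENNReal.tsum_const, ENat.card_eq_coe_natCard]
    rfl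
  have h2 : (resCard K : ℝ≥0∞) * (distribHaarChar K u : ℝ≥0∞) = 1 := by
    rw [← mul_assoc] at hcount
    have := hcount.symm
    nth_rewrite 2 [← one_mul (μ O)] at this
    exact (ENNReal.mul_left_inj h0 h1).1 this
  have h3 : (resCard K : ℝ≥0) * distribHaarChar K u = 1 := by exact_mod_cast h2
  have h4 : (resCard K : ℝ) * (distribHaarChar K u : ℝ) = 1 := by exact_mod_cast h3
  exact eq_inv_of_mul_eq_one_right h4

lemma fracIdeal_eq {u : Kˣ} (hu : (distribHaarChar K u : ℝ) = (resCard K : ℝ)⁻¹) (k : ℤ) :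
    fracIdeal K k = (u ^ k) • {x : K | valuation K x ≤ 1} := by
  have hk : ((distribHaarChar K (u ^ k) : ℝ≥0) : ℝ) = (resCard K : ℝ) ^ (-k) := by
    rw [map_zpow, NNReal.coe_zpow, hu, inv_zpow, zpow_neg]
  ext x
  rw [Set.mem_smul_set_iff_inv_smul_mem, fracIdeal, mem_ofPred_eq, ← hk, NNReal.coe_le_coe]
  by_cases hx : x = 0
  · simp [hx, kabs]
  · obtain ⟨y, rfl⟩ : ∃ y : Kˣ, (y : K) = x := ⟨Units.mk0 x hx, rfl⟩
    rw [kabs_units]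
    have := char_le_one_iff ((u ^ k)⁻¹ * y)
    rw [map_mul, map_inv, inv_mul_le_iff₀ distribHaarChar_pos, mul_one] at this
    rw [this]
    simp [Units.smul_def]

lemma isCompact_fracIdeal (k : ℤ) : IsCompact (fracIdeal K k) := by
  obtain ⟨u, hu⟩ := exists_char_eq K
  rw [fracIdeal_eq hu]
  exact isCompact_int.smul _

lemma isClopen_fracIdeal (k : ℤ) : IsClopen (fracIdeal K k) := by
  obtain ⟨u, hu⟩ := exists_char_eq K
  rw [fracIdeal_eq hu]
  exact ⟨isClopen_int.isClosed.smul _, isClopen_int.isOpen.smul _⟩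

/-! ### Test functions with vanishing mean and their dual -/

section measure

variable [MeasurableSpace K] [BorelSpace K] (μ : Measure K) [μ.IsAddHaarMeasure] [μ.Regular]

lemma measureReal_fracIdeal (k : ℤ) :
    μ.real (fracIdeal K k) = (resCard K : ℝ) ^ (-k) * μ.real {x : K | valuation K x ≤ 1} := by
  obtain ⟨u, hu⟩ := exists_char_eq K
  rw [fracIdeal_eq hu, measureReal_def, ← distribHaarChar_mul, ENNReal.toReal_mul,
    ENNReal.coe_toReal, map_zpow, NNReal.coe_zpow, hu, inv_zpow, zpow_neg, measureReal_def]

/-- `𝒮₀(K)`: the locally constant, compactly supported functions `K → ℂ` with integral zero. -/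
def testSpace : Submodule ℂ (K → ℂ) where
  carrier := {f | IsLocallyConstant f ∧ HasCompactSupport f ∧ ∫ x, f x ∂μ = 0}
  zero_mem' := ⟨IsLocallyConstant.const 0, HasCompactSupport.zero, by simp⟩
  add_mem' := by
    rintro f g ⟨hf, hf', hf0⟩ ⟨hg, hg', hg0⟩
    refine ⟨hf.add hg, hf'.add hg', ?_⟩
    have := integral_add (μ := μ) (hf.continuous.integrable_of_hasCompactSupport hf')
      (hg.continuous.integrable_of_hasCompactSupport hg')
    simpa [hf0, hg0] using this
  smul_mem' := by
    rintro c f ⟨hf, hf', hf0⟩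
    refine ⟨hf.comp (c • ·), hf'.comp_left (g := (c • ·)) (by simp), ?_⟩
    simp [integral_const_mul, hf0]

/-- `𝒮₀'(K)`: the dual of `𝒮₀(K)`. The space `𝒮₀(K)` carries the inductive limit topology of the
finite-dimensional spaces of functions in `𝒮₀(K)` that are supported in `𝔓^l` and constant on the
cosets of `𝔓^k`, so that every linear functional is continuous. -/
abbrev TestDual : Type _ := Module.Dual ℂ (testSpace μ)

lemma besovKernel_mem (k : ℤ) : besovKernel K k ∈ testSpace μ := by
  have hind : ∀ (c : ℂ) (j : ℤ),
      IsLocallyConstant (fun x => c * (fracIdeal K j).indicator (fun _ => (1 : ℂ)) x) := by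
    intro c j
    exact (LocallyConstant.charFn ℂ (isClopen_fracIdeal j)).isLocallyConstant.comp (c * ·)
  have hcs : ∀ (c : ℂ) (j : ℤ),
      HasCompactSupport (fun x => c * (fracIdeal K j).indicator (fun _ => (1 : ℂ)) x) := by
    intro c j
    refine HasCompactSupport.intro (isCompact_fracIdeal j) fun x hx => ?_
    simp [hx]
  have hq : (resCard K : ℂ) ≠ 0 := by exact_mod_cast (resCard_pos (K := K)).ne'
  have hint : ∀ j : ℤ, ∫ x, (resCard K : ℂ) ^ j *
      (fracIdeal K j).indicator (fun _ => (1 : ℂ)) x ∂μ =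
        (μ.real {x : K | valuation K x ≤ 1} : ℂ) := by
    intro j
    rw [integral_const_mul, integral_indicator (isClopen_fracIdeal j).isOpen.measurableSet,
      setIntegral_const, measureReal_fracIdeal]
    simp only [smul_eq_mul, mul_one, Complex.real_smul]
    push_cast
    rw [zpow_neg, mul_inv_cancel_left₀ (zpow_ne_zero j hq)]
  refine ⟨?_, ?_, ?_⟩
  · exact (hind _ k).sub (hind _ (k - 1))
  · exact (hcs _ k).sub (hcs _ (k - 1))
  · have := integral_sub (μ := μ)
      ((hind ((resCard K : ℂ) ^ k) k).continuous.integrable_of_hasCompactSupport (hcs _ k))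
      ((hind ((resCard K : ℂ) ^ (k - 1)) (k - 1)).continuous.integrable_of_hasCompactSupport
        (hcs _ (k - 1)))
    rw [hint, hint, sub_self] at this
    exact this

lemma reflect_mem {f : K → ℂ} (hf : f ∈ testSpace μ) (x : K) :
    (fun y => f (x - y)) ∈ testSpace μ := by
  obtain ⟨h1, h2, h3⟩ := hf
  refine ⟨h1.comp_continuous (continuous_const.sub continuous_id), ?_, ?_⟩
  · exact h2.comp_homeomorph (Homeomorph.subLeft x)
  · rw [integral_sub_left_eq_self f μ x, h3]

lemma conj_mem {f : K → ℂ} (hf : f ∈ testSpace μ) : (fun y => star (f y)) ∈ testSpace μ := by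
  obtain ⟨h1, h2, h3⟩ := hf
  refine ⟨h1.comp star, h2.comp_left (g := star) (by simp), ?_⟩
  have : ∫ x, star (f x) ∂μ = star (∫ x, f x ∂μ) := integral_conj
  rw [this, h3, star_zero]

lemma haarWavelet_mem : haarWavelet K ∈ testSpace μ := by
  have : haarWavelet K = besovKernel K 0 := by
    funext x; simp [haarWavelet, besovKernel]
  rw [this]
  exact besovKernel_mem μ 0

lemma memLp_of_mem {f : K → ℂ} (hf : f ∈ testSpace μ) : MemLp f 2 μ :=
  hf.1.continuous.memLp_of_hasCompactSupport hf.2.1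

/-- The inclusion `𝒮₀(K) ⊆ L²(K)`. -/
def testToL2 (f : testSpace μ) : Lp ℂ 2 μ := (memLp_of_mem μ f.2).toLp

/-- The wavelet `φ = 1_𝔇 - q^{-1} 1_{𝔓^{-1}}` as an element of `L²(K)`. -/
def haarWaveletL2 : Lp ℂ 2 μ := testToL2 μ ⟨haarWavelet K, haarWavelet_mem μ⟩

/-! ### Homogeneous Besov spaces -/

/-- The convolution `(f * Φ_k)(x) = f(Φ_k(x - ·))` for `f ∈ 𝒮₀'(K)`. -/
def convKernel (f : TestDual μ) (k : ℤ) (x : K) : ℂ :=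
  f ⟨fun y => besovKernel K k (x - y), reflect_mem μ (besovKernel_mem μ k) x⟩

/-- The Besov norm `(∑_k q^{kαt} ‖f * Φ_k‖_s^t)^{1/t}` (a supremum if `t = ∞`), as an extended
nonnegative real. -/
def besovNorm (α : ℝ) (s t : ℝ≥0∞) (f : TestDual μ) : ℝ≥0∞ :=
  if t = ∞ then
    ⨆ k : ℤ, ENNReal.ofReal ((resCard K : ℝ) ^ ((k : ℝ) * α)) * eLpNorm (convKernel μ f k) s μ
  else
    (∑' k : ℤ, ENNReal.ofReal ((resCard K : ℝ) ^ ((k : ℝ) * α * t.toReal)) *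
      eLpNorm (convKernel μ f k) s μ ^ t.toReal) ^ (1 / t.toReal)

/-- The homogeneous Besov space. -/
def besovSpace (α : ℝ) (s t : ℝ≥0∞) : Set (TestDual μ) := {f | besovNorm μ α s t f < ∞}

end measure

/-! ### The affine group `G = K ⋊ Kˣ`, with underlying topological and measurable space `K × Kˣ` -/

/-- `(x,h)(y,k) = (h y + x, h k)`. -/
def affMul (a b : K × Kˣ) : K × Kˣ := ((a.2 : K) * b.1 + a.1, a.2 * b.2)

/-- `(x,h)⁻¹ = (-h⁻¹ x, h⁻¹)`. -/
def affInv (a : K × Kˣ) : K × Kˣ := (-(((a.2⁻¹ : Kˣ) : K) * a.1), a.2⁻¹)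

/-- The modular function `Δ(x,h) = |h|⁻¹`. -/
def affMod (a : K × Kˣ) : ℝ := ((kabs (a.2 : K) : ℝ))⁻¹

/-- Left translation `(L_a F)(b) = F(a⁻¹ b)`. -/
def leftTrans (a : K × Kˣ) (F : K × Kˣ → ℂ) : K × Kˣ → ℂ := fun b => F (affMul (affInv a) b)

/-- Right translation `(R_a F)(b) = F(b a)`. -/
def rightTrans (a : K × Kˣ) (F : K × Kˣ → ℂ) : K × Kˣ → ℂ := fun b => F (affMul b a)

section group

variable [MeasurableSpace K] [BorelSpace K] (μ : Measure K) [μ.IsAddHaarMeasure] [μ.Regular]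
  (ν : Measure Kˣ)

/-- The left Haar measure `dx dh / |h|` of `G`, where `ν = dh` is a Haar measure of `Kˣ`. -/
def affHaar : Measure (K × Kˣ) :=
  μ.prod (ν.withDensity fun h => ((kabs (h : K) : ℝ≥0∞))⁻¹)

/-- The mixed norm `‖F‖_{L^{s,t}_w} = (∫_{Kˣ} ‖w(·,h) F(·,h)‖_s^t dν(h))^{1/t}` (an essential
supremum in `h` if `t = ∞`), as an extended nonnegative real. -/
def mixedNorm (w : K × Kˣ → ℝ) (s t : ℝ≥0∞) (F : K × Kˣ → ℂ) : ℝ≥0∞ :=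
  if t = ∞ then
    essSup (fun h : Kˣ => eLpNorm (fun x : K => (w (x, h) : ℂ) * F (x, h)) s μ) ν
  else
    (∫⁻ h : Kˣ, eLpNorm (fun x : K => (w (x, h) : ℂ) * F (x, h)) s μ ^ t.toReal ∂ν) ^
      (1 / t.toReal)

/-- The weighted mixed Lebesgue space `L^{s,t}_w`. -/
def mixedSpace (w : K × Kˣ → ℝ) (s t : ℝ≥0∞) : Set (K × Kˣ → ℂ) :=
  {F | Measurable F ∧ mixedNorm μ ν w s t F < ∞}

/-- The weight `w(x,h) = |h|^{-α - 1/2}`. -/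
def besovWeight (α : ℝ) (a : K × Kˣ) : ℝ := (kabs (a.2 : K) : ℝ) ^ (-α - 1 / 2)

/-- The operator `A` maps the function space `Y = L^{s,t}_w` into itself, with norm at most `c`. -/
def OpNormLE (w : K × Kˣ → ℝ) (s t : ℝ≥0∞)
    (A : (K × Kˣ → ℂ) → (K × Kˣ → ℂ)) (c : ℝ) : Prop :=
  ∀ F ∈ mixedSpace μ ν w s t, A F ∈ mixedSpace μ ν w s t ∧
    mixedNorm μ ν w s t (A F) ≤ ENNReal.ofReal c * mixedNorm μ ν w s t F

/-- `v` is a control weight for `Y = L^{s,t}_w`: a measurable, locally bounded, submultiplicative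
weight on `G` with
`v(a) ≥ max {‖L_a‖, ‖L_{a⁻¹}‖, ‖R_a‖, ‖R_{a⁻¹}‖ Δ(a⁻¹)}` (operator norms on `Y`) and
`v(a) = v(a⁻¹) Δ(a⁻¹)`. -/
structure IsControlWeight (w : K × Kˣ → ℝ) (s t : ℝ≥0∞) (v : K × Kˣ → ℝ) : Prop where
  pos : ∀ a, 0 < v a
  measurable : Measurable v
  bounded : ∀ C : Set (K × Kˣ), IsCompact C → BddAbove (v '' C)
  submul : ∀ a b, v (affMul a b) ≤ v a * v b
  left : ∀ a, OpNormLE μ ν w s t (leftTrans a) (v a)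
  left_inv : ∀ a, OpNormLE μ ν w s t (leftTrans (affInv a)) (v a)
  right : ∀ a, OpNormLE μ ν w s t (rightTrans a) (v a)
  right_inv : ∀ a, OpNormLE μ ν w s t (rightTrans (affInv a)) (v a / affMod (affInv a))
  symm : ∀ a, v a = v (affInv a) * affMod (affInv a)

/-! ### The quasi-regular representation and the wavelet transform -/

lemma memLp_affine (a : K × Kˣ) {g : K → ℂ} (hg : MemLp g 2 μ) :
    MemLp (fun y => (((kabs (a.2 : K) : ℝ) ^ (-(1 / 2 : ℝ)) : ℝ) : ℂ) *
      g (((a.2⁻¹ : Kˣ) : K) * (y - a.1))) 2 μ := by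
  have hmap : Measure.map (fun y : K => ((a.2⁻¹ : Kˣ) : K) * (y - a.1)) μ =
      (distribHaarChar K a.2 : ℝ≥0∞) • μ := by
    let e : K ≃ₜ K := (Homeomorph.subRight a.1).trans (Homeomorph.smul a.2⁻¹)
    have he : (fun y : K => ((a.2⁻¹ : Kˣ) : K) * (y - a.1)) = e := by
      funext y; simp [e, Units.smul_def]
    ext S hS
    rw [he, Measure.map_apply e.continuous.measurable hS]
    have hpre : e ⁻¹' S = a.1 +ᵥ (a.2 • S) := by
      ext y
      rw [Set.mem_vadd_set_iff_neg_vadd_mem, Set.mem_smul_set_iff_inv_smul_mem]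
      simp [e, sub_eq_add_neg, add_comm]
    rw [hpre, measure_vadd, ← distribHaarChar_mul, Measure.smul_apply, smul_eq_mul]
  have h1 : MemLp g 2 (Measure.map (fun y : K => ((a.2⁻¹ : Kˣ) : K) * (y - a.1)) μ) := by
    rw [hmap]
    exact hg.smul_measure ENNReal.coe_ne_top
  have hm : Continuous (fun y : K => ((a.2⁻¹ : Kˣ) : K) * (y - a.1)) := by fun_prop
  exact (h1.comp_of_map hm.measurable.aemeasurable).const_mul _

/-- The quasi-regular representation of `G` on `L²(K)`:
`(π(x,h) g)(y) = |h|^{-1/2} g(h⁻¹ (y - x))`. -/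
def quasiRegular (a : K × Kˣ) (g : Lp ℂ 2 μ) : Lp ℂ 2 μ :=
  (memLp_affine μ a (Lp.memLp g)).toLp

/-- The wavelet transform `W_g f(a) = ⟨f | π(a) g⟩`, linear in `f`; Mathlib's inner product is
linear in its second argument. -/
def waveletTransform (g f : Lp ℂ 2 μ) (a : K × Kˣ) : ℂ := inner ℂ (quasiRegular μ a g) f

/-! ### Coorbit spaces -/

/-- The space of test vectors `ℋ¹_v = {f ∈ L²(K) : W_g f ∈ L¹_v(G)}`, built with the vector `g`. -/
def testVectors (v : K × Kˣ → ℝ) (g : Lp ℂ 2 μ) : Submodule ℂ (Lp ℂ 2 μ) where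
  carrier := {f | Integrable (fun a => (v a : ℂ) * waveletTransform μ g f a) (affHaar μ ν)}
  zero_mem' := by simp [waveletTransform]
  add_mem' := by
    intro f f' hf hf'
    refine (hf.add hf').congr (Filter.Eventually.of_forall fun a => ?_)
    simp [waveletTransform, inner_add_right, mul_add]
  smul_mem' := by
    intro c f hf
    refine (hf.const_mul c).congr (Filter.Eventually.of_forall fun a => ?_)
    simp [waveletTransform, inner_smul_right, mul_left_comm]

/-- The norm `‖f‖_{ℋ¹_v} = ‖W_g f‖_{L¹_v}`. -/
def testVectorNorm (v : K × Kˣ → ℝ) (g f : Lp ℂ 2 μ) : ℝ :=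
  ∫ a, ‖(v a : ℂ) * waveletTransform μ g f a‖ ∂(affHaar μ ν)

/-- `g` is a nonzero analyzing vector: `W_g g ∈ L¹_v(G)`. -/
def IsAnalyzing (v : K × Kˣ → ℝ) (g : Lp ℂ 2 μ) : Prop := g ≠ 0 ∧ g ∈ testVectors μ ν v g

/-- The reservoir `ℋ_v^{1,~}`: the continuous conjugate-linear functionals on `ℋ¹_v` (built with
the vector `g₀`). -/
def reservoir (v : K × Kˣ → ℝ) (g₀ : Lp ℂ 2 μ) :
    Set (testVectors μ ν v g₀ →ₛₗ[starRingEnd ℂ] ℂ) :=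
  {l | ∃ C : ℝ, ∀ f, ‖l f‖ ≤ C * testVectorNorm μ ν v g₀ f}

variable {μ ν} in
/-- The extended wavelet transform `W_g l(a) = ⟨l | π(a) g⟩ = l(π(a) g)` of a conjugate-linear
functional `l` on `ℋ¹_v`, for `g` with orbit in `ℋ¹_v`. -/
def extWavelet {v : K × Kˣ → ℝ} {g₀ g : Lp ℂ 2 μ}
    (hg : ∀ a, quasiRegular μ a g ∈ testVectors μ ν v g₀)
    (l : testVectors μ ν v g₀ →ₛₗ[starRingEnd ℂ] ℂ) (a : K × Kˣ) : ℂ :=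
  l ⟨quasiRegular μ a g, hg a⟩

variable {μ ν} in
/-- The coorbit space `Co_g(L^{s,t}_w) = {l ∈ ℋ_v^{1,~} : W_g l ∈ L^{s,t}_w}`. -/
def coorbitSpace {v : K × Kˣ → ℝ} {g₀ g : Lp ℂ 2 μ}
    (hg : ∀ a, quasiRegular μ a g ∈ testVectors μ ν v g₀) (w : K × Kˣ → ℝ) (s t : ℝ≥0∞) :
    Set (testVectors μ ν v g₀ →ₛₗ[starRingEnd ℂ] ℂ) :=
  {l | l ∈ reservoir μ ν v g₀ ∧ extWavelet hg l ∈ mixedSpace μ ν w s t}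

variable {μ ν} in
/-- The coorbit norm `‖l‖_{Co_g(L^{s,t}_w)} = ‖W_g l‖_{L^{s,t}_w}`. -/
def coorbitNorm {v : K × Kˣ → ℝ} {g₀ g : Lp ℂ 2 μ}
    (hg : ∀ a, quasiRegular μ a g ∈ testVectors μ ν v g₀) (w : K × Kˣ → ℝ) (s t : ℝ≥0∞)
    (l : testVectors μ ν v g₀ →ₛₗ[starRingEnd ℂ] ℂ) : ℝ≥0∞ :=
  mixedNorm μ ν w s t (extWavelet hg l)

variable {μ ν} in
/-- The natural map from conjugate-linear functionals on `ℋ¹_v ⊇ 𝒮₀(K)` to `𝒮₀'(K)`: restriction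
to `𝒮₀(K)`, made linear by conjugating the argument. -/
def toTestDual {v : K × Kˣ → ℝ} {g₀ : Lp ℂ 2 μ}
    (hS : ∀ ψ : testSpace μ, testToL2 μ ψ ∈ testVectors μ ν v g₀)
    (l : testVectors μ ν v g₀ →ₛₗ[starRingEnd ℂ] ℂ) : TestDual μ where
  toFun ψ := l ⟨testToL2 μ ⟨fun y => star (ψ.1 y), conj_mem μ ψ.2⟩, hS _⟩
  map_add' ψ χ := by
    rw [← map_add]
    congr 1
    apply Subtype.ext
    change testToL2 μ _ = testToL2 μ _ + testToL2 μ _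
    simp only [testToL2]
    rw [← MemLp.toLp_add]
    congr 1
    funext y
    simp
  map_smul' c ψ := by
    have : (⟨testToL2 μ ⟨fun y => star ((c • ψ).1 y), conj_mem μ (c • ψ).2⟩, hS _⟩ :
        testVectors μ ν v g₀) =
        (starRingEnd ℂ c) •
          ⟨testToL2 μ ⟨fun y => star (ψ.1 y), conj_mem μ ψ.2⟩, hS _⟩ := by
      apply Subtype.ext
      change testToL2 μ _ = (starRingEnd ℂ c) • testToL2 μ _
      simp only [testToL2]
      rw [← MemLp.toLp_const_smul]
      congr 1
      funext y
      simp
    rw [this, map_smulₛₗ]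
    simp

end group

end LocalFieldWavelet

end

open LocalFieldWavelet

open MeasureTheory ValuativeRel Set
open scoped NNReal ENNReal Pointwise

set_option linter.unusedSectionVars false
set_option linter.overlappingInstances false

noncomputable section

namespace LocalFieldWavelet

variable {K : Type*} [Field K] [ValuativeRel K] [TopologicalSpace K]
  [IsNonarchimedeanLocalField K]

/-! ### The absolute value and the fractional ideals -/

/-! The wavelet φ is Φ_0, and for |h| = q^{-k} the vector π(x,h)φ is |h|^{1/2} Φ_k(x - ·), an atom.
If l restricts to f on 𝒮₀(K), then W_φ l(x,h) = |h|^{1/2} (f * Φ_k)(x). The weight |h|^{-α-1/2}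
turns the factor into |h|^{-α} = q^{kα}. The sphere |h| = q^{-k} has mass ν(𝔇*), so the integral
over Kˣ is ν(𝔇*) times a sum over k. This gives the exact norm identity for g = φ
(`mixedNorm_atom`). Three points remain: other analyzing vectors give equivalent norms, l is
determined by f, and every f in the Besov space comes from some l.

Two features of φ carry the rest. It is fixed by the compact open subgroup U = 𝔇 ⋊ 𝔇*, so a ↦ π(a)φ
is constant on the cosets aU, and integrals of such functions are sums over the countable set G/U
(`hasSum_coset`). Moreover Φ_k * Φ_0 = 0 for k ≠ 0, so the reproducing kernel W_φ φ has compact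
support (`waveletKernel_eq`) and lies in L¹_v for every weight bounded on compact sets.

The analytic core is the orthogonality relation `integral_waveletTransform_mul_waveletKernel`. Since
the atoms are total in L²(K) (`eq_zero_of_waveletTransform_eq_zero`), it only has to be checked on
atoms, where it becomes a functional equation of spherical functions: the average of Φ_0(z - hy)
over |h| = 1 is proportional to Φ_0(z)Φ_0(y) (`setIntegral_unit_besovKernel`). It yields the
reproducing formula for φ. It also recovers W_φ f from W_g f by convolution with a compactly
supported kernel, once g is translated so as not to be orthogonal to φ. Hence ℋ¹_v does not depend
on the analyzing vector, up to equivalence of norms.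

The expansion of f ∈ ℋ¹_v into atoms, indexed by G/U, converges in ℋ¹_v, so it may be inserted into
a continuous functional l (`hasSum_functional`). Thus l is determined by its values on atoms, which
belong to 𝒮₀(K); this is injectivity. It also shows that W_g l and W_φ l arise from each other by
convolution with kernels in L¹_v. Since v dominates the norms of right translations of Y,
Minkowski's inequality bounds these convolutions on Y, and the coorbit norms are equivalent.

For surjectivity, the coefficients f(π(a)φ) of a Besov functional f form a function in Y that is
constant on the cosets of U, hence pointwise O(v(a)) (`enorm_le_of_invariant`). Integration against
them defines l in the reservoir. It restricts to f, because a function in 𝒮₀(K) is a finite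
combination of atoms (`exists_functional`). -/

variable (K) in
lemma one_lt_resCard : 1 < resCard K := Finite.one_lt_card

variable (K) in
lemma one_lt_resCard_real : (1 : ℝ) < resCard K := by exact_mod_cast one_lt_resCard K

variable (K) in
lemma resCard_real_pos : (0 : ℝ) < resCard K := zero_lt_one.trans (one_lt_resCard_real K)

@[simp] lemma kabs_zero : kabs (0 : K) = 0 := by simp [kabs]

@[simp] lemma kabs_one : kabs (1 : K) = 1 := by
  simpa using kabs_units (K := K) 1

lemma kabs_units_pos (h : Kˣ) : 0 < kabs (h : K) := by
  rw [kabs_units]; exact distribHaarChar_pos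

lemma kabs_units_pos_real (h : Kˣ) : (0 : ℝ) < kabs (h : K) := by
  exact_mod_cast kabs_units_pos h

@[simp] lemma kabs_mul (x y : K) : kabs (x * y) = kabs x * kabs y := by
  by_cases hx : x = 0
  · simp [hx]
  by_cases hy : y = 0
  · simp [hy]
  lift x to Kˣ using IsUnit.mk0 x hx
  lift y to Kˣ using IsUnit.mk0 y hy
  rw [← Units.val_mul, kabs_units, kabs_units, kabs_units, map_mul]

lemma kabs_units_inv (h : Kˣ) : kabs ((h⁻¹ : Kˣ) : K) = (kabs (h : K))⁻¹ := by
  rw [kabs_units, kabs_units, map_inv]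

lemma kabs_eq_zero {x : K} : kabs x = 0 ↔ x = 0 := by
  refine ⟨fun h => ?_, fun h => by simp [h]⟩
  by_contra hx
  exact (kabs_units_pos (Units.mk0 x hx)).ne' h

lemma kabs_le_one_iff (x : K) : kabs x ≤ 1 ↔ valuation K x ≤ 1 := by
  by_cases hx : x = 0
  · simp [hx]
  lift x to Kˣ using IsUnit.mk0 x hx
  rw [kabs_units, char_le_one_iff]

@[simp] lemma kabs_neg (x : K) : kabs (-x) = kabs x := by
  have h1 : kabs (-1 : K) = 1 := by
    have h2 : kabs (-1 : K) * kabs (-1 : K) = 1 := by rw [← kabs_mul]; simp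
    have h3 : kabs (-1 : K) ≤ 1 := (kabs_le_one_iff _).2 (by simp)
    refine le_antisymm h3 ?_
    calc (1 : ℝ≥0) = kabs (-1 : K) * kabs (-1 : K) := h2.symm
      _ ≤ kabs (-1 : K) * 1 := by gcongr
      _ = _ := mul_one _
  rw [neg_eq_neg_one_mul, kabs_mul, h1, one_mul]

/-- The module and the valuation have only been compared at the value 1, so one divides by the
larger of the two elements and works in the valuation ring. -/
lemma kabs_add_le (x y : K) : kabs (x + y) ≤ max (kabs x) (kabs y) := by
  wlog hxy : kabs x ≤ kabs y generalizing x y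
  · rw [add_comm, max_comm]
    exact this y x (le_of_not_ge hxy)
  rw [max_eq_right hxy]
  by_cases hy : y = 0
  · subst hy
    have : kabs x = 0 := le_antisymm (by simpa using hxy) (zero_le)
    simp [kabs_eq_zero.1 this]
  have h1 : kabs (x * y⁻¹) ≤ 1 := by
    have h2 : kabs y * kabs y⁻¹ = 1 := by rw [← kabs_mul, mul_inv_cancel₀ hy, kabs_one]
    rw [kabs_mul, ← h2]
    gcongr
  have h3 : x + y = (x * y⁻¹ + 1) * y := by field_simp
  have h4 : kabs (x * y⁻¹ + 1) ≤ 1 := by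
    rw [kabs_le_one_iff] at h1 ⊢
    exact (Valuation.map_add _ _ _).trans (max_le h1 (by simp))
  rw [h3, kabs_mul]
  exact mul_le_of_le_one_left' h4

lemma kabs_integer_unit (z : 𝒪[K]ˣ) : kabs ((z : 𝒪[K]) : K) = 1 := by
  have h1 : kabs ((z : 𝒪[K]) : K) ≤ 1 := (kabs_le_one_iff _).2 z.val.2
  have h2 : kabs (((z⁻¹ : 𝒪[K]ˣ) : 𝒪[K]) : K) ≤ 1 := (kabs_le_one_iff _).2 (z⁻¹).val.2
  have h3 : kabs ((z : 𝒪[K]) : K) * kabs (((z⁻¹ : 𝒪[K]ˣ) : 𝒪[K]) : K) = 1 := by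
    rw [← kabs_mul, ← kabs_one (K := K)]
    congr 1
    have := congrArg (Subtype.val) z.mul_inv
    exact this
  refine le_antisymm h1 ?_
  rw [← h3]
  exact mul_le_of_le_one_right' h2

/-- The translates of p𝔇 by representatives of the residue classes are q disjoint subsets of 𝔇, each
of measure |p| times that of 𝔇. Equality for this p is deduced in `exists_kabs_eq_zpow`. -/
lemma resCard_mul_kabs_irreducible_le {p : 𝒪[K]} (hp : Irreducible p) :
    (resCard K : ℝ≥0) * kabs (p : K) ≤ 1 := by
  have hp0 : (p : K) ≠ 0 := fun h => hp.ne_zero (Subtype.ext h)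
  set u : Kˣ := Units.mk0 (p : K) hp0
  have hu : kabs (p : K) = distribHaarChar K u := kabs_units u
  rw [hu]
  borelize K
  let μ : Measure K := Measure.addHaar
  set O : Set K := {x : K | valuation K x ≤ 1} with hO
  have h0 : μ O ≠ 0 := measure_int_ne_zero μ
  have h1 : μ O ≠ ∞ := measure_int_ne_top μ
  let sec : 𝓀[K] → 𝒪[K] := Function.surjInv IsLocalRing.residue_surjective
  have hsec : ∀ c, IsLocalRing.residue 𝒪[K] (sec c) = c :=
    Function.surjInv_eq IsLocalRing.residue_surjective
  have hunion : (⋃ c : 𝓀[K], ((sec c : K) +ᵥ (u • O))) ⊆ O := by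
    intro x hx
    obtain ⟨c, _, ⟨y, hy, rfl⟩, rfl⟩ := mem_iUnion.1 hx
    have h2 : valuation K ((u : K) * y) ≤ 1 := by
      rw [map_mul]
      exact mul_le_one' p.2 hy
    exact (Valuation.map_add _ _ _).trans (max_le (sec c).2 h2)
  have hdisj : Pairwise (Function.onFun Disjoint fun c : 𝓀[K] => ((sec c : K) +ᵥ (u • O))) := by
    intro c d hcd
    rw [Function.onFun, Set.disjoint_left]
    rintro x ⟨_, ⟨y, hy, rfl⟩, rfl⟩ ⟨_, ⟨z, hz, rfl⟩, hyz⟩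
    apply hcd
    have h3 : (sec c - sec d : 𝒪[K]) = p * (⟨z, hz⟩ - ⟨y, hy⟩) := by
      apply Subtype.ext
      have : (sec d : K) + (p : K) * z = (sec c : K) + (p : K) * y := hyz
      change (sec c : K) - sec d = (p : K) * (z - y)
      linear_combination -this
    have h4 : IsLocalRing.residue 𝒪[K] (sec c - sec d) = 0 := by
      rw [IsLocalRing.residue_eq_zero_iff, hp.maximalIdeal_eq, Ideal.mem_span_singleton]
      exact ⟨_, h3⟩
    rwa [map_sub, hsec, hsec, sub_eq_zero] at h4
  have hmeas : MeasurableSet (u • O) := (isClopen_int.isClosed.smul u).measurableSet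
  have hcount : (resCard K : ℝ≥0∞) * (distribHaarChar K u * μ O) ≤ μ O := by
    refine le_trans (le_of_eq ?_) (measure_mono hunion)
    rw [measure_iUnion hdisj (fun c => hmeas.const_vadd _)]
    simp only [measure_vadd, ← distribHaarChar_mul]
    rw [ENNReal.tsum_const, ENat.card_eq_coe_natCard]
    rfl
  have h2 : (resCard K : ℝ≥0∞) * (distribHaarChar K u : ℝ≥0∞) ≤ 1 := by
    rw [← mul_assoc] at hcount
    by_contra! h
    have := ENNReal.mul_lt_mul_left h0 h1 h
    rw [one_mul] at this
    exact absurd hcount (not_le.2 this)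
  exact_mod_cast h2

/-- Units of the ring of integers have absolute value 1, so nonzero integers have absolute value
|p|^n for a prime p. The element u of `exists_char_eq` then satisfies q^{-1} = |u| = |p|^n ≤ |p| ≤
q^{-1} with n ≥ 1, which forces |p| = q^{-1}. -/
lemma exists_kabs_eq_zpow (h : Kˣ) : ∃ k : ℤ, (kabs (h : K) : ℝ) = (resCard K : ℝ) ^ (-k) := by
  obtain ⟨p, hp⟩ := IsDiscreteValuationRing.exists_irreducible 𝒪[K]
  have hp0 : (p : K) ≠ 0 := fun h => hp.ne_zero (Subtype.ext h)
  have key : ∀ g : Kˣ, kabs (g : K) ≤ 1 → ∃ n : ℕ, kabs (g : K) = kabs (p : K) ^ n := by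
    intro g hg
    have hg' := (kabs_le_one_iff _).1 hg
    obtain ⟨n, z, hz⟩ := IsDiscreteValuationRing.eq_unit_mul_pow_irreducible
      (x := (⟨(g : K), hg'⟩ : 𝒪[K])) (fun h0 => g.ne_zero (congrArg Subtype.val h0)) hp
    have hz' : (g : K) = ((z : 𝒪[K]) : K) * (p : K) ^ n := congrArg Subtype.val hz
    refine ⟨n, ?_⟩
    rw [hz', kabs_mul, kabs_integer_unit, one_mul]
    clear hz hz'
    induction n with
    | zero => simp
    | succ n ih => rw [pow_succ, pow_succ, kabs_mul, ih]
  have hq := one_lt_resCard_real K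
  have hq0 := resCard_real_pos K
  have hp1 : kabs (p : K) = (resCard K : ℝ≥0)⁻¹ := by
    obtain ⟨u, hu⟩ := exists_char_eq K
    rw [← kabs_units] at hu
    have hu' : kabs (u : K) = (resCard K : ℝ≥0)⁻¹ := NNReal.coe_injective (by simpa using hu)
    have hqn : (1 : ℝ≥0) < resCard K := by exact_mod_cast one_lt_resCard K
    have hu1 : kabs (u : K) < 1 := by rw [hu']; exact inv_lt_one_of_one_lt₀ hqn
    obtain ⟨n, hn⟩ := key u hu1.le
    have hn0 : n ≠ 0 := by rintro rfl; simp [hn] at hu1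
    have h1 := resCard_mul_kabs_irreducible_le hp
    have h2 : kabs (p : K) ≤ (resCard K : ℝ≥0)⁻¹ := by
      rw [← one_div, le_div_iff₀' (zero_lt_one.trans hqn)]
      exact h1
    have h3 : kabs (p : K) ≤ 1 := h2.trans (inv_le_one_of_one_le₀ hqn.le)
    refine le_antisymm h2 ?_
    rw [← hu', hn]
    exact pow_le_of_le_one (zero_le) h3 hn0
  rcases le_total (kabs (h : K)) 1 with h1 | h1
  · obtain ⟨n, hn⟩ := key h h1
    refine ⟨n, ?_⟩
    rw [hn, hp1]; simp
  · obtain ⟨n, hn⟩ := key h⁻¹ (by rw [kabs_units_inv]; exact inv_le_one_of_one_le₀ h1)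
    refine ⟨-n, ?_⟩
    rw [kabs_units_inv, hp1] at hn
    have : kabs (h : K) = (resCard K : ℝ≥0) ^ n := by
      rw [← inv_inv (kabs (h : K)), hn]; simp
    rw [this]; simp

variable (K) in
lemma exists_unit_kabs_eq (k : ℤ) : ∃ h : Kˣ, (kabs (h : K) : ℝ) = (resCard K : ℝ) ^ (-k) := by
  obtain ⟨u, hu⟩ := exists_char_eq K
  refine ⟨u ^ k, ?_⟩
  rw [kabs_units, map_zpow, NNReal.coe_zpow, hu, inv_zpow, zpow_neg]

lemma mem_fracIdeal {k : ℤ} {x : K} :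
    x ∈ fracIdeal K k ↔ (kabs x : ℝ) ≤ (resCard K : ℝ) ^ (-k) := Iff.rfl

lemma zero_mem_fracIdeal (k : ℤ) : (0 : K) ∈ fracIdeal K k := by
  rw [mem_fracIdeal, kabs_zero]
  exact (zpow_pos (resCard_real_pos K) _).le

lemma add_mem_fracIdeal {k : ℤ} {x y : K} (hx : x ∈ fracIdeal K k) (hy : y ∈ fracIdeal K k) :
    x + y ∈ fracIdeal K k := by
  have : (kabs (x + y) : ℝ) ≤ max (kabs x : ℝ) (kabs y) := by exact_mod_cast kabs_add_le x y
  exact this.trans (max_le hx hy)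

lemma neg_mem_fracIdeal {k : ℤ} {x : K} : -x ∈ fracIdeal K k ↔ x ∈ fracIdeal K k := by
  simp [mem_fracIdeal]

lemma sub_mem_fracIdeal {k : ℤ} {x y : K} (hx : x ∈ fracIdeal K k) (hy : y ∈ fracIdeal K k) :
    x - y ∈ fracIdeal K k := by
  rw [sub_eq_add_neg]; exact add_mem_fracIdeal hx (neg_mem_fracIdeal.2 hy)

lemma add_mem_fracIdeal_iff_right {k : ℤ} {x y : K} (hx : x ∈ fracIdeal K k) :
    x + y ∈ fracIdeal K k ↔ y ∈ fracIdeal K k :=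
  ⟨fun h => by simpa using sub_mem_fracIdeal h hx, fun h => add_mem_fracIdeal hx h⟩

lemma fracIdeal_mono {j k : ℤ} (h : j ≤ k) : fracIdeal K k ⊆ fracIdeal K j := by
  intro x hx
  refine (mem_fracIdeal.1 hx).trans ?_
  exact zpow_le_zpow_right₀ (one_lt_resCard_real K).le (by lia)

lemma mul_mem_fracIdeal_iff {h : Kˣ} {j : ℤ} (hh : (kabs (h : K) : ℝ) = (resCard K : ℝ) ^ (-j))
    {k : ℤ} {x : K} : (h : K) * x ∈ fracIdeal K (j + k) ↔ x ∈ fracIdeal K k := by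
  rw [mem_fracIdeal, mem_fracIdeal, kabs_mul, NNReal.coe_mul, hh, neg_add,
    zpow_add₀ (resCard_real_pos K).ne']
  exact mul_le_mul_iff_right₀ (zpow_pos (resCard_real_pos K) _)

lemma mem_fracIdeal_of_kabs_eq {j : ℤ} {x : K} (hx : (kabs x : ℝ) = (resCard K : ℝ) ^ (-j))
    {k : ℤ} : x ∈ fracIdeal K k ↔ k ≤ j := by
  rw [mem_fracIdeal, hx, zpow_le_zpow_iff_right₀ (one_lt_resCard_real K)]
  lia

/-- The value group is discrete, so a sphere is a difference of two consecutive ideals; this is why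
spheres are open and compact. -/
lemma kabs_eq_zpow_iff {j : ℤ} {x : K} : (kabs x : ℝ) = (resCard K : ℝ) ^ (-j) ↔
    x ∈ fracIdeal K j ∧ x ∉ fracIdeal K (j + 1) := by
  constructor
  · intro h
    rw [mem_fracIdeal_of_kabs_eq h, mem_fracIdeal_of_kabs_eq h]
    lia
  · rintro ⟨h1, h2⟩
    have hx : x ≠ 0 := by rintro rfl; exact h2 (zero_mem_fracIdeal _)
    obtain ⟨k, hk⟩ := exists_kabs_eq_zpow (Units.mk0 x hx)
    rw [Units.val_mk0] at hk
    rw [mem_fracIdeal_of_kabs_eq hk] at h1 h2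
    rw [hk]
    congr 1; lia

lemma exists_mem_fracIdeal (x : K) : ∃ n : ℕ, x ∈ fracIdeal K (-n) := by
  obtain ⟨n, hn⟩ := pow_unbounded_of_one_lt (kabs x : ℝ) (one_lt_resCard_real K)
  exact ⟨n, by rw [mem_fracIdeal, neg_neg, zpow_natCast]; exact hn.le⟩

lemma eq_zero_of_forall_mem_fracIdeal {x : K} (h : ∀ n : ℕ, x ∈ fracIdeal K n) : x = 0 := by
  by_contra hx
  obtain ⟨k, hk⟩ := exists_kabs_eq_zpow (Units.mk0 x hx)
  have := (mem_fracIdeal_of_kabs_eq hk).1 (h (k.toNat + 1))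
  lia

/-! ### Topology -/

instance instT2Space : T2Space K := by
  let := IsTopologicalAddGroup.rightUniformSpace K
  have := isUniformAddGroup_of_addCommGroup (G := K)
  infer_instance

/-- The ideals 𝔓^n are compact and decrease to {0}. -/
lemma exists_fracIdeal_subset {U : Set K} (hU : U ∈ nhds (0 : K)) :
    ∃ n : ℕ, fracIdeal K n ⊆ U := by
  refine exists_subset_nhds_of_isCompact' (V := fun n : ℕ => fracIdeal K n) ?_
    (fun n => isCompact_fracIdeal _) (fun n => (isClopen_fracIdeal _).isClosed) ?_
  · exact (antitone_nat_of_succ_le fun n => fracIdeal_mono (by simp)).directed_ge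
  · intro x hx
    rw [eq_zero_of_forall_mem_fracIdeal (mem_iInter.1 hx)]
    exact hU

lemma isOpen_coset (x : K) (k : ℤ) : IsOpen {y : K | y - x ∈ fracIdeal K k} :=
  (isClopen_fracIdeal k).isOpen.preimage (by fun_prop)

lemma isCompact_coset (x : K) (k : ℤ) : IsCompact {y : K | y - x ∈ fracIdeal K k} :=
  (Homeomorph.subRight x).isCompact_preimage.2 (isCompact_fracIdeal k)

lemma exists_coset_subset {U : Set K} {x : K} (hU : U ∈ nhds x) :
    ∃ n : ℕ, {y : K | y - x ∈ fracIdeal K n} ⊆ U := by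
  have h1 : (fun y => y + x) ⁻¹' U ∈ nhds (0 : K) := by
    apply (continuous_add_const x).continuousAt
    simpa using hU
  obtain ⟨n, hn⟩ := exists_fracIdeal_subset h1
  refine ⟨n, fun y hy => ?_⟩
  simpa using hn hy

instance instSigmaCompactSpace : SigmaCompactSpace K := by
  refine ⟨⟨fun n : ℕ => fracIdeal K (-n), fun n => isCompact_fracIdeal _, ?_⟩⟩
  exact eq_univ_of_forall fun x => mem_iUnion.2 (exists_mem_fracIdeal x)

/-- By σ-compactness countably many cosets of 𝔓^n cover K for each n, and together they form a
basis. Second countability makes the product σ-algebra on the affine group the Borel one, which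
measurability of the group law rests on. -/
instance instSecondCountableTopology : SecondCountableTopology K := by
  have hcov : ∀ n : ℕ, ∃ S : Set K, S.Countable ∧
      ⋃ x ∈ S, {y : K | y - x ∈ fracIdeal K n} = univ := by
    intro n
    refine countable_cover_nhds fun x => ?_
    exact (isOpen_coset x n).mem_nhds (by simp [zero_mem_fracIdeal])
  choose S hS hcov using hcov
  let B : Set (Set K) := ⋃ n : ℕ, (fun x => {y : K | y - x ∈ fracIdeal K n}) '' (S n)
  have hB : TopologicalSpace.IsTopologicalBasis B := by
    refine TopologicalSpace.isTopologicalBasis_of_isOpen_of_nhds ?_ ?_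
    · intro U hU
      obtain ⟨n, x, -, rfl⟩ := mem_iUnion.1 hU
      exact isOpen_coset x n
    · intro a U ha hU
      obtain ⟨n, hn⟩ := exists_coset_subset (hU.mem_nhds ha)
      have h1 : a ∈ ⋃ x ∈ S n, {y : K | y - x ∈ fracIdeal K n} := hcov n ▸ mem_univ a
      obtain ⟨x, hx, hax⟩ := mem_iUnion₂.1 h1
      refine ⟨_, mem_iUnion.2 ⟨n, x, hx, rfl⟩, hax, fun y hy => hn ?_⟩
      have := sub_mem_fracIdeal (show y - x ∈ fracIdeal K n from hy) hax
      simpa using this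
  exact hB.secondCountableTopology (countable_iUnion fun n => (hS n).image _)

instance instT2SpaceUnits : T2Space Kˣ := Units.isEmbedding_val₀.t2Space

instance instSecondCountableTopologyUnits : SecondCountableTopology Kˣ :=
  Units.isEmbedding_val₀.secondCountableTopology

lemma isOpen_unit_coset (h : Kˣ) : IsOpen {g : Kˣ | kabs (g : K) = kabs (h : K)} := by
  obtain ⟨j, hj⟩ := exists_kabs_eq_zpow h
  have : {g : Kˣ | kabs (g : K) = kabs (h : K)} =
      Units.val ⁻¹' (fracIdeal K j \ fracIdeal K (j + 1)) := by
    ext g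
    rw [mem_ofPred_eq, ← NNReal.coe_inj, hj, kabs_eq_zpow_iff]; rfl
  rw [this]
  exact ((isClopen_fracIdeal j).isOpen.sdiff (isClopen_fracIdeal _).isClosed).preimage
    Units.continuous_val

lemma isCompact_annulus (i j : ℤ) :
    IsCompact {g : Kˣ | (g : K) ∈ fracIdeal K i ∧ (g : K) ∉ fracIdeal K j} := by
  rw [Units.isEmbedding_val₀.isCompact_iff]
  have : Units.val '' {g : Kˣ | (g : K) ∈ fracIdeal K i ∧ (g : K) ∉ fracIdeal K j} =
      fracIdeal K i \ fracIdeal K j := by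
    ext x
    constructor
    · rintro ⟨g, hg, rfl⟩; exact hg
    · intro hx
      have h0 : x ≠ 0 := by rintro rfl; exact hx.2 (zero_mem_fracIdeal _)
      exact ⟨Units.mk0 x h0, hx, rfl⟩
  rw [this]
  exact (isCompact_fracIdeal i).diff (isClopen_fracIdeal j).isOpen

lemma isCompact_unit_sphere (h : Kˣ) : IsCompact {g : Kˣ | kabs (g : K) = kabs (h : K)} := by
  obtain ⟨j, hj⟩ := exists_kabs_eq_zpow h
  convert isCompact_annulus (K := K) j (j + 1) using 2
  funext g
  rw [← NNReal.coe_inj, hj, kabs_eq_zpow_iff]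

instance instLocallyCompactSpaceUnits : WeaklyLocallyCompactSpace Kˣ :=
  ⟨fun h => ⟨_, isCompact_unit_sphere h, (isOpen_unit_coset h).mem_nhds rfl⟩⟩

lemma continuous_kabs_units : Continuous fun h : Kˣ => (kabs (h : K) : ℝ≥0) := by
  refine IsLocallyConstant.continuous ?_
  rw [IsLocallyConstant.iff_exists_open]
  exact fun h => ⟨_, isOpen_unit_coset h, rfl, fun g hg => hg⟩

section borel

variable [MeasurableSpace K] [BorelSpace K]

instance instBorelSpaceUnits : BorelSpace Kˣ :=
  ⟨by rw [Units.isEmbedding_val₀.eq_induced, borel_comap, ← BorelSpace.measurable_eq (α := K)]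
      rfl⟩

lemma measurable_kabs_units : Measurable fun h : Kˣ => (kabs (h : K) : ℝ≥0) :=
  continuous_kabs_units.measurable

lemma measurableSet_fracIdeal (k : ℤ) : MeasurableSet (fracIdeal K k) :=
  (isClopen_fracIdeal k).isOpen.measurableSet

end borel

/-! ### Haar measure of `K` -/

section measure

variable [MeasurableSpace K] [BorelSpace K] (μ : Measure K) [μ.IsAddHaarMeasure] [μ.Regular]

variable {μ} in
lemma measureReal_fracIdeal_eq (hμ : μ (fracIdeal K 0) = 1) (k : ℤ) :
    μ.real (fracIdeal K k) = (resCard K : ℝ) ^ (-k) := by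
  have h0 := measureReal_fracIdeal μ (K := K) 0
  rw [measureReal_def, hμ] at h0
  rw [measureReal_fracIdeal]
  simp only [ENNReal.toReal_one, neg_zero, zpow_zero, one_mul] at h0
  rw [← h0, mul_one]

variable {μ} in
lemma measure_fracIdeal (hμ : μ (fracIdeal K 0) = 1) (k : ℤ) :
    μ (fracIdeal K k) = ENNReal.ofReal ((resCard K : ℝ) ^ (-k)) := by
  rw [← measureReal_fracIdeal_eq hμ, ofReal_measureReal (isCompact_fracIdeal k).measure_ne_top]

lemma measure_coset_fracIdeal (x : K) (k : ℤ) :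
    μ {y | y - x ∈ fracIdeal K k} = μ (fracIdeal K k) := by
  have : {y | y - x ∈ fracIdeal K k} = (fun y => y + -x) ⁻¹' fracIdeal K k := by
    ext y; simp [sub_eq_add_neg]
  rw [this, measure_preimage_add_right]

/-- The affine bijection `y ↦ h⁻¹ (y - x)` of `K`. -/
def affineHomeo (a : K × Kˣ) : K ≃ₜ K := (Homeomorph.subRight a.1).trans (Homeomorph.smul a.2⁻¹)

lemma affineHomeo_apply (a : K × Kˣ) (y : K) :
    affineHomeo a y = ((a.2⁻¹ : Kˣ) : K) * (y - a.1) := by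
  simp [affineHomeo, Units.smul_def]

lemma affineHomeo_symm_apply (a : K × Kˣ) (y : K) :
    (affineHomeo a).symm y = (a.2 : K) * y + a.1 := by
  rw [Homeomorph.symm_apply_eq, affineHomeo_apply]; simp

/-- The preimage of S under y ↦ h⁻¹(y - x) is x + hS, hence the factor |h| and not its inverse. -/
lemma map_affineHomeo (a : K × Kˣ) :
    Measure.map (affineHomeo a) μ = (kabs (a.2 : K) : ℝ≥0∞) • μ := by
  ext S hS
  rw [Measure.map_apply (affineHomeo a).continuous.measurable hS]
  have hpre : affineHomeo a ⁻¹' S = a.1 +ᵥ (a.2 • S) := by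
    ext y
    rw [Set.mem_vadd_set_iff_neg_vadd_mem, Set.mem_smul_set_iff_inv_smul_mem, mem_preimage,
      affineHomeo_apply]
    simp [sub_eq_neg_add, Units.smul_def, mul_add]
  rw [hpre, measure_vadd, ← distribHaarChar_mul, Measure.smul_apply, smul_eq_mul, kabs_units]

lemma lintegral_affineHomeo (a : K × Kˣ) (f : K → ℝ≥0∞) :
    ∫⁻ y, f (affineHomeo a y) ∂μ = kabs (a.2 : K) * ∫⁻ y, f y ∂μ := by
  rw [← smul_eq_mul, ← lintegral_smul_measure, ← map_affineHomeo]
  exact (lintegral_map_equiv f (affineHomeo a).toMeasurableEquiv).symm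

lemma kabs_mul_inv_cancel_ennreal (h : Kˣ) :
    (kabs (h : K) : ℝ≥0∞) * (kabs (h : K) : ℝ≥0∞)⁻¹ = 1 :=
  ENNReal.mul_inv_cancel (by exact_mod_cast (kabs_units_pos h).ne') ENNReal.coe_ne_top

lemma lintegral_affine (a : K × Kˣ) (f : K → ℝ≥0∞) :
    ∫⁻ y, f ((a.2 : K) * y + a.1) ∂μ = (kabs (a.2 : K) : ℝ≥0∞)⁻¹ * ∫⁻ y, f y ∂μ := by
  have := lintegral_affineHomeo μ a (fun y => f ((a.2 : K) * y + a.1))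
  simp only [← affineHomeo_symm_apply, Homeomorph.symm_apply_apply] at this
  simp only [← affineHomeo_symm_apply]
  rw [this, ← mul_assoc, mul_comm (_⁻¹), kabs_mul_inv_cancel_ennreal, one_mul]

lemma integral_affineHomeo (a : K × Kˣ) (f : K → ℂ) :
    ∫ y, f (affineHomeo a y) ∂μ = (kabs (a.2 : K) : ℂ) * ∫ y, f y ∂μ := by
  have h1 := integral_map_equiv (μ := μ) (affineHomeo a).toMeasurableEquiv f
  have h2 : Measure.map (affineHomeo a).toMeasurableEquiv μ = (kabs (a.2 : K) : ℝ≥0∞) • μ :=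
    map_affineHomeo μ a
  rw [h2, integral_smul_measure] at h1
  rw [ENNReal.coe_toReal, Complex.real_smul] at h1
  exact h1.symm

end measure

/-! ### The affine group -/

section group

lemma affInv_affMul_cancel_left (a b : K × Kˣ) : affMul (affInv a) (affMul a b) = b := by
  refine Prod.ext ?_ ?_
  · simp only [affMul, affInv]; rw [mul_add, ← mul_assoc]; simp
  · simp [affMul, affInv]

lemma affMul_affInv_cancel_left (a b : K × Kˣ) : affMul a (affMul (affInv a) b) = b := by
  refine Prod.ext ?_ ?_
  · simp only [affMul, affInv]; rw [mul_add, ← mul_assoc]; simp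
  · simp [affMul, affInv]

lemma affMul_affInv_cancel_right (a b : K × Kˣ) : affMul (affMul a b) (affInv b) = a := by
  refine Prod.ext ?_ ?_
  · simp only [affMul, affInv, Units.val_mul]; rw [mul_neg, mul_assoc, ← mul_assoc (b.2 : K)]; simp
  · simp [affMul, affInv]

lemma affInv_affInv (a : K × Kˣ) : affInv (affInv a) = a := by
  refine Prod.ext ?_ ?_
  · simp only [affInv]; rw [mul_neg, ← mul_assoc]; simp
  · simp [affInv]

lemma affMul_one (a : K × Kˣ) : affMul a (0, 1) = a := by simp [affMul]

lemma affMul_affInv_self (a : K × Kˣ) : affMul a (affInv a) = (0, 1) := by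
  simpa [affMul_one] using affMul_affInv_cancel_left a (0, 1)

lemma affInv_affMul (a b : K × Kˣ) : affInv (affMul a b) = affMul (affInv b) (affInv a) := by
  refine Prod.ext ?_ ?_
  · simp only [affMul, affInv, mul_inv_rev, Units.val_mul]
    rw [mul_add, mul_assoc, ← mul_assoc ((a.2⁻¹ : Kˣ) : K)]
    simp; ring
  · simp [affMul, affInv]

lemma affMod_affInv (a : K × Kˣ) : affMod (affInv a) = kabs (a.2 : K) := by
  simp only [affMod, affInv, kabs_units_inv]; simp

lemma continuous_affMul : Continuous fun p : (K × Kˣ) × (K × Kˣ) => affMul p.1 p.2 := by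
  unfold affMul; fun_prop

lemma continuous_affInv : Continuous (affInv : K × Kˣ → K × Kˣ) := by
  unfold affInv; fun_prop

lemma continuous_affMul_left (a : K × Kˣ) : Continuous (affMul a) :=
  continuous_affMul.comp (by fun_prop : Continuous fun b => (a, b))

lemma continuous_affMul_right (a : K × Kˣ) : Continuous (fun b => affMul b a) :=
  continuous_affMul.comp (by fun_prop : Continuous fun b => (b, a))

end group

/-! ### The left Haar measure of the affine group -/

section affHaar

variable [MeasurableSpace K] [BorelSpace K] (μ : Measure K) [μ.IsAddHaarMeasure] [μ.Regular]
  (ν : Measure Kˣ) [ν.IsHaarMeasure]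

lemma measurable_affMul : Measurable fun p : (K × Kˣ) × (K × Kˣ) => affMul p.1 p.2 :=
  continuous_affMul.measurable

lemma measurable_affMul_left (a : K × Kˣ) : Measurable (affMul a) :=
  (continuous_affMul_left a).measurable

lemma measurable_affMul_right (a : K × Kˣ) : Measurable (fun b => affMul b a) :=
  (continuous_affMul_right a).measurable

lemma measurable_kabs_inv : Measurable fun h : Kˣ => ((kabs (h : K) : ℝ≥0∞))⁻¹ :=
  measurable_kabs_units.coe_nnreal_ennreal.inv

instance instSFiniteAffHaar : SFinite (affHaar μ ν) := by unfold affHaar; infer_instance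

lemma lintegral_affHaar {F : K × Kˣ → ℝ≥0∞} (hF : Measurable F) :
    ∫⁻ a, F a ∂(affHaar μ ν) =
      ∫⁻ h, (kabs (h : K) : ℝ≥0∞)⁻¹ * ∫⁻ x, F (x, h) ∂μ ∂ν := by
  rw [affHaar, lintegral_prod_symm _ hF.aemeasurable,
    lintegral_withDensity_eq_lintegral_mul _ measurable_kabs_inv]
  · rfl
  · exact Measurable.lintegral_prod_left' hF

/-- The substitution in x costs the inverse absolute value of the dilation part of a. Multiplied by
the density at h it gives the density at the translated point, and invariance of ν finishes. -/
lemma lintegral_affMul_left (a : K × Kˣ) {F : K × Kˣ → ℝ≥0∞} (hF : Measurable F) :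
    ∫⁻ b, F (affMul a b) ∂(affHaar μ ν) = ∫⁻ b, F b ∂(affHaar μ ν) := by
  rw [lintegral_affHaar μ ν (F := fun b => F (affMul a b)) (hF.comp (measurable_affMul_left a)),
    lintegral_affHaar μ ν hF]
  rw [← lintegral_mul_left_eq_self
    (fun h : Kˣ => (kabs (h : K) : ℝ≥0∞)⁻¹ * ∫⁻ x, F (x, h) ∂μ) a.2]
  refine lintegral_congr fun h => ?_
  simp only [affMul]
  rw [lintegral_affine μ a (fun x => F (x, a.2 * h)), ← mul_assoc]
  congr 1
  rw [Units.val_mul, kabs_mul, ENNReal.coe_mul, ENNReal.mul_inv (Or.inr ENNReal.coe_ne_top)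
    (Or.inl ENNReal.coe_ne_top), mul_comm]

/-- Here the first coordinate is only translated, so nothing compensates the change of the density;
the resulting factor is Δ(a⁻¹). -/
lemma lintegral_affMul_right (a : K × Kˣ) {F : K × Kˣ → ℝ≥0∞} (hF : Measurable F) :
    ∫⁻ b, F (affMul b a) ∂(affHaar μ ν) =
      kabs (a.2 : K) * ∫⁻ b, F b ∂(affHaar μ ν) := by
  rw [lintegral_affHaar μ ν (F := fun b => F (affMul b a)) (hF.comp (measurable_affMul_right a)),
    lintegral_affHaar μ ν hF,
    ← lintegral_mul_right_eq_self
      (fun h : Kˣ => (kabs (h : K) : ℝ≥0∞)⁻¹ * ∫⁻ x, F (x, h) ∂μ) a.2, ← lintegral_const_mul]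
  · refine lintegral_congr fun h => ?_
    simp only [affMul]
    rw [lintegral_add_left_eq_self (fun x => F (x, h * a.2)), ← mul_assoc]
    congr 1
    rw [Units.val_mul, kabs_mul, ENNReal.coe_mul, ENNReal.mul_inv (Or.inr ENNReal.coe_ne_top)
      (Or.inl ENNReal.coe_ne_top), mul_comm, mul_assoc, mul_comm (_⁻¹) (kabs (a.2 : K) : ℝ≥0∞),
      kabs_mul_inv_cancel_ennreal, mul_one]
  · refine Measurable.comp (g := fun h : Kˣ => (kabs (h : K) : ℝ≥0∞)⁻¹ * ∫⁻ x, F (x, h) ∂μ) ?_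
      (measurable_mul_const a.2)
    exact measurable_kabs_inv.mul (Measurable.lintegral_prod_left' hF)

/-- Left translation of the affine group as a homeomorphism. -/
def affMulHomeo (a : K × Kˣ) : K × Kˣ ≃ₜ K × Kˣ where
  toFun := affMul a
  invFun := affMul (affInv a)
  left_inv := affInv_affMul_cancel_left a
  right_inv := affMul_affInv_cancel_left a
  continuous_toFun := continuous_affMul_left a
  continuous_invFun := continuous_affMul_left _

lemma map_affMul_left (a : K × Kˣ) : Measure.map (affMul a) (affHaar μ ν) = affHaar μ ν := by
  ext S hS
  have hm : Measurable (S.indicator (1 : K × Kˣ → ℝ≥0∞)) := measurable_one.indicator hS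
  rw [← lintegral_indicator_one hS, lintegral_map hm (measurable_affMul_left a),
    ← lintegral_indicator_one hS]
  exact lintegral_affMul_left μ ν a hm

lemma integral_affMul_left (a : K × Kˣ) (F : K × Kˣ → ℂ) :
    ∫ b, F (affMul a b) ∂(affHaar μ ν) = ∫ b, F b ∂(affHaar μ ν) := by
  have h1 := integral_map_equiv (μ := affHaar μ ν) (affMulHomeo a).toMeasurableEquiv F
  have h2 : Measure.map (affMulHomeo a).toMeasurableEquiv (affHaar μ ν) = affHaar μ ν :=
    map_affMul_left μ ν a
  rw [h2] at h1
  exact h1.symm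

/-! ### Cosets of the stabilizer of the wavelet -/

variable (K) in
/-- The orbit equivalence relation of the right action of `𝔇 ⋊ 𝔇*` on `K ⋊ Kˣ`. -/
def cosetSetoid : Setoid (K × Kˣ) where
  r a b := kabs (a.2 : K) = kabs (b.2 : K) ∧ kabs (a.1 - b.1) ≤ kabs (a.2 : K)
  iseqv :=
    { refl := fun a => ⟨rfl, by simp⟩
      symm := fun {a b} h => ⟨h.1.symm, by rw [← neg_sub, kabs_neg, ← h.1]; exact h.2⟩
      trans := fun {a b c} h h' => ⟨h.1.trans h'.1, by
        have := kabs_add_le (a.1 - b.1) (b.1 - c.1)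
        rw [sub_add_sub_cancel] at this
        exact this.trans (max_le h.2 (h'.2.trans h.1.ge))⟩ }

variable (K) in
/-- The quotient of `K ⋊ Kˣ` by the subgroup `𝔇 ⋊ 𝔇*`. -/
abbrev AffCoset : Type _ := Quotient (cosetSetoid K)

lemma cosetSetoid_iff {a b : K × Kˣ} : cosetSetoid K a b ↔
    kabs (a.2 : K) = kabs (b.2 : K) ∧ kabs (a.1 - b.1) ≤ kabs (a.2 : K) := Iff.rfl

lemma cosetSetoid_iff_zpow {a b : K × Kˣ} {k : ℤ}
    (ha : (kabs (a.2 : K) : ℝ) = (resCard K : ℝ) ^ (-k)) : cosetSetoid K a b ↔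
    kabs (b.2 : K) = kabs (a.2 : K) ∧ b.1 - a.1 ∈ fracIdeal K k := by
  rw [cosetSetoid_iff, mem_fracIdeal, ← ha, NNReal.coe_le_coe, ← neg_sub b.1, kabs_neg]
  exact and_congr_left' eq_comm

lemma isOpen_cosetSetoid (a : K × Kˣ) : IsOpen {b | cosetSetoid K a b} := by
  obtain ⟨k, hk⟩ := exists_kabs_eq_zpow a.2
  simp only [cosetSetoid_iff_zpow hk]
  exact (isOpen_unit_coset a.2).preimage continuous_snd |>.inter
    ((isOpen_coset a.1 k).preimage continuous_fst)

lemma isOpen_coset_preimage (S : Set (AffCoset K)) :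
    IsOpen ((fun a : K × Kˣ => (⟦a⟧ : AffCoset K)) ⁻¹' S) := by
  rw [isOpen_iff_mem_nhds]
  intro a ha
  refine Filter.mem_of_superset ((isOpen_cosetSetoid a).mem_nhds ((cosetSetoid K).refl a)) ?_
  intro b hb
  have : (⟦a⟧ : AffCoset K) = ⟦b⟧ := Quotient.sound hb
  rw [mem_preimage, ← this]
  exact ha

/-- The cosets are open, so a countable dense set meets each of them. -/
instance instCountableAffCoset : Countable (AffCoset K) := by
  obtain ⟨D, hD, hDd⟩ := TopologicalSpace.exists_countable_dense (K × Kˣ)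
  have : Countable D := hD
  refine Function.Surjective.countable (f := fun d : D => (⟦(d : K × Kˣ)⟧ : AffCoset K)) ?_
  intro i
  obtain ⟨a, ha, haD⟩ := hDd.exists_mem_open (isOpen_coset_preimage {i})
    ⟨i.out, by simp⟩
  exact ⟨⟨a, ha⟩, haD⟩

/-- The measure of the group `𝔇*` of units of the ring of integers. -/
def unitMass : ℝ≥0∞ := ν {h : Kˣ | kabs (h : K) = 1}

lemma unitMass_ne_zero : unitMass ν ≠ 0 := by
  have := (isOpen_unit_coset (1 : Kˣ)).measure_pos ν ⟨1, rfl⟩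
  simp only [Units.val_one, kabs_one] at this
  exact this.ne'

lemma unitMass_ne_top : unitMass ν ≠ ∞ := by
  have := (isCompact_unit_sphere (1 : Kˣ)).measure_lt_top (μ := ν)
  simp only [Units.val_one, kabs_one] at this
  exact this.ne

lemma unitMass_toReal_pos : 0 < (unitMass ν).toReal :=
  ENNReal.toReal_pos (unitMass_ne_zero ν) (unitMass_ne_top ν)

lemma measure_unit_sphere (g : Kˣ) : ν {h : Kˣ | kabs (h : K) = kabs (g : K)} = unitMass ν := by
  rw [unitMass, ← measure_preimage_mul ν g⁻¹ {h : Kˣ | kabs (h : K) = 1}]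
  congr 1
  ext h
  have := (kabs_units_pos g).ne'
  simp only [mem_ofPred_eq, mem_preimage, Units.val_mul, kabs_mul, kabs_units_inv]
  rw [inv_mul_eq_one₀ this, eq_comm]

variable {μ} in
-- The translation part of the coset has measure |h|, which the density 1/|h| cancels. All cosets
-- therefore have the same mass.
lemma affHaar_coset (hμ : μ (fracIdeal K 0) = 1) (a : K × Kˣ) :
    affHaar μ ν {b | cosetSetoid K a b} = unitMass ν := by
  obtain ⟨k, hk⟩ := exists_kabs_eq_zpow a.2
  have hS : {b | cosetSetoid K a b} =
      {y : K | y - a.1 ∈ fracIdeal K k} ×ˢ {h : Kˣ | kabs (h : K) = kabs (a.2 : K)} := by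
    ext b
    rw [mem_ofPred_eq, cosetSetoid_iff_zpow hk, mem_prod, and_comm]; rfl
  have hm := (isOpen_unit_coset a.2).measurableSet
  rw [hS, affHaar, Measure.prod_prod, measure_coset_fracIdeal, measure_fracIdeal hμ, ← hk,
    withDensity_apply _ hm, setLIntegral_congr_fun (g := fun _ => (kabs (a.2 : K) : ℝ≥0∞)⁻¹) hm
      (fun h (hh : kabs (h : K) = _) => by simp only [hh]),
    setLIntegral_const, measure_unit_sphere, ← mul_assoc, ENNReal.ofReal_coe_nnreal,
    kabs_mul_inv_cancel_ennreal, one_mul]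

/-! ### Integrals of coset-invariant functions as sums over the cosets -/

lemma coset_fiber (i : AffCoset K) :
    (fun a : K × Kˣ => (⟦a⟧ : AffCoset K)) ⁻¹' {i} = {b | cosetSetoid K i.out b} := by
  ext b
  rw [mem_preimage, mem_singleton_iff, mem_ofPred_eq, eq_comm, ← Quotient.out_eq i, Quotient.eq,
    Quotient.out_eq]

lemma eq_out_of_invariant {E : Type*} {F : K × Kˣ → E}
    (hF : ∀ a b, cosetSetoid K a b → F a = F b) (a : K × Kˣ) :
    F a = F (⟦a⟧ : AffCoset K).out :=
  hF _ _ ((cosetSetoid K).symm (Quotient.mk_out a))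

lemma continuous_of_invariant {E : Type*} [TopologicalSpace E] {F : K × Kˣ → E}
    (hF : ∀ a b, cosetSetoid K a b → F a = F b) : Continuous F := by
  refine IsLocallyConstant.continuous ?_
  rw [IsLocallyConstant.iff_exists_open]
  exact fun a => ⟨_, isOpen_cosetSetoid a, (cosetSetoid K).refl a, fun b hb => (hF a b hb).symm⟩

variable {μ} in
lemma lintegral_eq_tsum_coset (hμ : μ (fracIdeal K 0) = 1) {F : K × Kˣ → ℝ≥0∞}
    (hF : ∀ a b, cosetSetoid K a b → F a = F b) :
    ∫⁻ a, F a ∂(affHaar μ ν) = unitMass ν * ∑' i : AffCoset K, F i.out := by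
  have hd : Pairwise (Function.onFun Disjoint
      fun i : AffCoset K => (fun a : K × Kˣ => (⟦a⟧ : AffCoset K)) ⁻¹' {i}) := fun i j hij =>
    Disjoint.preimage _ (disjoint_singleton.2 hij)
  have hm := fun i : AffCoset K => (isOpen_coset_preimage {i}).measurableSet
  have hu : ⋃ i : AffCoset K, (fun a : K × Kˣ => (⟦a⟧ : AffCoset K)) ⁻¹' {i} = univ :=
    eq_univ_of_forall fun a => mem_iUnion.2 ⟨⟦a⟧, rfl⟩
  rw [← setLIntegral_univ, ← hu, lintegral_iUnion hm hd, ← ENNReal.tsum_mul_left]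
  refine tsum_congr fun i => ?_
  rw [setLIntegral_congr_fun (g := fun _ => F i.out) (hm i) (fun a ha => ?_), setLIntegral_const,
    coset_fiber, affHaar_coset ν hμ, mul_comm]
  rw [eq_out_of_invariant hF a, show (⟦a⟧ : AffCoset K) = i from ha]

variable {μ} in
lemma hasSum_coset (hμ : μ (fracIdeal K 0) = 1) {F : K × Kˣ → ℂ}
    (hF : ∀ a b, cosetSetoid K a b → F a = F b) (hint : Integrable F (affHaar μ ν)) :
    HasSum (fun i : AffCoset K => F i.out)
      (((unitMass ν).toReal : ℂ)⁻¹ * ∫ a, F a ∂(affHaar μ ν)) := by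
  have hd : Pairwise (Function.onFun Disjoint
      fun i : AffCoset K => (fun a : K × Kˣ => (⟦a⟧ : AffCoset K)) ⁻¹' {i}) := fun i j hij =>
    Disjoint.preimage _ (disjoint_singleton.2 hij)
  have hm := fun i : AffCoset K => (isOpen_coset_preimage {i}).measurableSet
  have hu : ⋃ i : AffCoset K, (fun a : K × Kˣ => (⟦a⟧ : AffCoset K)) ⁻¹' {i} = univ :=
    eq_univ_of_forall fun a => mem_iUnion.2 ⟨⟦a⟧, rfl⟩
  have h1 := hasSum_integral_iUnion (μ := affHaar μ ν) (f := F) hm hd hint.integrableOn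
  rw [hu, setIntegral_univ] at h1
  have h2 := h1.mul_left (((unitMass ν).toReal : ℂ)⁻¹)
  refine h2.congr_fun fun i => ?_
  have hne : ((unitMass ν).toReal : ℂ) ≠ 0 := by exact_mod_cast (unitMass_toReal_pos ν).ne'
  rw [setIntegral_congr_fun (g := fun _ => F i.out) (hm i) (fun a ha => ?_), setIntegral_const,
    coset_fiber, measureReal_def, affHaar_coset ν hμ, Complex.real_smul, inv_mul_cancel_left₀ hne]
  rw [eq_out_of_invariant hF a, show (⟦a⟧ : AffCoset K) = i from ha]

end affHaar

/-! ### The quasi-regular representation -/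

section representation

variable [MeasurableSpace K] [BorelSpace K] (μ : Measure K) [μ.IsAddHaarMeasure] [μ.Regular]

lemma quasiMeasurePreserving_affineHomeo (a : K × Kˣ) :
    Measure.QuasiMeasurePreserving (affineHomeo a) μ μ := by
  refine ⟨(affineHomeo a).continuous.measurable, ?_⟩
  rw [map_affineHomeo]
  exact Measure.smul_absolutelyContinuous

/-- The normalizing factor `|h|^{-1/2}` of the quasi-regular representation. -/
def actFactor (a : K × Kˣ) : ℝ := (kabs (a.2 : K) : ℝ) ^ (-(1 / 2 : ℝ))

lemma actFactor_affMul (a b : K × Kˣ) : actFactor (affMul a b) = actFactor a * actFactor b := by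
  simp only [actFactor, affMul, Units.val_mul, kabs_mul, NNReal.coe_mul]
  exact Real.mul_rpow (NNReal.coe_nonneg _) (NNReal.coe_nonneg _)

lemma actFactor_sq (a : K × Kˣ) : actFactor a * actFactor a * kabs (a.2 : K) = 1 := by
  have h := kabs_units_pos_real a.2
  rw [actFactor, ← Real.rpow_add h, ← Real.rpow_add_one h.ne']
  norm_num

variable {μ}

lemma coeFn_quasiRegular (a : K × Kˣ) (g : Lp ℂ 2 μ) :
    quasiRegular μ a g =ᵐ[μ] fun y => (actFactor a : ℂ) * g (affineHomeo a y) := by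
  simp only [affineHomeo_apply]
  exact MemLp.coeFn_toLp _

lemma affineHomeo_affMul (a b : K × Kˣ) (y : K) :
    affineHomeo (affMul a b) y = affineHomeo b (affineHomeo a y) := by
  simp only [affineHomeo_apply, affMul, mul_inv_rev, Units.val_mul]
  rw [mul_assoc, sub_add_eq_sub_sub_swap, mul_sub ((a.2⁻¹ : Kˣ) : K), ← mul_assoc _ (a.2 : K)]
  simp

lemma quasiRegular_affMul (a b : K × Kˣ) (g : Lp ℂ 2 μ) :
    quasiRegular μ (affMul a b) g = quasiRegular μ a (quasiRegular μ b g) := by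
  apply Lp.ext
  have h1 := (quasiMeasurePreserving_affineHomeo μ a).ae_eq_comp (coeFn_quasiRegular b g)
  filter_upwards [coeFn_quasiRegular (affMul a b) g, coeFn_quasiRegular a (quasiRegular μ b g), h1]
    with y hy1 hy2 hy3
  simp only [Function.comp_apply] at hy3
  rw [hy1, hy2, hy3, actFactor_affMul, affineHomeo_affMul]
  push_cast; ring

lemma quasiRegular_one (g : Lp ℂ 2 μ) : quasiRegular μ (0, 1) g = g := by
  apply Lp.ext
  filter_upwards [coeFn_quasiRegular (0, 1) g] with y hy
  rw [hy, affineHomeo_apply]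
  simp [actFactor]

lemma quasiRegular_add (a : K × Kˣ) (f g : Lp ℂ 2 μ) :
    quasiRegular μ a (f + g) = quasiRegular μ a f + quasiRegular μ a g := by
  apply Lp.ext
  have h1 := (quasiMeasurePreserving_affineHomeo μ a).ae_eq_comp (Lp.coeFn_add f g)
  filter_upwards [coeFn_quasiRegular a (f + g), coeFn_quasiRegular a f, coeFn_quasiRegular a g, h1,
    Lp.coeFn_add (quasiRegular μ a f) (quasiRegular μ a g)] with y hy1 hy2 hy3 hy4 hy5
  simp only [Function.comp_apply, Pi.add_apply] at hy4
  rw [hy1, hy5, Pi.add_apply, hy2, hy3, hy4, mul_add]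

lemma quasiRegular_smul (a : K × Kˣ) (c : ℂ) (g : Lp ℂ 2 μ) :
    quasiRegular μ a (c • g) = c • quasiRegular μ a g := by
  apply Lp.ext
  have h1 := (quasiMeasurePreserving_affineHomeo μ a).ae_eq_comp (Lp.coeFn_smul c g)
  filter_upwards [coeFn_quasiRegular a (c • g), coeFn_quasiRegular a g, h1,
    Lp.coeFn_smul c (quasiRegular μ a g)] with y hy1 hy2 hy4 hy5
  simp only [Function.comp_apply, Pi.smul_apply, smul_eq_mul] at hy4 hy5
  rw [hy1, hy5, hy2, hy4]; ring

lemma inner_quasiRegular_quasiRegular (a : K × Kˣ) (f g : Lp ℂ 2 μ) :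
    inner ℂ (quasiRegular μ a f) (quasiRegular μ a g) = inner ℂ f g := by
  rw [L2.inner_def, L2.inner_def]
  have h1 : ∀ᵐ y ∂μ, inner ℂ (quasiRegular μ a f y) (quasiRegular μ a g y) =
      ((actFactor a * actFactor a : ℝ) : ℂ) *
        (fun z => inner ℂ (f z) (g z)) (affineHomeo a y) := by
    filter_upwards [coeFn_quasiRegular a f, coeFn_quasiRegular a g] with y hy1 hy2
    rw [hy1, hy2]
    simp only [RCLike.inner_apply, map_mul, Complex.conj_ofReal]
    push_cast; ring
  rw [integral_congr_ae h1, integral_const_mul,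
    integral_affineHomeo μ a (fun z => inner ℂ (f z) (g z)), ← mul_assoc]
  have := actFactor_sq a
  rw [show ((actFactor a * actFactor a : ℝ) : ℂ) * ((kabs (a.2 : K) : ℝ) : ℂ) = 1 by
    rw [← Complex.ofReal_mul, this, Complex.ofReal_one], one_mul]

lemma inner_quasiRegular_left (a : K × Kˣ) (f g : Lp ℂ 2 μ) :
    inner ℂ (quasiRegular μ a f) g = inner ℂ f (quasiRegular μ (affInv a) g) := by
  rw [← inner_quasiRegular_quasiRegular a f (quasiRegular μ (affInv a) g), ← quasiRegular_affMul,
    affMul_affInv_self, quasiRegular_one]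

lemma norm_quasiRegular (a : K × Kˣ) (g : Lp ℂ 2 μ) : ‖quasiRegular μ a g‖ = ‖g‖ := by
  have h := inner_quasiRegular_quasiRegular a g g
  rw [inner_self_eq_norm_sq_to_K, inner_self_eq_norm_sq_to_K] at h
  have h' : ‖quasiRegular μ a g‖ ^ 2 = ‖g‖ ^ 2 := by exact_mod_cast h
  exact (sq_eq_sq₀ (norm_nonneg _) (norm_nonneg _)).1 h'

lemma waveletTransform_quasiRegular_left (g f : Lp ℂ 2 μ) (c b : K × Kˣ) :
    waveletTransform μ (quasiRegular μ c g) f b = waveletTransform μ g f (affMul b c) := by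
  rw [waveletTransform, waveletTransform, quasiRegular_affMul]

lemma waveletTransform_quasiRegular_right (g f : Lp ℂ 2 μ) (a b : K × Kˣ) :
    waveletTransform μ g (quasiRegular μ a f) b = waveletTransform μ g f (affMul (affInv a) b) := by
  rw [waveletTransform, waveletTransform, quasiRegular_affMul, inner_quasiRegular_left (affInv a),
    affInv_affInv]

lemma norm_waveletTransform_le (g f : Lp ℂ 2 μ) (a : K × Kˣ) :
    ‖waveletTransform μ g f a‖ ≤ ‖g‖ * ‖f‖ := by
  rw [waveletTransform, ← norm_quasiRegular a g]
  exact norm_inner_le_norm _ _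

/-! ### The wavelet atoms -/

lemma indicator_one_congr {X Y : Type*} {s : Set X} {t : Set Y} {x : X} {y : Y}
    (h : x ∈ s ↔ y ∈ t) :
    s.indicator (fun _ => (1 : ℂ)) x = t.indicator (fun _ => (1 : ℂ)) y := by
  by_cases hx : x ∈ s
  · rw [indicator_of_mem hx, indicator_of_mem (h.1 hx)]
  · rw [indicator_of_notMem hx, indicator_of_notMem (fun hy => hx (h.2 hy))]

/-- The integer `k` with `|h| = q^{-k}`. -/
def level (h : Kˣ) : ℤ := (exists_kabs_eq_zpow h).choose

lemma kabs_eq_level (h : Kˣ) : (kabs (h : K) : ℝ) = (resCard K : ℝ) ^ (-level h) :=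
  (exists_kabs_eq_zpow h).choose_spec

lemma level_eq_of_kabs {h : Kˣ} {k : ℤ} (hk : (kabs (h : K) : ℝ) = (resCard K : ℝ) ^ (-k)) :
    level h = k := by
  rw [kabs_eq_level h] at hk
  have := zpow_right_injective₀ (resCard_real_pos K) (one_lt_resCard_real K).ne' hk
  lia

lemma level_eq_iff {h g : Kˣ} : level h = level g ↔ kabs (h : K) = kabs (g : K) := by
  constructor
  · intro e
    apply NNReal.coe_injective
    rw [kabs_eq_level, kabs_eq_level, e]
  · intro e
    exact level_eq_of_kabs (by rw [e, kabs_eq_level])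

lemma besovKernel_neg (k : ℤ) (x : K) : besovKernel K k (-x) = besovKernel K k x := by
  simp only [besovKernel, indicator_one_congr (neg_mem_fracIdeal (x := x))]

lemma haarWavelet_eq_besovKernel : haarWavelet K = besovKernel K 0 := by
  funext x; simp [haarWavelet, besovKernel]

lemma resCard_ne_zero_complex : (resCard K : ℂ) ≠ 0 := by
  exact_mod_cast (resCard_pos (K := K)).ne'

/-- Dilation shifts the index of the Littlewood–Paley kernel by the level of h. This identifies the
dilated wavelet with a multiple of Φ_k, and so the wavelet transform with a convolution by Φ_k. -/
lemma besovKernel_zero_inv_mul (h : Kˣ) (x : K) :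
    besovKernel K 0 (((h⁻¹ : Kˣ) : K) * x) = (kabs (h : K) : ℂ) * besovKernel K (level h) x := by
  have h1 : ∀ j : ℤ, (fracIdeal K j).indicator (fun _ => (1 : ℂ)) (((h⁻¹ : Kˣ) : K) * x) =
      (fracIdeal K (level h + j)).indicator (fun _ => (1 : ℂ)) x := by
    intro j
    have := mul_mem_fracIdeal_iff (kabs_eq_level h) (k := j) (x := ((h⁻¹ : Kˣ) : K) * x)
    rw [← mul_assoc] at this
    simp only [Units.mul_inv, one_mul] at this
    exact indicator_one_congr this.symm
  have hq := resCard_ne_zero_complex (K := K)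
  have h2 : ((kabs (h : K) : ℝ) : ℂ) = (resCard K : ℂ) ^ (-level h) := by
    rw [kabs_eq_level]; push_cast; rfl
  simp only [besovKernel, h1]
  rw [h2, mul_sub, ← mul_assoc, ← mul_assoc, ← zpow_add₀ hq, ← zpow_add₀ hq]
  simp only [add_zero, zero_sub]
  congr 2
  · simp
  · congr 2; ring

variable (μ) in
/-- The translated and dilated wavelet `π(a) φ`, as a test function. -/
def atom (a : K × Kˣ) : testSpace μ :=
  ((actFactor a * kabs (a.2 : K) : ℝ) : ℂ) •
    ⟨fun y => besovKernel K (level a.2) (a.1 - y), reflect_mem μ (besovKernel_mem μ _) a.1⟩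

lemma atom_apply (a : K × Kˣ) (y : K) : (atom μ a).1 y =
    ((actFactor a * kabs (a.2 : K) : ℝ) : ℂ) * besovKernel K (level a.2) (a.1 - y) := rfl

lemma atom_apply' (a : K × Kˣ) (y : K) :
    (atom μ a).1 y = (actFactor a : ℂ) * haarWavelet K (affineHomeo a y) := by
  rw [atom_apply, haarWavelet_eq_besovKernel, affineHomeo_apply, besovKernel_zero_inv_mul,
    ← neg_sub, besovKernel_neg]
  push_cast; ring

lemma star_besovKernel (k : ℤ) (x : K) : star (besovKernel K k x) = besovKernel K k x := by
  simp only [besovKernel, indicator]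
  split_ifs <;> simp

lemma star_atom (a : K × Kˣ) (y : K) : star ((atom μ a).1 y) = (atom μ a).1 y := by
  rw [atom_apply, star_mul', star_besovKernel]
  congr 1
  exact Complex.conj_ofReal _

lemma coeFn_testToL2 (f : testSpace μ) : testToL2 μ f =ᵐ[μ] f.1 := MemLp.coeFn_toLp _

lemma testToL2_atom (a : K × Kˣ) :
    testToL2 μ (atom μ a) = quasiRegular μ a (haarWaveletL2 μ) := by
  apply Lp.ext
  have h1 := (quasiMeasurePreserving_affineHomeo μ a).ae_eq_comp
    (coeFn_testToL2 ⟨haarWavelet K, haarWavelet_mem μ⟩)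
  filter_upwards [coeFn_testToL2 (atom μ a), coeFn_quasiRegular a (haarWaveletL2 μ), h1]
    with y hy1 hy2 hy3
  rw [hy1, hy2, atom_apply']
  simp only [Function.comp_apply] at hy3
  rw [haarWaveletL2, hy3]

/-- An atom sees h only through |h|, and Φ_k is invariant under translation by 𝔓^k, which contains
the difference of the two centres. -/
lemma atom_eq_of_rel {a b : K × Kˣ} (h : cosetSetoid K a b) : atom μ a = atom μ b := by
  have hk : level a.2 = level b.2 := level_eq_iff.2 h.1
  apply Subtype.ext
  funext y
  rw [atom_apply, atom_apply]
  have hmem : ∀ j ≤ level a.2, (a.1 - y ∈ fracIdeal K j ↔ b.1 - y ∈ fracIdeal K j) := by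
    intro j hj
    have h1 : b.1 - a.1 ∈ fracIdeal K j :=
      fracIdeal_mono hj ((cosetSetoid_iff_zpow (kabs_eq_level a.2)).1 h).2
    rw [← add_mem_fracIdeal_iff_right (y := a.1 - y) h1, sub_add_sub_cancel]
  congr 1
  · rw [actFactor, actFactor, h.1]
  · rw [← hk]
    rw [besovKernel, besovKernel, indicator_one_congr (hmem _ le_rfl),
      indicator_one_congr (hmem (level a.2 - 1) (by lia))]

lemma quasiRegular_haarWavelet_eq_of_rel {a b : K × Kˣ} (h : cosetSetoid K a b) :
    quasiRegular μ a (haarWaveletL2 μ) = quasiRegular μ b (haarWaveletL2 μ) := by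
  rw [← testToL2_atom, ← testToL2_atom, atom_eq_of_rel h]

lemma waveletTransform_haarWavelet_invariant (f : Lp ℂ 2 μ) (a b : K × Kˣ)
    (h : cosetSetoid K a b) :
    waveletTransform μ (haarWaveletL2 μ) f a = waveletTransform μ (haarWaveletL2 μ) f b := by
  rw [waveletTransform, waveletTransform, quasiRegular_haarWavelet_eq_of_rel h]

/-! ### Inner products with atoms and totality of the atoms in L²(K) -/

lemma inner_testToL2 (f : testSpace μ) (g : Lp ℂ 2 μ) :
    inner ℂ (testToL2 μ f) g = ∫ y, star (f.1 y) * g y ∂μ := by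
  rw [L2.inner_def]
  refine integral_congr_ae ?_
  filter_upwards [coeFn_testToL2 f] with y hy
  rw [hy, RCLike.inner_apply, mul_comm]; rfl

lemma inner_testToL2_testToL2 (f g : testSpace μ) :
    inner ℂ (testToL2 μ f) (testToL2 μ g) = ∫ y, star (f.1 y) * g.1 y ∂μ := by
  rw [inner_testToL2]
  refine integral_congr_ae ?_
  filter_upwards [coeFn_testToL2 g] with y hy
  rw [hy]

lemma setIntegral_coset_eq_inner (x : K) (k : ℤ) (f : Lp ℂ 2 μ) :
    ∫ y in {y | y - x ∈ fracIdeal K k}, f y ∂μ =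
      inner ℂ (indicatorConstLp 2 (isOpen_coset x k).measurableSet
        (isCompact_coset x k).measure_ne_top (1 : ℂ)) f := by
  rw [L2.inner_indicatorConstLp_one]

lemma integrableOn_of_isCompact (f : Lp ℂ 2 μ) {S : Set K} (hS : IsCompact S) :
    IntegrableOn f S μ :=
  ((Lp.memLp f).locallyIntegrable (by norm_num)).integrableOn_isCompact hS

/-- When 𝔇 has measure 1, q^k times the integral over a coset of 𝔓^k is the mean of f there: the
transform compares the means over two nested balls. -/
lemma waveletTransform_haarWavelet_eq (f : Lp ℂ 2 μ) (a : K × Kˣ) :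
    waveletTransform μ (haarWaveletL2 μ) f a = ((actFactor a * kabs (a.2 : K) : ℝ) : ℂ) *
      ((resCard K : ℂ) ^ level a.2 * (∫ y in {y | y - a.1 ∈ fracIdeal K (level a.2)}, f y ∂μ) -
        (resCard K : ℂ) ^ (level a.2 - 1) *
          ∫ y in {y | y - a.1 ∈ fracIdeal K (level a.2 - 1)}, f y ∂μ) := by
  rw [waveletTransform, ← testToL2_atom, inner_testToL2]
  have h1 : ∀ j : ℤ, ∫ y in {y | y - a.1 ∈ fracIdeal K j}, f y ∂μ =
      ∫ y, {y | y - a.1 ∈ fracIdeal K j}.indicator f y ∂μ := fun j =>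
    (integral_indicator (isOpen_coset a.1 j).measurableSet).symm
  have h2 : ∀ j : ℤ, Integrable ({y | y - a.1 ∈ fracIdeal K j}.indicator f) μ := fun j =>
    (integrable_indicator_iff (isOpen_coset a.1 j).measurableSet).2
      (integrableOn_of_isCompact f (isCompact_coset a.1 j))
  rw [h1, h1, ← integral_const_mul, ← integral_const_mul, ← integral_sub ((h2 _).const_mul _)
    ((h2 _).const_mul _), ← integral_const_mul]
  refine integral_congr_ae (Filter.Eventually.of_forall fun y => ?_)
  simp only [star_atom]
  rw [atom_apply, ← neg_sub, besovKernel_neg, mul_assoc]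
  congr 1
  simp only [besovKernel, indicator, mem_ofPred_eq]
  split_ifs <;> ring

/-- The translates and dilates of the wavelet are total in `L²(K)`. -/
lemma eq_zero_of_waveletTransform_eq_zero (hμ : μ (fracIdeal K 0) = 1) {f : Lp ℂ 2 μ}
    (hf : ∀ a, waveletTransform μ (haarWaveletL2 μ) f a = 0) : f = 0 := by
  have hq := resCard_ne_zero_complex (K := K)
  have hq0 := resCard_real_pos K
  -- A vanishing transform at scale q^{-k} means that f has equal means over x + 𝔓^k and x +
  -- 𝔓^{k-1}.
  have hstep : ∀ (x : K) (k : ℤ),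
      (resCard K : ℂ) ^ k * (∫ y in {y | y - x ∈ fracIdeal K k}, f y ∂μ) =
        (resCard K : ℂ) ^ (k - 1) * ∫ y in {y | y - x ∈ fracIdeal K (k - 1)}, f y ∂μ := by
    intro x k
    obtain ⟨h, hh⟩ := exists_unit_kabs_eq K k
    have := hf (x, h)
    rw [waveletTransform_haarWavelet_eq, level_eq_of_kabs hh] at this
    rcases mul_eq_zero.1 this with h0 | h0
    · exfalso
      have h1 : 0 < actFactor ((x, h) : K × Kˣ) := Real.rpow_pos_of_pos (kabs_units_pos_real h) _
      have h2 := mul_pos h1 (kabs_units_pos_real h)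
      exact h2.ne' (by exact_mod_cast h0)
    · exact sub_eq_zero.1 h0
  have hiter : ∀ (x : K) (k : ℤ) (n : ℕ),
      (resCard K : ℂ) ^ k * (∫ y in {y | y - x ∈ fracIdeal K k}, f y ∂μ) =
        (resCard K : ℂ) ^ (k - n) * ∫ y in {y | y - x ∈ fracIdeal K (k - n)}, f y ∂μ := by
    intro x k n
    induction n with
    | zero => simp
    | succ n ih =>
      rw [ih, hstep]
      push_cast
      simp only [sub_sub]
  -- By Cauchy–Schwarz the mean over x + 𝔓^k is O(q^{k/2}). It does not change as k tends to -∞, so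
  -- it is zero.
  have hbound : ∀ (x : K) (k : ℤ),
      ‖(resCard K : ℂ) ^ k * ∫ y in {y | y - x ∈ fracIdeal K k}, f y ∂μ‖ ≤
        √((resCard K : ℝ) ^ k) * ‖f‖ := by
    intro x k
    rw [setIntegral_coset_eq_inner, norm_mul]
    have h1 := norm_inner_le_norm (𝕜 := ℂ) (indicatorConstLp 2 (isOpen_coset x k).measurableSet
        (isCompact_coset x k).measure_ne_top (1 : ℂ) (μ := μ)) f
    rw [norm_indicatorConstLp (by norm_num) (by norm_num), measureReal_def, measure_coset_fracIdeal,
      ← measureReal_def, measureReal_fracIdeal_eq hμ] at h1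
    have h2 : ‖(resCard K : ℂ) ^ k‖ = (resCard K : ℝ) ^ k := by simp
    rw [h2]
    have hp : (0 : ℝ) < (resCard K : ℝ) ^ k := zpow_pos hq0 k
    calc (resCard K : ℝ) ^ k * _ ≤ (resCard K : ℝ) ^ k * _ := mul_le_mul_of_nonneg_left h1 hp.le
      _ = √((resCard K : ℝ) ^ k) * ‖f‖ := by
        rw [zpow_neg, norm_one, one_mul, ← mul_assoc]
        congr 1
        simp only [ENNReal.toReal_ofNat]
        rw [← Real.sqrt_eq_rpow, Real.sqrt_inv]
        nth_rewrite 1 [← Real.mul_self_sqrt hp.le]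
        rw [mul_assoc, mul_inv_cancel₀ (Real.sqrt_pos.2 hp).ne', mul_one]
  have hball : ∀ (x : K) (k : ℤ), ∫ y in {y | y - x ∈ fracIdeal K k}, f y ∂μ = 0 := by
    intro x k
    have hlim : Filter.Tendsto (fun n : ℕ => √((resCard K : ℝ) ^ (k - (n : ℤ))) * ‖f‖)
        Filter.atTop (nhds 0) := by
      have h1 : Filter.Tendsto (fun n : ℕ => (resCard K : ℝ) ^ (k - (n : ℤ)))
          Filter.atTop (nhds 0) := by
        have h2 := (tendsto_pow_atTop_nhds_zero_of_lt_one (r := ((resCard K : ℝ))⁻¹)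
          (by positivity) (inv_lt_one_of_one_lt₀ (one_lt_resCard_real K))).const_mul
            ((resCard K : ℝ) ^ k)
        rw [mul_zero] at h2
        refine h2.congr fun n => ?_
        rw [zpow_sub₀ hq0.ne', zpow_natCast, inv_pow]; rfl
      have h3 := (h1.sqrt).mul_const ‖f‖
      simpa using h3
    have h0 : (resCard K : ℂ) ^ k * (∫ y in {y | y - x ∈ fracIdeal K k}, f y ∂μ) = 0 := by
      rw [← norm_le_zero_iff]
      refine ge_of_tendsto' hlim fun n => ?_
      rw [hiter x k n]
      exact hbound x _
    exact (mul_eq_zero.1 h0).resolve_left (zpow_ne_zero k hq)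
  -- A compact union of cosets of 𝔓^k splits into countably many disjoint balls, over each of which
  -- f integrates to zero.
  have hopen : ∀ (S : Set K) (k : ℤ), IsCompact S → (∀ x ∈ S, {y | y - x ∈ fracIdeal K k} ⊆ S) →
      ∫ y in S, f y ∂μ = 0 := by
    intro S k hS hSk
    let st : Setoid K :=
      { r := fun x y => y - x ∈ fracIdeal K k
        iseqv :=
          { refl := fun x => by simp [zero_mem_fracIdeal]
            symm := fun {x y} h => by rw [← neg_sub, neg_mem_fracIdeal]; exact h
            trans := fun {x y z} h h' => by
              simpa using add_mem_fracIdeal h h' } }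
    have hfib : ∀ i : Quotient st, {y | (⟦y⟧ : Quotient st) = i} =
        {y | y - i.out ∈ fracIdeal K k} := by
      intro i
      ext y
      rw [mem_ofPred_eq, eq_comm, ← Quotient.out_eq i, Quotient.eq, Quotient.out_eq]; rfl
    have hcount : Countable (Quotient st) := by
      obtain ⟨D, hD, hDd⟩ := TopologicalSpace.exists_countable_dense K
      have : Countable D := hD
      refine Function.Surjective.countable (f := fun d : D => (⟦(d : K)⟧ : Quotient st)) ?_
      intro i
      obtain ⟨a, ha, haD⟩ := hDd.exists_mem_open (isOpen_coset i.out k)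
        ⟨i.out, by simp [zero_mem_fracIdeal]⟩
      refine ⟨⟨a, ha⟩, ?_⟩
      have : a ∈ {y | (⟦y⟧ : Quotient st) = i} := by rw [hfib]; exact haD
      exact this
    let T : Quotient st → Set K := fun i => S ∩ {y | (⟦y⟧ : Quotient st) = i}
    have hTU : S = ⋃ i, T i := by ext y; simp [T]
    have hT : ∀ i, T i = ∅ ∨ T i = {y | y - i.out ∈ fracIdeal K k} := by
      intro i
      rcases (T i).eq_empty_or_nonempty with h | ⟨z, hzS, hz⟩
      · exact Or.inl h
      · right
        simp only [T, hfib] at hz ⊢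
        refine inter_eq_right.2 fun y hy => hSk z hzS ?_
        have := sub_mem_fracIdeal (show y - i.out ∈ fracIdeal K k from hy) hz
        simpa using this
    have hTm : ∀ i, MeasurableSet (T i) := by
      intro i
      rcases hT i with h | h <;> rw [h]
      · exact MeasurableSet.empty
      · exact (isOpen_coset _ k).measurableSet
    rw [hTU, integral_iUnion hTm]
    · refine (tsum_congr fun i => ?_).trans tsum_zero
      rcases hT i with h | h <;> rw [h]
      · simp
      · exact hball _ k
    · intro i j hij
      refine Set.disjoint_left.2 fun y hy hy' => hij ?_
      exact hy.2.symm.trans hy'.2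
    · rw [← hTU]; exact integrableOn_of_isCompact f hS
  -- A general compact S is the decreasing intersection of the sets S + 𝔓^n, to which the previous
  -- step applies.
  have hcpt : ∀ S : Set K, IsCompact S → ∫ y in S, f y ∂μ = 0 := by
    intro S hS
    have hadd : ∀ n : ℕ, IsCompact (S + fracIdeal K n) := fun n => hS.add (isCompact_fracIdeal _)
    have hanti : Antitone fun n : ℕ => S + fracIdeal K (n : ℤ) := fun m n hmn =>
      add_subset_add_left (fracIdeal_mono (by exact_mod_cast hmn))
    have hInter : ⋂ n : ℕ, (S + fracIdeal K (n : ℤ)) = S := by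
      apply Subset.antisymm
      · intro y hy
        by_contra hyS
        obtain ⟨n, hn⟩ := exists_coset_subset (hS.isClosed.isOpen_compl.mem_nhds hyS)
        obtain ⟨s, hs, p, hp, hsp⟩ := Set.mem_add.1 (mem_iInter.1 hy n)
        refine hn ?_ hs
        rw [mem_ofPred_eq, ← hsp, ← neg_mem_fracIdeal]
        simpa using hp
      · refine subset_iInter fun n y hy => ?_
        exact ⟨y, hy, 0, zero_mem_fracIdeal _, add_zero y⟩
    have h1 := tendsto_setIntegral_of_antitone (μ := μ) (f := f)
      (s := fun n : ℕ => S + fracIdeal K (n : ℤ)) (fun n => (hadd n).measurableSet) hanti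
      ⟨0, integrableOn_of_isCompact f (hadd 0)⟩
    rw [hInter] at h1
    refine tendsto_nhds_unique h1 ?_
    refine (tendsto_const_nhds (x := (0 : ℂ))).congr fun n => ?_
    refine (hopen _ n (hadd n) ?_).symm
    rintro _ ⟨s, hs, p, hp, rfl⟩ y hy
    refine ⟨s, hs, p + (y - (s + p)), add_mem_fracIdeal hp hy, ?_⟩
    change s + (p + (y - (s + p))) = y
    ring
  have h0 : f =ᵐ[μ] 0 := ae_eq_zero_of_forall_setIntegral_isCompact_eq_zero'
    ((Lp.memLp f).locallyIntegrable (by norm_num)) hcpt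
  exact (Lp.eq_zero_iff_ae_eq_zero).2 h0

end representation

/-! ### The reproducing kernel of the wavelet -/

section kernel

variable [MeasurableSpace K] [BorelSpace K] {μ : Measure K} [μ.IsAddHaarMeasure] [μ.Regular]

/-- Convolution of the indicator functions of two fractional ideals. -/
lemma integral_indicator_mul_indicator (hμ : μ (fracIdeal K 0) = 1) (i j : ℤ) (x : K) :
    ∫ y, (fracIdeal K i).indicator (fun _ => (1 : ℂ)) (y - x) *
        (fracIdeal K j).indicator (fun _ => (1 : ℂ)) y ∂μ =
      (resCard K : ℂ) ^ (-max i j) *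
        (fracIdeal K (min i j)).indicator (fun _ => (1 : ℂ)) x := by
  have hE : ∀ y : K, (fracIdeal K i).indicator (fun _ => (1 : ℂ)) (y - x) *
        (fracIdeal K j).indicator (fun _ => (1 : ℂ)) y =
      ({y : K | y - x ∈ fracIdeal K i} ∩ fracIdeal K j).indicator (fun _ => (1 : ℂ)) y := by
    intro y
    by_cases h1 : y - x ∈ fracIdeal K i <;> by_cases h2 : y ∈ fracIdeal K j <;>
      simp [indicator, h1, h2]
  simp only [hE]
  have hm : MeasurableSet ({y : K | y - x ∈ fracIdeal K i} ∩ fracIdeal K j) :=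
    (isOpen_coset x i).measurableSet.inter (measurableSet_fracIdeal j)
  rw [integral_indicator hm, setIntegral_const, Complex.real_smul, mul_one]
  by_cases hx : x ∈ fracIdeal K (min i j)
  · rw [indicator_of_mem hx, mul_one]
    have hmeas : μ.real ({y : K | y - x ∈ fracIdeal K i} ∩ fracIdeal K j) =
        (resCard K : ℝ) ^ (-max i j) := by
      rcases le_total i j with hij | hij
      · rw [min_eq_left hij] at hx
        rw [max_eq_right hij, ← measureReal_fracIdeal_eq hμ]
        congr 1
        refine inter_eq_right.2 fun y hy => sub_mem_fracIdeal (fracIdeal_mono hij hy) hx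
      · rw [min_eq_right hij] at hx
        rw [max_eq_left hij, ← measureReal_fracIdeal_eq hμ, measureReal_def, measureReal_def,
          ← measure_coset_fracIdeal μ x i]
        congr 2
        refine inter_eq_left.2 fun y hy => ?_
        have := add_mem_fracIdeal (fracIdeal_mono hij hy) hx
        simpa using this
    rw [hmeas]; push_cast; rfl
  · rw [indicator_of_notMem hx, mul_zero]
    have hem : ({y : K | y - x ∈ fracIdeal K i} ∩ fracIdeal K j) = ∅ := by
      refine eq_empty_of_forall_notMem fun y hy => hx ?_
      have h1 : y - x ∈ fracIdeal K (min i j) := fracIdeal_mono (min_le_left _ _) hy.1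
      have h2 : y ∈ fracIdeal K (min i j) := fracIdeal_mono (min_le_right _ _) hy.2
      simpa using sub_mem_fracIdeal h2 h1
    rw [hem]; simp

lemma continuous_indicator_fracIdeal (i : ℤ) :
    Continuous fun y : K => (fracIdeal K i).indicator (fun _ => (1 : ℂ)) y :=
  (LocallyConstant.charFn ℂ (isClopen_fracIdeal i)).isLocallyConstant.continuous

lemma integrable_indicator_mul_indicator (i j : ℤ) (x : K) :
    Integrable (fun y => (fracIdeal K i).indicator (fun _ => (1 : ℂ)) (y - x) *
        (fracIdeal K j).indicator (fun _ => (1 : ℂ)) y) μ := by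
  refine Continuous.integrable_of_hasCompactSupport ?_ ?_
  · exact ((continuous_indicator_fracIdeal i).comp (by fun_prop)).mul
      (continuous_indicator_fracIdeal j)
  · refine HasCompactSupport.intro (isCompact_fracIdeal j) fun y hy => ?_
    rw [indicator_of_notMem hy, mul_zero]

/-- Convolution of the Littlewood--Paley kernels. -/
lemma integral_besovKernel_mul_besovKernel (hμ : μ (fracIdeal K 0) = 1) (k : ℤ) (x : K) :
    ∫ y, besovKernel K k (y - x) * besovKernel K 0 y ∂μ =
      if k = 0 then besovKernel K 0 x else 0 := by
  have hq := resCard_ne_zero_complex (K := K)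
  set q : ℂ := (resCard K : ℂ) with hqdef
  have hE : ∀ y : K, besovKernel K k (y - x) * besovKernel K 0 y =
      q ^ k * ((fracIdeal K k).indicator (fun _ => (1 : ℂ)) (y - x) *
        (fracIdeal K 0).indicator (fun _ => (1 : ℂ)) y) -
      q ^ (k - 1) * ((fracIdeal K (k - 1)).indicator (fun _ => (1 : ℂ)) (y - x) *
        (fracIdeal K 0).indicator (fun _ => (1 : ℂ)) y) -
      (q ^ k * q⁻¹ * ((fracIdeal K k).indicator (fun _ => (1 : ℂ)) (y - x) *
        (fracIdeal K (-1)).indicator (fun _ => (1 : ℂ)) y) -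
      q ^ (k - 1) * q⁻¹ * ((fracIdeal K (k - 1)).indicator (fun _ => (1 : ℂ)) (y - x) *
        (fracIdeal K (-1)).indicator (fun _ => (1 : ℂ)) y)) := by
    intro y
    simp only [besovKernel, zero_sub, zpow_zero, zpow_neg, zpow_one, ← hqdef]
    ring
  have hI := fun i j => integrable_indicator_mul_indicator (μ := μ) (K := K) i j x
  have hI2 : ∀ (c d : ℂ) (i j i' j' : ℤ), Integrable (fun y =>
      c * ((fracIdeal K i).indicator (fun _ => (1 : ℂ)) (y - x) *
        (fracIdeal K j).indicator (fun _ => (1 : ℂ)) y) -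
      d * ((fracIdeal K i').indicator (fun _ => (1 : ℂ)) (y - x) *
        (fracIdeal K j').indicator (fun _ => (1 : ℂ)) y)) μ := fun c d i j i' j' =>
    ((hI i j).const_mul c).sub ((hI i' j').const_mul d)
  simp only [hE]
  rw [integral_sub (hI2 _ _ _ _ _ _) (hI2 _ _ _ _ _ _),
    integral_sub ((hI _ _).const_mul _) ((hI _ _).const_mul _),
    integral_sub ((hI _ _).const_mul _) ((hI _ _).const_mul _)]
  simp only [integral_const_mul, integral_indicator_mul_indicator hμ, ← hqdef]
  have hz : ∀ m n : ℤ, q ^ m * q ^ n = q ^ (m + n) := fun m n => (zpow_add₀ hq m n).symm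
  have hinv : q⁻¹ = q ^ (-1 : ℤ) := by simp
  -- With I_j = q^j 1_{𝔓^j} the convolution I_i * I_j is I_{min(i,j)}. Hence (I_k - I_{k-1}) * (I_0
  -- - I_{-1}) cancels in pairs unless k = 0.
  split_ifs with hk
  · subst hk
    simp only [besovKernel, ← hqdef, zero_sub, max_self, min_self, hinv, ← mul_assoc, hz]
    norm_num
  · rcases lt_or_gt_of_ne hk with h | h
    · rw [max_eq_right h.le, max_eq_right (by lia : k - 1 ≤ 0), max_eq_right (by lia : k ≤ -1),
        max_eq_right (by lia : k - 1 ≤ -1), min_eq_left h.le, min_eq_left (by lia : k - 1 ≤ 0),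
        min_eq_left (by lia : k ≤ -1), min_eq_left (by lia : k - 1 ≤ -1)]
      simp only [hinv, ← mul_assoc, hz]
      ring_nf
    · rw [max_eq_left h.le, max_eq_left (by lia : (0 : ℤ) ≤ k - 1), max_eq_left (by lia : -1 ≤ k),
        max_eq_left (by lia : -1 ≤ k - 1), min_eq_right h.le, min_eq_right (by lia : (0 : ℤ) ≤ k - 1),
        min_eq_right (by lia : -1 ≤ k), min_eq_right (by lia : -1 ≤ k - 1)]
      simp only [hinv, ← mul_assoc, hz]
      ring_nf

variable (μ) in
/-- The reproducing kernel `W_φ φ`. -/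
def waveletKernel (a : K × Kˣ) : ℂ :=
  waveletTransform μ (haarWaveletL2 μ) (haarWaveletL2 μ) a

/-- The inner product is a convolution of Φ_k with Φ_0, and different scales are orthogonal. The
kernel thus lives on |h| = 1, where it is Φ_0; its compact support gives every integrability
statement below that involves the kernel. -/
lemma waveletKernel_eq (hμ : μ (fracIdeal K 0) = 1) (a : K × Kˣ) :
    waveletKernel μ a = if kabs (a.2 : K) = 1 then besovKernel K 0 a.1 else 0 := by
  rw [waveletKernel, waveletTransform, ← testToL2_atom, haarWaveletL2, inner_testToL2_testToL2]
  simp only [star_atom]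
  simp only [atom_apply, haarWavelet_eq_besovKernel]
  have h1 : ∀ y, ((actFactor a * kabs (a.2 : K) : ℝ) : ℂ) * besovKernel K (level a.2) (a.1 - y) *
      besovKernel K 0 y = ((actFactor a * kabs (a.2 : K) : ℝ) : ℂ) *
      (besovKernel K (level a.2) (y - a.1) * besovKernel K 0 y) := by
    intro y
    rw [← neg_sub y, besovKernel_neg, mul_assoc]
  simp only [h1]
  rw [integral_const_mul, integral_besovKernel_mul_besovKernel hμ]
  have h2 : level a.2 = 0 ↔ kabs (a.2 : K) = 1 := by
    rw [← level_eq_of_kabs (h := (1 : Kˣ)) (k := 0) (by simp), level_eq_iff]; simp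
  simp only [h2]
  split_ifs with h
  · simp [actFactor, h]
  · simp

lemma waveletTransform_atom (a b : K × Kˣ) :
    waveletTransform μ (haarWaveletL2 μ) (quasiRegular μ a (haarWaveletL2 μ)) b =
      waveletKernel μ (affMul (affInv a) b) :=
  waveletTransform_quasiRegular_right _ _ _ _

lemma star_waveletKernel (hμ : μ (fracIdeal K 0) = 1) (a : K × Kˣ) :
    star (waveletKernel μ a) = waveletKernel μ a := by
  rw [waveletKernel_eq hμ]
  split_ifs
  · exact star_besovKernel _ _
  · simp

lemma waveletKernel_eq_inner' (hμ : μ (fracIdeal K 0) = 1) (a : K × Kˣ) :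
    waveletKernel μ a = inner ℂ (haarWaveletL2 μ) (quasiRegular μ a (haarWaveletL2 μ)) := by
  rw [← star_waveletKernel hμ, waveletKernel, waveletTransform]
  exact inner_conj_symm _ _

lemma waveletKernel_affInv (hμ : μ (fracIdeal K 0) = 1) (a : K × Kˣ) :
    waveletKernel μ (affInv a) = waveletKernel μ a := by
  rw [waveletKernel_eq_inner' hμ, ← inner_quasiRegular_left]; rfl

lemma waveletKernel_invariant (a b : K × Kˣ) (h : cosetSetoid K a b) :
    waveletKernel μ a = waveletKernel μ b :=
  waveletTransform_haarWavelet_invariant _ a b h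

lemma continuous_waveletKernel : Continuous (waveletKernel (K := K) μ) :=
  continuous_of_invariant waveletKernel_invariant

lemma besovKernel_zero_of_mem {x : K} (hx : x ∈ fracIdeal K 0) :
    besovKernel K 0 x = 1 - (resCard K : ℂ)⁻¹ := by
  rw [besovKernel, indicator_of_mem hx, indicator_of_mem (fracIdeal_mono (by norm_num) hx)]
  simp

lemma besovKernel_zero_of_notMem {x : K} (hx : x ∉ fracIdeal K (-1)) : besovKernel K 0 x = 0 := by
  have h0 : x ∉ fracIdeal K 0 := fun h => hx (fracIdeal_mono (by norm_num) h)
  simp [besovKernel, hx, h0]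

variable (K) in
/-- The stabilizer scale: a compact set carrying the reproducing kernel. -/
def kernelSupport : Set (K × Kˣ) := fracIdeal K (-1) ×ˢ {h : Kˣ | kabs (h : K) = 1}

lemma isCompact_kernelSupport : IsCompact (kernelSupport K) := by
  refine (isCompact_fracIdeal _).prod ?_
  simpa using isCompact_unit_sphere (1 : Kˣ)

lemma waveletKernel_eq_zero (hμ : μ (fracIdeal K 0) = 1) {a : K × Kˣ}
    (ha : a ∉ kernelSupport K) : waveletKernel μ a = 0 := by
  rw [waveletKernel_eq hμ]
  split_ifs with h
  · exact besovKernel_zero_of_notMem fun h' => ha ⟨h', h⟩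
  · rfl

lemma hasCompactSupport_waveletKernel (hμ : μ (fracIdeal K 0) = 1) :
    HasCompactSupport (waveletKernel (K := K) μ) :=
  HasCompactSupport.intro isCompact_kernelSupport fun _ ha => waveletKernel_eq_zero hμ ha

lemma inner_haarWaveletL2_self (hμ : μ (fracIdeal K 0) = 1) :
    inner ℂ (haarWaveletL2 (K := K) μ) (haarWaveletL2 μ) = 1 - (resCard K : ℂ)⁻¹ := by
  have h1 : waveletKernel μ ((0, 1) : K × Kˣ) =
      inner ℂ (haarWaveletL2 (K := K) μ) (haarWaveletL2 μ) := by
    rw [waveletKernel, waveletTransform, quasiRegular_one]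
  rw [← h1, waveletKernel_eq hμ]
  simp [besovKernel_zero_of_mem (zero_mem_fracIdeal (K := K) 0)]

lemma one_sub_inv_resCard_ne_zero : (1 : ℂ) - (resCard K : ℂ)⁻¹ ≠ 0 := by
  rw [sub_ne_zero, ne_comm, inv_ne_one]
  have := one_lt_resCard K
  exact_mod_cast this.ne'

lemma haarWaveletL2_ne_zero (hμ : μ (fracIdeal K 0) = 1) : haarWaveletL2 (K := K) μ ≠ 0 := by
  intro h
  have := inner_haarWaveletL2_self (K := K) hμ
  rw [h, inner_zero_left] at this
  exact one_sub_inv_resCard_ne_zero this.symm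

/-! ### The spherical function identity -/

lemma continuous_besovKernel (k : ℤ) : Continuous (besovKernel K k) :=
  (continuous_const.mul (continuous_indicator_fracIdeal k)).sub
    (continuous_const.mul (continuous_indicator_fracIdeal (k - 1)))

/-- For i < 0 the mean-zero function Φ_0 is supported in 𝔓^{-1} ⊆ 𝔓^i, so it integrates to zero over
each coset of 𝔓^i. For i = 0 it is constant on the coset of integration, of measure 1. -/
lemma setIntegral_besovKernel_sub (hμ : μ (fracIdeal K 0) = 1) (z : K) {i : ℤ} (hi : i ≤ 0) :
    ∫ w in fracIdeal K i, besovKernel K 0 (z - w) ∂μ =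
      if i = 0 then besovKernel K 0 z else 0 := by
  have hq := resCard_ne_zero_complex (K := K)
  rw [← integral_indicator (measurableSet_fracIdeal i)]
  have hE : ∀ w : K, (fracIdeal K i).indicator (fun w => besovKernel K 0 (z - w)) w =
      (fracIdeal K 0).indicator (fun _ => (1 : ℂ)) (w - z) *
        (fracIdeal K i).indicator (fun _ => (1 : ℂ)) w -
      (resCard K : ℂ)⁻¹ * ((fracIdeal K (-1)).indicator (fun _ => (1 : ℂ)) (w - z) *
        (fracIdeal K i).indicator (fun _ => (1 : ℂ)) w) := by
    intro w
    by_cases hw : w ∈ fracIdeal K i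
    · rw [indicator_of_mem hw, indicator_of_mem hw, ← neg_sub, besovKernel_neg, besovKernel]
      simp
    · simp [indicator_of_notMem hw]
  have hI := fun i j => integrable_indicator_mul_indicator (μ := μ) (K := K) i j z
  simp only [hE]
  rw [integral_sub (hI _ _) ((hI _ _).const_mul _), integral_const_mul,
    integral_indicator_mul_indicator hμ, integral_indicator_mul_indicator hμ]
  split_ifs with h
  · subst h
    simp [besovKernel]
  · rw [max_eq_left hi, max_eq_left (by lia : i ≤ -1), min_eq_right hi,
      min_eq_right (by lia : i ≤ -1)]
    simp [hq]

variable (ν : Measure Kˣ) [ν.IsHaarMeasure]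

lemma measurableSet_unit_sphere : MeasurableSet {h : Kˣ | kabs (h : K) = 1} := by
  simpa using (isOpen_unit_coset (1 : Kˣ)).measurableSet

lemma setIntegral_unit_mul_right {u : Kˣ} (hu : kabs (u : K) = 1) (f : Kˣ → ℂ) :
    ∫ h in {h : Kˣ | kabs (h : K) = 1}, f (h * u) ∂ν =
      ∫ h in {h : Kˣ | kabs (h : K) = 1}, f h ∂ν := by
  rw [← integral_indicator measurableSet_unit_sphere, ← integral_indicator measurableSet_unit_sphere,
    ← integral_mul_right_eq_self ({h : Kˣ | kabs (h : K) = 1}.indicator f) u]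
  congr 1
  funext h
  have : h ∈ {h : Kˣ | kabs (h : K) = 1} ↔ h * u ∈ {h : Kˣ | kabs (h : K) = 1} := by
    simp [hu]
  by_cases hh : h ∈ {h : Kˣ | kabs (h : K) = 1}
  · rw [indicator_of_mem hh, indicator_of_mem (this.1 hh)]
  · rw [indicator_of_notMem hh, indicator_of_notMem (fun h' => hh (this.2 h'))]

lemma setIntegral_sphere_mul {h : Kˣ} (hh : kabs (h : K) = 1) (j : ℤ) (f : K → ℂ) :
    ∫ w in fracIdeal K j \ fracIdeal K (j + 1), f (h * w) ∂μ =
      ∫ w in fracIdeal K j \ fracIdeal K (j + 1), f w ∂μ := by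
  have hm : MeasurableSet (fracIdeal K j \ fracIdeal K (j + 1)) :=
    (measurableSet_fracIdeal j).diff (measurableSet_fracIdeal _)
  rw [← integral_indicator hm, ← integral_indicator hm]
  have h1 := integral_affineHomeo μ (0, h⁻¹)
    ((fracIdeal K j \ fracIdeal K (j + 1)).indicator f)
  simp only [affineHomeo_apply, kabs_units_inv, hh, sub_zero, inv_inv] at h1
  simp only [inv_one, NNReal.coe_one, Complex.ofReal_one, one_mul] at h1
  rw [← h1]
  congr 1
  funext w
  have hmem : ∀ k, (h : K) * w ∈ fracIdeal K k ↔ w ∈ fracIdeal K k := by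
    intro k
    rw [mem_fracIdeal, mem_fracIdeal, kabs_mul, hh, one_mul]
  have : w ∈ fracIdeal K j \ fracIdeal K (j + 1) ↔
      (h : K) * w ∈ fracIdeal K j \ fracIdeal K (j + 1) := by
    rw [mem_sdiff, mem_sdiff, hmem, hmem]
  by_cases hw : w ∈ fracIdeal K j \ fracIdeal K (j + 1)
  · rw [indicator_of_mem hw, indicator_of_mem (this.1 hw)]
  · rw [indicator_of_notMem hw, indicator_of_notMem (fun h' => hw (this.2 h'))]

/-- The functional equation of the spherical function Φ_0 / (1 - q^{-1}) for the action of 𝔇* on K.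
If y ∈ 𝔇, translation by hy leaves Φ_0 unchanged. Otherwise the average over units is an average
over the whole sphere through y, and a sphere is a difference of two ideals, over which the
integrals of Φ_0(z - ·) are known. -/
lemma setIntegral_unit_besovKernel (hμ : μ (fracIdeal K 0) = 1) (z y : K) :
    (1 - (resCard K : ℂ)⁻¹) *
        ∫ h in {h : Kˣ | kabs (h : K) = 1}, besovKernel K 0 (z - h * y) ∂ν =
      (unitMass ν).toReal * besovKernel K 0 z * besovKernel K 0 y := by
  have hq := resCard_ne_zero_complex (K := K)
  set S : Set Kˣ := {h : Kˣ | kabs (h : K) = 1} with hS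
  have hSm : MeasurableSet S := measurableSet_unit_sphere
  by_cases hy : y ∈ fracIdeal K 0
  · have h1 : ∀ h ∈ S, besovKernel K 0 (z - h * y) = besovKernel K 0 z := by
      intro h hh
      have hhy : -((h : K) * y) ∈ fracIdeal K 0 := by
        rw [neg_mem_fracIdeal, mem_fracIdeal, kabs_mul, show kabs (h : K) = 1 from hh, one_mul]
        exact hy
      have hm : ∀ j ≤ (0 : ℤ), (z - h * y ∈ fracIdeal K j ↔ z ∈ fracIdeal K j) := by
        intro j hj
        rw [sub_eq_neg_add]
        exact add_mem_fracIdeal_iff_right (fracIdeal_mono hj hhy)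
      rw [besovKernel, besovKernel, indicator_one_congr (hm 0 le_rfl),
        indicator_one_congr (hm (0 - 1) (by norm_num))]
    rw [setIntegral_congr_fun hSm h1, setIntegral_const, besovKernel_zero_of_mem hy,
      Complex.real_smul, measureReal_def]
    rw [unitMass]; ring
  · have hy0 : y ≠ 0 := by rintro rfl; exact hy (zero_mem_fracIdeal _)
    set u := Units.mk0 y hy0
    obtain ⟨j, hj⟩ := exists_kabs_eq_zpow u
    have hj' : (kabs y : ℝ) = (resCard K : ℝ) ^ (-j) := hj
    have hj0 : j < 0 := by
      rw [mem_fracIdeal_of_kabs_eq hj'] at hy; lia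
    set T : Set K := fracIdeal K j \ fracIdeal K (j + 1) with hT
    have hTm : MeasurableSet T := (measurableSet_fracIdeal j).diff (measurableSet_fracIdeal _)
    have hTc : IsCompact T := (isCompact_fracIdeal j).diff (isClopen_fracIdeal _).isOpen
    have hSc : IsCompact S := by simpa [hS] using isCompact_unit_sphere (1 : Kˣ)
    set A := ∫ h in S, besovKernel K 0 (z - h * y) ∂ν with hA
    have hcont : Continuous fun p : Kˣ × K => besovKernel K 0 (z - p.1 * p.2) :=
      (continuous_besovKernel 0).comp (by fun_prop)
    -- Every w on the sphere T is y times a unit, which the invariance of ν absorbs.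
    have hin : ∀ w ∈ T, ∫ h in S, besovKernel K 0 (z - h * w) ∂ν = A := by
      intro w hw
      have hw0 : w ≠ 0 := by rintro rfl; exact hw.2 (zero_mem_fracIdeal _)
      have hwk : kabs w = kabs y := by
        rw [← NNReal.coe_inj, hj']; exact kabs_eq_zpow_iff.2 hw
      have hv : kabs ((u⁻¹ * Units.mk0 w hw0 : Kˣ) : K) = 1 := by
        rw [Units.val_mul, kabs_mul, kabs_units_inv, Units.val_mk0 hw0, hwk]
        exact inv_mul_cancel₀ (kabs_units_pos u).ne'
      have := setIntegral_unit_mul_right ν hv (fun h => besovKernel K 0 (z - h * y))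
      rw [hA, ← this]
      refine integral_congr_ae (Filter.Eventually.of_forall fun h => ?_)
      have : (w : K) = (u⁻¹ * Units.mk0 w hw0 : Kˣ) * y := by
        rw [Units.val_mul, Units.val_mk0, mul_comm, ← mul_assoc]
        simp [u, hy0]
      simp only
      rw [Units.val_mul, mul_assoc, ← this]
    have hint : Integrable (fun p : Kˣ × K => besovKernel K 0 (z - p.1 * p.2))
        ((ν.restrict S).prod (μ.restrict T)) := by
      rw [Measure.prod_restrict]
      exact hcont.continuousOn.integrableOn_compact (hSc.prod hTc)
    -- The double integral over units h and points w of T, in both orders: the inner integral over h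
    -- is A, and the inner integral over w does not depend on h.
    have hfub : A * μ.real T = (unitMass ν).toReal * ∫ w in T, besovKernel K 0 (z - w) ∂μ := by
      have h1 : ∫ w in T, ∫ h in S, besovKernel K 0 (z - h * w) ∂ν ∂μ = A * μ.real T := by
        rw [setIntegral_congr_fun hTm hin, setIntegral_const, Complex.real_smul, mul_comm]
      have h2 : ∫ h in S, ∫ w in T, besovKernel K 0 (z - h * w) ∂μ ∂ν =
          (unitMass ν).toReal * ∫ w in T, besovKernel K 0 (z - w) ∂μ := by
        rw [setIntegral_congr_fun (g := fun _ => ∫ w in T, besovKernel K 0 (z - w) ∂μ) hSm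
          (fun h hh => setIntegral_sphere_mul hh j (fun w => besovKernel K 0 (z - w))),
          setIntegral_const, Complex.real_smul]
        rfl
      rw [← h1, ← h2]
      exact (integral_integral_swap hint).symm
    -- The integral over 𝔓^j vanishes since j < 0, and the subtracted one over 𝔓^{j+1} survives only
    -- when j + 1 = 0.
    have hT1 : ∫ w in T, besovKernel K 0 (z - w) ∂μ = if j = -1 then -besovKernel K 0 z else 0 := by
      have hic : ∀ i, IntegrableOn (fun w => besovKernel K 0 (z - w)) (fracIdeal K i) μ := fun i =>
        ((continuous_besovKernel 0).comp (by fun_prop)).continuousOn.integrableOn_compact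
          (isCompact_fracIdeal i)
      rw [hT, setIntegral_sdiff (measurableSet_fracIdeal _) (hic _)
        (fracIdeal_mono (by lia)), setIntegral_besovKernel_sub hμ z hj0.le,
        setIntegral_besovKernel_sub hμ z (by lia : j + 1 ≤ 0), if_neg hj0.ne, zero_sub]
      by_cases h : j = -1
      · simp [h]
      · rw [if_neg (by lia), if_neg h, neg_zero]
    have hT2 : (μ.real T : ℂ) = (resCard K : ℂ) ^ (-j) * (1 - (resCard K : ℂ)⁻¹) := by
      rw [hT, measureReal_sdiff (fracIdeal_mono (by lia)) (measurableSet_fracIdeal _)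
        (isCompact_fracIdeal _).measure_ne_top,
        measureReal_fracIdeal_eq hμ, measureReal_fracIdeal_eq hμ]
      push_cast
      rw [neg_add, zpow_add₀ hq, zpow_neg_one]; ring
    rw [hT1, hT2] at hfub
    by_cases h : j = -1
    · have hyk : besovKernel K 0 y = -(resCard K : ℂ)⁻¹ := by
        rw [besovKernel, indicator_of_notMem hy, indicator_of_mem]
        · simp
        · rw [mem_fracIdeal_of_kabs_eq hj']; lia
      rw [if_pos h, h] at hfub
      rw [hyk]
      simp only [neg_neg, zpow_one] at hfub
      field_simp
      field_simp at hfub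
      linear_combination hfub
    · have hyk : besovKernel K 0 y = 0 := by
        refine besovKernel_zero_of_notMem ?_
        rw [mem_fracIdeal_of_kabs_eq hj']; lia
      rw [if_neg h, mul_zero] at hfub
      have hA0 : A = 0 := by
        refine (mul_eq_zero.1 hfub).resolve_right ?_
        exact mul_ne_zero (zpow_ne_zero _ hq) one_sub_inv_resCard_ne_zero
      rw [hA0, hyk]; simp

end kernel

/-! ### Density of the atoms and strong continuity -/

section orthogonality

variable [MeasurableSpace K] [BorelSpace K] {μ : Measure K} [μ.IsAddHaarMeasure] [μ.Regular]

lemma topologicalClosure_span_atoms (hμ : μ (fracIdeal K 0) = 1) :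
    (Submodule.span ℂ (range fun a : K × Kˣ =>
      quasiRegular μ a (haarWaveletL2 μ))).topologicalClosure = ⊤ := by
  rw [Submodule.topologicalClosure_eq_top_iff, Submodule.eq_bot_iff]
  intro f hf
  refine eq_zero_of_waveletTransform_eq_zero hμ fun a => ?_
  exact (Submodule.mem_orthogonal _ _).1 hf _ (Submodule.subset_span ⟨a, rfl⟩)

/-- A closed linear property of vectors of `L²(K)` holds if it holds for the atoms. -/
lemma atom_induction (hμ : μ (fracIdeal K 0) = 1) {P : Lp ℂ 2 μ → Prop}
    (hc : IsClosed {g | P g}) (h0 : P 0) (hadd : ∀ f g, P f → P g → P (f + g))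
    (hsmul : ∀ (c : ℂ) f, P f → P (c • f))
    (hatom : ∀ a, P (quasiRegular μ a (haarWaveletL2 μ))) (g : Lp ℂ 2 μ) : P g := by
  let S : Submodule ℂ (Lp ℂ 2 μ) :=
    { carrier := {g | P g}
      zero_mem' := h0
      add_mem' := fun {f g} hf hg => hadd f g hf hg
      smul_mem' := fun c f hf => hsmul c f hf }
  have h1 : Submodule.span ℂ (range fun a : K × Kˣ => quasiRegular μ a (haarWaveletL2 μ)) ≤ S :=
    Submodule.span_le.2 (by rintro _ ⟨a, rfl⟩; exact hatom a)
  have h2 := Submodule.topologicalClosure_minimal _ h1 hc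
  rw [topologicalClosure_span_atoms hμ] at h2
  exact h2 (Submodule.mem_top (x := g))

lemma quasiRegular_sub (a : K × Kˣ) (f g : Lp ℂ 2 μ) :
    quasiRegular μ a (f - g) = quasiRegular μ a f - quasiRegular μ a g := by
  rw [sub_eq_add_neg, ← neg_one_smul ℂ g, quasiRegular_add, quasiRegular_smul, neg_one_smul,
    ← sub_eq_add_neg]

/-- The orbit map of an atom is locally constant. Since the representation is isometric,
approximating g approximates its orbit map uniformly. -/
lemma continuous_quasiRegular (hμ : μ (fracIdeal K 0) = 1) (g : Lp ℂ 2 μ) :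
    Continuous fun a : K × Kˣ => quasiRegular μ a g := by
  refine atom_induction hμ (P := fun g => Continuous fun a : K × Kˣ => quasiRegular μ a g)
    ?_ ?_ ?_ ?_ ?_ g
  · refine isClosed_of_closure_subset fun g hg => ?_
    refine continuous_of_uniform_approx_of_continuous fun u hu => ?_
    obtain ⟨ε, hε, hεu⟩ := Metric.mem_uniformity_dist.1 hu
    obtain ⟨g', hg', hgg'⟩ := Metric.mem_closure_iff.1 hg ε hε
    refine ⟨_, hg', fun a => hεu ?_⟩
    rwa [dist_eq_norm, ← quasiRegular_sub, norm_quasiRegular, ← dist_eq_norm]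
  · have : ∀ a : K × Kˣ, quasiRegular μ a (0 : Lp ℂ 2 μ) = 0 := fun a => by
      simpa using quasiRegular_smul a 0 (0 : Lp ℂ 2 μ)
    simp only [this]
    exact continuous_const
  · intro f g hf hg
    simp only [quasiRegular_add]
    exact hf.add hg
  · intro c f hf
    simp only [quasiRegular_smul]
    exact hf.const_smul c
  · intro d
    simp only [← quasiRegular_affMul]
    exact (continuous_of_invariant (F := fun a => quasiRegular μ a (haarWaveletL2 μ))
      (fun a b h => quasiRegular_haarWavelet_eq_of_rel h)).comp (continuous_affMul_right d)

lemma continuous_waveletTransform (hμ : μ (fracIdeal K 0) = 1) (g f : Lp ℂ 2 μ) :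
    Continuous fun a : K × Kˣ => waveletTransform μ g f a :=
  (continuous_quasiRegular hμ g).inner continuous_const

/-- The orthogonality relation carries the factor ⟨g, φ⟩, which may vanish. By totality some
translate of g is not orthogonal to φ and can replace g. -/
lemma exists_waveletTransform_ne_zero (hμ : μ (fracIdeal K 0) = 1) {g : Lp ℂ 2 μ} (hg : g ≠ 0) :
    ∃ c : K × Kˣ, inner ℂ (quasiRegular μ c g) (haarWaveletL2 μ) ≠ 0 := by
  by_contra! h
  refine hg (eq_zero_of_waveletTransform_eq_zero hμ fun a => ?_)
  have := h (affInv a)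
  rw [inner_quasiRegular_left, affInv_affInv] at this
  rw [waveletTransform, ← inner_conj_symm, this, map_zero]

/-! ### Orthogonality relations -/

variable (ν : Measure Kˣ) [ν.IsHaarMeasure]

instance instIsFiniteMeasureOnCompactsAffHaar : IsFiniteMeasureOnCompacts (affHaar μ ν) := by
  have h1 : (fun h : Kˣ => ((kabs (h : K) : ℝ≥0∞))⁻¹) =
      fun h : Kˣ => (((kabs (h : K))⁻¹ : ℝ≥0) : ℝ≥0∞) := by
    funext h
    rw [ENNReal.coe_inv (kabs_units_pos h).ne']
  have h2 : IsLocallyFiniteMeasure (ν.withDensity fun h : Kˣ => ((kabs (h : K) : ℝ≥0∞))⁻¹) := by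
    rw [h1]
    exact IsLocallyFiniteMeasure.withDensity_coe
      (continuous_kabs_units.inv₀ fun h => (kabs_units_pos h).ne')
  unfold affHaar
  infer_instance

lemma integral_affHaar_of_unit {F : K × Kˣ → ℂ} (hF : Integrable F (affHaar μ ν))
    (h0 : ∀ a : K × Kˣ, kabs (a.2 : K) ≠ 1 → F a = 0) :
    ∫ a, F a ∂(affHaar μ ν) =
      ∫ h in {h : Kˣ | kabs (h : K) = 1}, ∫ x, F (x, h) ∂μ ∂ν := by
  have hS : MeasurableSet {h : Kˣ | kabs (h : K) = 1} := measurableSet_unit_sphere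
  have hν : (ν.withDensity fun h => ((kabs (h : K) : ℝ≥0∞))⁻¹).restrict
      {h : Kˣ | kabs (h : K) = 1} = ν.restrict {h : Kˣ | kabs (h : K) = 1} := by
    rw [restrict_withDensity hS]
    refine (withDensity_congr_ae ?_).trans withDensity_one
    filter_upwards [ae_restrict_mem hS] with h hh
    rw [show kabs (h : K) = 1 from hh]
    simp
  have h1 : ∀ h ∉ {h : Kˣ | kabs (h : K) = 1}, ∫ x, F (x, h) ∂μ = 0 := by
    intro h hh
    have : ∀ x, F (x, h) = 0 := fun x => h0 (x, h) hh
    simp only [this, integral_zero]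
  rw [affHaar] at hF
  rw [affHaar, integral_prod_symm _ hF, ← setIntegral_eq_integral_of_forall_compl_eq_zero h1, hν]

lemma integrable_mul_waveletKernel (hμ : μ (fracIdeal K 0) = 1) {F : K × Kˣ → ℂ}
    (hF : Continuous F) : Integrable (fun b => F b * waveletKernel μ b) (affHaar μ ν) :=
  (hF.mul continuous_waveletKernel).integrable_of_hasCompactSupport
    (hasCompactSupport_waveletKernel hμ).mul_left

/-- The constant in the orthogonality relations. -/
def orthConst (ν : Measure Kˣ) : ℂ := (unitMass ν).toReal / (1 - (resCard K : ℂ)⁻¹)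

lemma orthConst_ne_zero : orthConst ν ≠ 0 :=
  div_ne_zero (by exact_mod_cast (unitMass_toReal_pos ν).ne') one_sub_inv_resCard_ne_zero

/-- The orthogonality relation for two atoms. The second kernel confines the integral to |h| = 1.
The integral in x is then a convolution of Littlewood–Paley kernels, zero unless c has level 0, and
the remaining integral over units is `setIntegral_unit_besovKernel`. -/
lemma integral_waveletKernel_mul_waveletKernel (hμ : μ (fracIdeal K 0) = 1) (c d : K × Kˣ) :
    ∫ b, waveletKernel μ (affMul (affInv c) (affMul b d)) * waveletKernel μ b ∂(affHaar μ ν) =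
      orthConst ν * waveletKernel μ d * waveletKernel μ c := by
  have hcont : Continuous fun b => waveletKernel μ (affMul (affInv c) (affMul b d)) :=
    continuous_waveletKernel.comp ((continuous_affMul_left _).comp (continuous_affMul_right d))
  rw [integral_affHaar_of_unit ν (integrable_mul_waveletKernel ν hμ hcont) (fun a ha => by
    rw [waveletKernel_eq hμ a, if_neg ha, mul_zero])]
  obtain ⟨z, m⟩ := c
  obtain ⟨y, l⟩ := d
  have hin : ∀ h ∈ {h : Kˣ | kabs (h : K) = 1},
      ∫ x, waveletKernel μ (affMul (affInv (z, m)) (affMul (x, h) (y, l))) *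
        waveletKernel μ (x, h) ∂μ =
      if kabs (l : K) = kabs (m : K) then (kabs (m : K) : ℂ) *
        (if level m = 0 then besovKernel K 0 (z - h * y) else 0) else 0 := by
    intro h hh
    have hh' : kabs (h : K) = 1 := hh
    have h2 : kabs ((m⁻¹ * (h * l) : Kˣ) : K) = 1 ↔ kabs (l : K) = kabs (m : K) := by
      rw [Units.val_mul, Units.val_mul, kabs_mul, kabs_mul, kabs_units_inv, hh', one_mul,
        inv_mul_eq_one₀ (kabs_units_pos m).ne', eq_comm]
    have h3 : ∀ x, waveletKernel μ (affMul (affInv (z, m)) (affMul (x, h) (y, l))) *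
        waveletKernel μ (x, h) = if kabs (l : K) = kabs (m : K) then (kabs (m : K) : ℂ) *
          (besovKernel K (level m) (x - (z - h * y)) * besovKernel K 0 x) else 0 := by
      intro x
      rw [waveletKernel_eq hμ, waveletKernel_eq hμ, if_pos hh']
      simp only [affMul, affInv, h2]
      split_ifs
      · rw [← mul_assoc, ← besovKernel_zero_inv_mul]
        congr 2; ring
      · simp
    simp only [h3]
    split_ifs with h4 h5
    · rw [integral_const_mul, integral_besovKernel_mul_besovKernel hμ, if_pos h5]
    · rw [integral_const_mul, integral_besovKernel_mul_besovKernel hμ, if_neg h5]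
    · simp
  rw [setIntegral_congr_fun measurableSet_unit_sphere hin, waveletKernel_eq hμ,
    waveletKernel_eq hμ]
  have hl : level m = 0 ↔ kabs (m : K) = 1 := by
    rw [← level_eq_of_kabs (h := (1 : Kˣ)) (k := 0) (by simp), level_eq_iff]; simp
  simp only [hl]
  by_cases h1 : kabs (m : K) = 1
  · by_cases h2 : kabs (l : K) = 1
    · simp only [h1, h2, if_true, NNReal.coe_one, Complex.ofReal_one, one_mul]
      have := setIntegral_unit_besovKernel ν hμ z y
      have hne := one_sub_inv_resCard_ne_zero (K := K)
      have h3 : (1 - (resCard K : ℂ)⁻¹) * orthConst ν = (unitMass ν).toReal :=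
        mul_div_cancel₀ _ hne
      rw [← mul_right_inj' hne, this, ← h3]
      ring
    · simp [h1, h2]
  · simp [h1]

lemma norm_integral_waveletTransform_mul_le (hμ : μ (fracIdeal K 0) = 1) (g f : Lp ℂ 2 μ) :
    ‖∫ b, waveletTransform μ g f b * waveletKernel μ b ∂(affHaar μ ν)‖ ≤
      (∫ b, ‖waveletKernel μ b‖ ∂(affHaar μ ν)) * (‖g‖ * ‖f‖) := by
  have hk : Integrable (waveletKernel (K := K) μ) (affHaar μ ν) :=
    continuous_waveletKernel.integrable_of_hasCompactSupport (hasCompactSupport_waveletKernel hμ)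
  rw [← integral_mul_const]
  refine norm_integral_le_of_norm_le (hk.norm.mul_const _)
    (Filter.Eventually.of_forall fun b => ?_)
  rw [norm_mul, mul_comm]
  exact mul_le_mul_of_nonneg_left (norm_waveletTransform_le g f b) (norm_nonneg _)

/-- The orthogonality relations, paired with the wavelet. -/
lemma integral_waveletTransform_mul_waveletKernel (hμ : μ (fracIdeal K 0) = 1)
    (g f : Lp ℂ 2 μ) :
    ∫ b, waveletTransform μ g f b * waveletKernel μ b ∂(affHaar μ ν) =
      orthConst ν * inner ℂ g (haarWaveletL2 μ) * inner ℂ (haarWaveletL2 μ) f := by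
  have hi := fun g f => integrable_mul_waveletKernel ν hμ (continuous_waveletTransform hμ g f)
  have hsmul0 : ∀ a : K × Kˣ, quasiRegular μ a (0 : Lp ℂ 2 μ) = 0 := fun a => by
    simpa using quasiRegular_smul a 0 (0 : Lp ℂ 2 μ)
  have hL : ∀ f : Lp ℂ 2 μ, Continuous fun g : Lp ℂ 2 μ =>
      ∫ b, waveletTransform μ g f b * waveletKernel μ b ∂(affHaar μ ν) := by
    intro f
    refine AddMonoidHomClass.continuous_of_bound (AddMonoidHom.mk' (fun g : Lp ℂ 2 μ =>
      ∫ b, waveletTransform μ g f b * waveletKernel μ b ∂(affHaar μ ν)) ?_)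
      ((∫ b, ‖waveletKernel μ b‖ ∂(affHaar μ ν)) * ‖f‖) ?_
    · intro g g'
      rw [← integral_add (hi g f) (hi g' f)]
      congr 1; funext b
      rw [waveletTransform, quasiRegular_add, inner_add_left, add_mul]; rfl
    · intro g
      refine (norm_integral_waveletTransform_mul_le ν hμ g f).trans (le_of_eq ?_)
      ring
  have hR : ∀ g : Lp ℂ 2 μ, Continuous fun f : Lp ℂ 2 μ =>
      ∫ b, waveletTransform μ g f b * waveletKernel μ b ∂(affHaar μ ν) := by
    intro g
    refine AddMonoidHomClass.continuous_of_bound (AddMonoidHom.mk' (fun f : Lp ℂ 2 μ =>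
      ∫ b, waveletTransform μ g f b * waveletKernel μ b ∂(affHaar μ ν)) ?_)
      ((∫ b, ‖waveletKernel μ b‖ ∂(affHaar μ ν)) * ‖g‖) ?_
    · intro f f'
      rw [← integral_add (hi g f) (hi g f')]
      congr 1; funext b
      rw [waveletTransform, inner_add_right, add_mul]; rfl
    · intro f
      refine (norm_integral_waveletTransform_mul_le ν hμ g f).trans (le_of_eq ?_)
      ring
  -- Both sides are linear and continuous in f, and conjugate-linear and continuous in g; so first f
  -- and then g may be taken to be an atom.
  refine atom_induction hμ (P := fun f => ∫ b, waveletTransform μ g f b *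
    waveletKernel μ b ∂(affHaar μ ν) =
      orthConst ν * inner ℂ g (haarWaveletL2 μ) * inner ℂ (haarWaveletL2 μ) f) ?_ ?_ ?_ ?_ ?_ f
  · exact isClosed_eq (hR g) (continuous_const.mul (continuous_const.inner continuous_id))
  · simp [waveletTransform]
  · intro f f' hf hf'
    rw [inner_add_right, mul_add, ← hf, ← hf', ← integral_add (hi g f) (hi g f')]
    congr 1; funext b
    rw [waveletTransform, inner_add_right, add_mul]; rfl
  · intro c f hf
    rw [inner_smul_right, mul_left_comm, ← hf, ← integral_const_mul]
    congr 1; funext b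
    rw [waveletTransform, inner_smul_right, mul_assoc]; rfl
  intro c
  refine atom_induction hμ (P := fun g => ∫ b, waveletTransform μ g
    (quasiRegular μ c (haarWaveletL2 μ)) b * waveletKernel μ b ∂(affHaar μ ν) =
      orthConst ν * inner ℂ g (haarWaveletL2 μ) *
        inner ℂ (haarWaveletL2 μ) (quasiRegular μ c (haarWaveletL2 μ))) ?_ ?_ ?_ ?_ ?_ g
  · exact isClosed_eq (hL _)
      ((continuous_const.mul (continuous_id.inner continuous_const)).mul continuous_const)
  · simp [waveletTransform, hsmul0]
  · intro g g' hg hg'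
    rw [inner_add_left, mul_add, add_mul, ← hg, ← hg', ← integral_add (hi g _) (hi g' _)]
    congr 1; funext b
    rw [waveletTransform, quasiRegular_add, inner_add_left, add_mul]; rfl
  · intro e g hg
    rw [inner_smul_left, mul_left_comm, mul_assoc, ← hg, ← integral_const_mul]
    congr 1; funext b
    rw [waveletTransform, quasiRegular_smul, inner_smul_left, mul_assoc]; rfl
  · intro d
    rw [← waveletKernel_eq_inner' hμ]
    have h1 : inner ℂ (quasiRegular μ d (haarWaveletL2 μ)) (haarWaveletL2 μ) =
      waveletKernel μ d := rfl
    rw [h1, ← integral_waveletKernel_mul_waveletKernel ν hμ c d]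
    congr 1; funext b
    rw [waveletTransform_quasiRegular_left, waveletTransform_atom]

/-- The orthogonality relation for π(a⁻¹)f: convolving W_g f with the fixed kernel of φ returns W_φ
f up to a constant. -/
lemma integral_waveletTransform_affMul_mul_waveletKernel (hμ : μ (fracIdeal K 0) = 1)
    (g f : Lp ℂ 2 μ) (a : K × Kˣ) :
    ∫ b, waveletTransform μ g f (affMul a b) * waveletKernel μ b ∂(affHaar μ ν) =
      orthConst ν * inner ℂ g (haarWaveletL2 μ) * waveletTransform μ (haarWaveletL2 μ) f a := by
  have h := integral_waveletTransform_mul_waveletKernel ν hμ g (quasiRegular μ (affInv a) f)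
  simp only [waveletTransform_quasiRegular_right, affInv_affInv] at h
  rw [h, waveletTransform, inner_quasiRegular_left]

lemma orthConst_mul_inner (hμ : μ (fracIdeal K 0) = 1) :
    orthConst ν * inner ℂ (haarWaveletL2 (K := K) μ) (haarWaveletL2 μ) =
      ((unitMass ν).toReal : ℂ) := by
  rw [inner_haarWaveletL2_self hμ, orthConst, div_mul_cancel₀ _ one_sub_inv_resCard_ne_zero]

lemma reproducing_formula (hμ : μ (fracIdeal K 0) = 1) (f : Lp ℂ 2 μ) (a : K × Kˣ) :
    ∫ b, waveletTransform μ (haarWaveletL2 μ) f (affMul a b) * waveletKernel μ b ∂(affHaar μ ν) =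
      (unitMass ν).toReal * waveletTransform μ (haarWaveletL2 μ) f a := by
  rw [integral_waveletTransform_affMul_mul_waveletKernel ν hμ, orthConst_mul_inner ν hμ]

/-! ### Wavelet coefficients of test functions -/

lemma exists_uniform_of_mem_testSpace (ψ : testSpace μ) :
    ∃ (m : ℕ) (n : ℕ), (∀ x ∉ fracIdeal K (-m), ψ.1 x = 0) ∧
      ∀ x y, x - y ∈ fracIdeal K n → ψ.1 x = ψ.1 y := by
  obtain ⟨ψ, h1, h2, -⟩ := ψ
  change ∃ (m : ℕ) (n : ℕ), (∀ x ∉ fracIdeal K (-m), ψ x = 0) ∧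
      ∀ x y, x - y ∈ fracIdeal K n → ψ x = ψ y
  obtain ⟨m, hm⟩ : ∃ m : ℕ, tsupport ψ ⊆ fracIdeal K (-m) := by
    have := h2.isCompact.elim_directed_cover (fun m : ℕ => fracIdeal K (-m : ℤ))
      (fun m => (isClopen_fracIdeal _).isOpen)
      (fun x _ => mem_iUnion.2 (exists_mem_fracIdeal x))
      (monotone_nat_of_le_succ fun n => fracIdeal_mono (by simp)).directed_le
    exact this
  have hm' : ∀ x ∉ fracIdeal K (-m), ψ x = 0 := fun x hx =>
    image_eq_zero_of_notMem_tsupport fun h => hx (hm h)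
  have hloc : ∀ x : K, ∃ n : ℕ, ∀ y, y - x ∈ fracIdeal K n → ψ y = ψ x := by
    intro x
    obtain ⟨U, hU, hxU, hc⟩ := (IsLocallyConstant.iff_exists_open ψ).1 h1 x
    obtain ⟨n, hn⟩ := exists_coset_subset (hU.mem_nhds hxU)
    exact ⟨n, fun y hy => hc y (hn hy)⟩
  choose n hn using hloc
  obtain ⟨T, -, hT⟩ := (isCompact_fracIdeal (K := K) (-m)).elim_nhds_subcover
    (fun x => {y | y - x ∈ fracIdeal K (n x)})
    (fun x _ => (isOpen_coset x _).mem_nhds (by simp [zero_mem_fracIdeal]))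
  refine ⟨m, T.sup n, hm', fun x y hxy => ?_⟩
  -- The exponents of constancy are natural numbers, so x and y lie either both inside 𝔓^{-m} or
  -- both outside, where ψ vanishes.
  have hxy' : x - y ∈ fracIdeal K (-m) := fracIdeal_mono (by lia) hxy
  by_cases hx : x ∈ fracIdeal K (-m)
  · obtain ⟨x₀, hx₀, hxx₀⟩ := mem_iUnion₂.1 (hT hx)
    have h3 : x - y ∈ fracIdeal K (n x₀) :=
      fracIdeal_mono (by exact_mod_cast Finset.le_sup hx₀) hxy
    rw [hn x₀ x hxx₀, hn x₀ y]
    have := sub_mem_fracIdeal (show x - x₀ ∈ fracIdeal K (n x₀) from hxx₀) h3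
    simpa using this
  · have hy : y ∉ fracIdeal K (-m) := fun hy => hx (by simpa using add_mem_fracIdeal hxy' hy)
    rw [hm' x hx, hm' y hy]

lemma atom_eq_zero_of_notMem {a : K × Kˣ} {y : K} (h : a.1 - y ∉ fracIdeal K (level a.2 - 1)) :
    (atom μ a).1 y = 0 := by
  have h' : a.1 - y ∉ fracIdeal K (level a.2) := fun h' => h (fracIdeal_mono (by lia) h')
  rw [atom_apply, besovKernel, indicator_of_notMem h, indicator_of_notMem h']
  simp

lemma atom_eq_of_sub_mem {a : K × Kˣ} {y z : K} (h : y - z ∈ fracIdeal K (level a.2)) :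
    (atom μ a).1 y = (atom μ a).1 z := by
  have hm : ∀ j ≤ level a.2, (a.1 - y ∈ fracIdeal K j ↔ a.1 - z ∈ fracIdeal K j) := by
    intro j hj
    rw [← add_mem_fracIdeal_iff_right (y := a.1 - y) (fracIdeal_mono hj h),
      add_comm, sub_add_sub_cancel]
  rw [atom_apply, atom_apply, besovKernel, besovKernel, indicator_one_congr (hm _ le_rfl),
    indicator_one_congr (hm (level a.2 - 1) (by lia))]

/-- An atom of level k lives on a coset of 𝔓^{k-1} and is constant on cosets of 𝔓^k. If k > n, then
ψ is constant where the atom lives, and the atom has mean zero. If k ≤ -m, the atom is constant on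
𝔓^{-m}, which carries ψ, and ψ has mean zero. At the finitely many levels between, the supports are
disjoint unless the centre lies in 𝔓^{-m}. -/
lemma exists_compact_waveletTransform_eq_zero (ψ : testSpace μ) :
    ∃ C : Set (K × Kˣ), IsCompact C ∧
      ∀ a ∉ C, waveletTransform μ (haarWaveletL2 μ) (testToL2 μ ψ) a = 0 := by
  obtain ⟨m, n, hm, hn⟩ := exists_uniform_of_mem_testSpace ψ
  refine ⟨fracIdeal K (-m) ×ˢ
    {g : Kˣ | (g : K) ∈ fracIdeal K (-m) ∧ (g : K) ∉ fracIdeal K (n + 1)},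
    (isCompact_fracIdeal _).prod (isCompact_annulus _ _), fun a ha => ?_⟩
  rw [waveletTransform, ← testToL2_atom, inner_testToL2_testToL2]
  simp only [star_atom]
  have hlev : ∀ j, (a.2 : K) ∈ fracIdeal K j ↔ j ≤ level a.2 := fun j =>
    mem_fracIdeal_of_kabs_eq (kabs_eq_level a.2)
  rw [mem_prod, mem_ofPred_eq, hlev, hlev] at ha
  rcases lt_or_ge (n : ℤ) (level a.2) with h1 | h1
  · have : ∀ y, (atom μ a).1 y * ψ.1 y = (atom μ a).1 y * ψ.1 a.1 := by
      intro y
      by_cases hy : a.1 - y ∈ fracIdeal K (level a.2 - 1)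
      · rw [hn a.1 y (fracIdeal_mono (by lia) hy)]
      · rw [atom_eq_zero_of_notMem hy, zero_mul, zero_mul]
    simp only [this]
    rw [integral_mul_const, (atom μ a).2.2.2, zero_mul]
  rcases le_or_gt (level a.2) (-m : ℤ) with h2 | h2
  · have : ∀ y, (atom μ a).1 y * ψ.1 y = (atom μ a).1 0 * ψ.1 y := by
      intro y
      by_cases hy : y ∈ fracIdeal K (-m)
      · rw [atom_eq_of_sub_mem (z := 0) (by simpa using fracIdeal_mono h2 hy)]
      · rw [hm y hy, mul_zero, mul_zero]
    simp only [this]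
    rw [integral_const_mul, ψ.2.2.2, mul_zero]
  · have ha1 : a.1 ∉ fracIdeal K (-m) := fun h => ha ⟨h, h2.le, by lia⟩
    have : ∀ y, (atom μ a).1 y * ψ.1 y = 0 := by
      intro y
      by_cases hy : a.1 - y ∈ fracIdeal K (level a.2 - 1)
      · have hy' : y ∉ fracIdeal K (-m) := fun h => ha1 (by
          simpa using add_mem_fracIdeal (fracIdeal_mono (by lia) hy) h)
        rw [hm y hy', mul_zero]
      · rw [atom_eq_zero_of_notMem hy, zero_mul]
    simp only [this, integral_zero]

end orthogonality

/-! ### Weighted `L¹` spaces on the affine group -/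

section weighted

variable [MeasurableSpace K] [BorelSpace K] {μ : Measure K} [μ.IsAddHaarMeasure] [μ.Regular]

/-- A measurable, locally bounded, submultiplicative weight `v ≥ 1` on the affine group with
`v(a) = v(a⁻¹) Δ(a⁻¹)`. -/
structure IsAdmissibleWeight (v : K × Kˣ → ℝ) : Prop where
  measurable : Measurable v
  bounded : ∀ C : Set (K × Kˣ), IsCompact C → BddAbove (v '' C)
  submul : ∀ a b, v (affMul a b) ≤ v a * v b
  symm : ∀ a, v a = v (affInv a) * affMod (affInv a)
  one_le : ∀ a, 1 ≤ v a

variable (μ) in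
/-- The norm of `L¹_v(G)`, as an extended nonnegative real. -/
def weightedNorm (ν : Measure Kˣ) (v : K × Kˣ → ℝ) (F : K × Kˣ → ℂ) : ℝ≥0∞ :=
  ∫⁻ a, ENNReal.ofReal (v a) * ‖F a‖ₑ ∂(affHaar μ ν)

variable {ν : Measure Kˣ} [ν.IsHaarMeasure] {v : K × Kˣ → ℝ}

namespace IsAdmissibleWeight

lemma pos (hv : IsAdmissibleWeight v) (a : K × Kˣ) : 0 < v a := zero_lt_one.trans_le (hv.one_le a)

lemma ofReal_submul (hv : IsAdmissibleWeight v) (a b : K × Kˣ) :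
    ENNReal.ofReal (v (affMul a b)) ≤ ENNReal.ofReal (v a) * ENNReal.ofReal (v b) := by
  rw [← ENNReal.ofReal_mul (hv.pos a).le]
  exact ENNReal.ofReal_le_ofReal (hv.submul a b)

lemma measurable_ofReal (hv : IsAdmissibleWeight v) : Measurable fun a => ENNReal.ofReal (v a) :=
  hv.measurable.ennreal_ofReal

lemma measurable_mul_enorm (hv : IsAdmissibleWeight v) {F : K × Kˣ → ℂ} (hF : Measurable F) :
    Measurable fun a => ENNReal.ofReal (v a) * ‖F a‖ₑ := hv.measurable_ofReal.mul hF.enorm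

end IsAdmissibleWeight

/-- The substitution contributes Δ(b⁻¹) and submultiplicativity contributes v(b⁻¹). Their product is
v(b), which is the purpose of the symmetry condition on the weight. -/
lemma weightedNorm_rightTrans_le (hv : IsAdmissibleWeight v) {F : K × Kˣ → ℂ} (hF : Measurable F)
    (b : K × Kˣ) :
    weightedNorm μ ν v (rightTrans b F) ≤ ENNReal.ofReal (v b) * weightedNorm μ ν v F := by
  have h1 := lintegral_affMul_right μ ν b
    (F := fun a => ENNReal.ofReal (v (affMul a (affInv b))) * ‖F a‖ₑ)
    ((hv.measurable_ofReal.comp (measurable_affMul_right _)).mul hF.enorm)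
  simp only [affMul_affInv_cancel_right] at h1
  rw [weightedNorm]
  simp only [rightTrans]
  rw [h1, hv.symm b, affMod_affInv, mul_comm (v _), ENNReal.ofReal_mul (NNReal.coe_nonneg _),
    ENNReal.ofReal_coe_nnreal, mul_assoc, weightedNorm]
  gcongr
  rw [← lintegral_const_mul _ (hv.measurable_mul_enorm hF)]
  refine lintegral_mono fun a => ?_
  rw [← mul_assoc, mul_comm (ENNReal.ofReal (v (affInv b)))]
  gcongr
  exact hv.ofReal_submul _ _

lemma weightedNorm_leftTrans_le (hv : IsAdmissibleWeight v) {F : K × Kˣ → ℂ} (hF : Measurable F)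
    (a : K × Kˣ) :
    weightedNorm μ ν v (leftTrans a F) ≤ ENNReal.ofReal (v a) * weightedNorm μ ν v F := by
  have h1 := lintegral_affMul_left μ ν a
    (F := fun b => ENNReal.ofReal (v b) * ‖leftTrans a F b‖ₑ)
    (hv.measurable_ofReal.mul (hF.comp (measurable_affMul_left _)).enorm)
  simp only [leftTrans, affInv_affMul_cancel_left] at h1
  rw [weightedNorm]
  simp only [leftTrans]
  rw [← h1, weightedNorm, ← lintegral_const_mul _ (hv.measurable_mul_enorm hF)]
  refine lintegral_mono fun b => ?_
  rw [← mul_assoc]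
  gcongr
  exact hv.ofReal_submul _ _

lemma weightedNorm_const_mul (c : ℂ) {F : K × Kˣ → ℂ} (hv : IsAdmissibleWeight v)
    (hF : Measurable F) :
    weightedNorm μ ν v (fun a => c * F a) = ‖c‖ₑ * weightedNorm μ ν v F := by
  rw [weightedNorm, weightedNorm, ← lintegral_const_mul _ (hv.measurable_mul_enorm hF)]
  refine lintegral_congr fun a => ?_
  rw [enorm_mul]; ring

/-- Convolution inequality in `L¹_v`. -/
lemma weightedNorm_integral_le (hv : IsAdmissibleWeight v) {H k : K × Kˣ → ℂ} (hH : Measurable H)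
    (hk : Measurable k) :
    weightedNorm μ ν v (fun a => ∫ b, H (affMul a b) * k b ∂(affHaar μ ν)) ≤
      weightedNorm μ ν v k * weightedNorm μ ν v H := by
  have hm : Measurable fun p : (K × Kˣ) × (K × Kˣ) =>
      ENNReal.ofReal (v p.1) * (‖H (affMul p.1 p.2)‖ₑ * ‖k p.2‖ₑ) :=
    (hv.measurable_ofReal.comp measurable_fst).mul
      ((hH.comp measurable_affMul).enorm.mul (hk.comp measurable_snd).enorm)
  calc weightedNorm μ ν v (fun a => ∫ b, H (affMul a b) * k b ∂(affHaar μ ν))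
      ≤ ∫⁻ a, ∫⁻ b, ENNReal.ofReal (v a) * (‖H (affMul a b)‖ₑ * ‖k b‖ₑ)
          ∂(affHaar μ ν) ∂(affHaar μ ν) := by
        refine lintegral_mono fun a => ?_
        rw [lintegral_const_mul]
        · gcongr
          refine (enorm_integral_le_lintegral_enorm _).trans (le_of_eq ?_)
          exact lintegral_congr fun b => enorm_mul _ _
        · exact (hH.comp (measurable_affMul_left a)).enorm.mul hk.enorm
    _ = ∫⁻ b, ∫⁻ a, ENNReal.ofReal (v a) * (‖H (affMul a b)‖ₑ * ‖k b‖ₑ)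
          ∂(affHaar μ ν) ∂(affHaar μ ν) := lintegral_lintegral_swap hm.aemeasurable
    _ ≤ ∫⁻ b, (ENNReal.ofReal (v b) * ‖k b‖ₑ) * weightedNorm μ ν v H ∂(affHaar μ ν) := by
        refine lintegral_mono fun b => ?_
        calc ∫⁻ a, ENNReal.ofReal (v a) * (‖H (affMul a b)‖ₑ * ‖k b‖ₑ) ∂(affHaar μ ν)
            = ‖k b‖ₑ * weightedNorm μ ν v (rightTrans b H) := by
              rw [weightedNorm, ← lintegral_const_mul]
              · refine lintegral_congr fun a => ?_
                rw [rightTrans]; ring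
              · exact hv.measurable_mul_enorm (hH.comp (measurable_affMul_right b))
          _ ≤ ‖k b‖ₑ * (ENNReal.ofReal (v b) * weightedNorm μ ν v H) := by
              gcongr; exact weightedNorm_rightTrans_le hv hH b
          _ = _ := by ring
    _ = _ := by
        rw [lintegral_mul_const _ (hv.measurable_mul_enorm hk)]
        rfl

lemma enorm_le_weighted (hv : IsAdmissibleWeight v) (a : K × Kˣ) (z : ℂ) :
    ‖z‖ₑ ≤ ENNReal.ofReal (v a) * ‖z‖ₑ := by
  refine le_mul_of_one_le_left (zero_le) ?_
  rw [ENNReal.one_le_ofReal]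
  exact hv.one_le a

lemma integrable_of_weightedNorm_lt_top (hv : IsAdmissibleWeight v) {F : K × Kˣ → ℂ}
    (hF : Measurable F) (h : weightedNorm μ ν v F < ∞) : Integrable F (affHaar μ ν) :=
  ⟨hF.aestronglyMeasurable, (lintegral_mono fun a => enorm_le_weighted hv a (F a)).trans_lt h⟩

lemma enorm_ofReal_mul (hv : IsAdmissibleWeight v) (a : K × Kˣ) (z : ℂ) :
    ‖(v a : ℂ) * z‖ₑ = ENNReal.ofReal (v a) * ‖z‖ₑ := by
  rw [enorm_mul]
  congr 1
  rw [← ofReal_norm, Complex.norm_real, Real.norm_of_nonneg (hv.pos a).le]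

lemma integrable_weight_mul_iff (hv : IsAdmissibleWeight v) {F : K × Kˣ → ℂ} (hF : Measurable F) :
    Integrable (fun a => (v a : ℂ) * F a) (affHaar μ ν) ↔ weightedNorm μ ν v F < ∞ := by
  have hm : AEStronglyMeasurable (fun a => (v a : ℂ) * F a) (affHaar μ ν) :=
    ((Complex.measurable_ofReal.comp hv.measurable).mul hF).aestronglyMeasurable
  rw [Integrable, and_iff_right hm, HasFiniteIntegral]
  simp only [enorm_ofReal_mul hv]
  rfl

lemma weightedNorm_lt_top_of_compact (hv : IsAdmissibleWeight v) {F : K × Kˣ → ℂ}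
    (hF : Continuous F) {C : Set (K × Kˣ)} (hC : IsCompact C) (h0 : ∀ a ∉ C, F a = 0) :
    weightedNorm μ ν v F < ∞ := by
  obtain ⟨M, hM⟩ := hv.bounded C hC
  have hFi : Integrable F (affHaar μ ν) :=
    hF.integrable_of_hasCompactSupport (HasCompactSupport.intro hC h0)
  calc weightedNorm μ ν v F ≤ ∫⁻ a, ENNReal.ofReal M * ‖F a‖ₑ ∂(affHaar μ ν) := by
        refine lintegral_mono fun a => ?_
        by_cases ha : a ∈ C
        · gcongr; exact hM ⟨a, ha, rfl⟩
        · simp [h0 a ha]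
    _ = ENNReal.ofReal M * ∫⁻ a, ‖F a‖ₑ ∂(affHaar μ ν) :=
        lintegral_const_mul _ hF.measurable.enorm
    _ < ∞ := ENNReal.mul_lt_top ENNReal.ofReal_lt_top hFi.2

lemma weightedNorm_waveletKernel_lt_top (hμ : μ (fracIdeal K 0) = 1) (hv : IsAdmissibleWeight v) :
    weightedNorm μ ν v (waveletKernel μ) < ∞ :=
  weightedNorm_lt_top_of_compact hv continuous_waveletKernel isCompact_kernelSupport
    fun _ ha => waveletKernel_eq_zero hμ ha

/-! ### Independence of the space of test vectors from the analyzing vector -/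

lemma measurable_waveletTransform (hμ : μ (fracIdeal K 0) = 1) (g f : Lp ℂ 2 μ) :
    Measurable (waveletTransform μ g f) := (continuous_waveletTransform hμ g f).measurable

lemma mem_testVectors_iff (hμ : μ (fracIdeal K 0) = 1) (hv : IsAdmissibleWeight v)
    {g f : Lp ℂ 2 μ} :
    f ∈ testVectors μ ν v g ↔ weightedNorm μ ν v (waveletTransform μ g f) < ∞ :=
  integrable_weight_mul_iff hv (measurable_waveletTransform hμ g f)

lemma testVectorNorm_eq (hμ : μ (fracIdeal K 0) = 1) (hv : IsAdmissibleWeight v)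
    (g f : Lp ℂ 2 μ) :
    testVectorNorm μ ν v g f = (weightedNorm μ ν v (waveletTransform μ g f)).toReal := by
  rw [testVectorNorm, integral_norm_eq_lintegral_enorm, weightedNorm]
  · simp only [enorm_ofReal_mul hv]
  · exact ((Complex.measurable_ofReal.comp hv.measurable).mul
      (measurable_waveletTransform hμ g f)).aestronglyMeasurable

/-- With c chosen so that ⟨π(c)g, φ⟩ ≠ 0, W_φ f is a multiple of the convolution of the right
translate of W_g f by c with the kernel of φ. The bound needs only g ≠ 0. -/
lemma exists_weightedNorm_haarWavelet_le (hμ : μ (fracIdeal K 0) = 1) (hv : IsAdmissibleWeight v)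
    {g : Lp ℂ 2 μ} (hg : g ≠ 0) : ∃ C : ℝ≥0∞, C < ∞ ∧ ∀ f : Lp ℂ 2 μ,
      weightedNorm μ ν v (waveletTransform μ (haarWaveletL2 μ) f) ≤
        C * weightedNorm μ ν v (waveletTransform μ g f) := by
  obtain ⟨c, hc⟩ := exists_waveletTransform_ne_zero hμ hg
  set d : ℂ := orthConst ν * inner ℂ (quasiRegular μ c g) (haarWaveletL2 μ) with hd
  have hd0 : d ≠ 0 := mul_ne_zero (orthConst_ne_zero ν) hc
  refine ⟨‖d⁻¹‖ₑ * (weightedNorm μ ν v (waveletKernel μ) * ENNReal.ofReal (v c)), ?_, fun f => ?_⟩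
  · exact ENNReal.mul_lt_top enorm_lt_top (ENNReal.mul_lt_top
      (weightedNorm_waveletKernel_lt_top hμ hv) ENNReal.ofReal_lt_top)
  have h1 : waveletTransform μ (haarWaveletL2 μ) f = fun a => d⁻¹ *
      ∫ b, waveletTransform μ (quasiRegular μ c g) f (affMul a b) * waveletKernel μ b
        ∂(affHaar μ ν) := by
    funext a
    rw [integral_waveletTransform_affMul_mul_waveletKernel ν hμ, ← hd, inv_mul_cancel_left₀ hd0]
  have h2 : waveletTransform μ (quasiRegular μ c g) f = rightTrans c (waveletTransform μ g f) := by
    funext a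
    rw [waveletTransform_quasiRegular_left]; rfl
  have hm : Measurable fun a => ∫ b, waveletTransform μ (quasiRegular μ c g) f (affMul a b) *
      waveletKernel μ b ∂(affHaar μ ν) := by
    simp only [integral_waveletTransform_affMul_mul_waveletKernel ν hμ]
    exact (measurable_waveletTransform hμ _ _).const_mul _
  rw [h1, weightedNorm_const_mul _ hv hm, mul_assoc, mul_assoc]
  gcongr
  refine (weightedNorm_integral_le hv (measurable_waveletTransform hμ _ _)
    continuous_waveletKernel.measurable).trans ?_
  gcongr
  rw [h2]
  exact weightedNorm_rightTrans_le hv (measurable_waveletTransform hμ _ _) c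

/-- Weak reproducing formula for test vectors. -/
lemma integral_waveletTransform_mul_inner (hμ : μ (fracIdeal K 0) = 1) (hv : IsAdmissibleWeight v)
    {f : Lp ℂ 2 μ} (hf : weightedNorm μ ν v (waveletTransform μ (haarWaveletL2 μ) f) < ∞)
    (f' : Lp ℂ 2 μ) :
    ∫ b, waveletTransform μ (haarWaveletL2 μ) f b *
        inner ℂ f' (quasiRegular μ b (haarWaveletL2 μ)) ∂(affHaar μ ν) =
      (unitMass ν).toReal * inner ℂ f' f := by
  have hfi := integrable_of_weightedNorm_lt_top hv (measurable_waveletTransform hμ _ f) hf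
  have hcont : ∀ f' : Lp ℂ 2 μ, Continuous fun b : K × Kˣ =>
      (inner ℂ f' (quasiRegular μ b (haarWaveletL2 μ)) : ℂ) := fun f' =>
    continuous_const.inner (continuous_quasiRegular hμ _)
  have hb : ∀ (f' : Lp ℂ 2 μ) (b : K × Kˣ),
      ‖(inner ℂ f' (quasiRegular μ b (haarWaveletL2 μ)) : ℂ)‖ ≤ ‖f'‖ * ‖haarWaveletL2 (K := K) μ‖ :=
    fun f' b => by
      rw [← norm_quasiRegular b (haarWaveletL2 μ)]
      exact norm_inner_le_norm _ _
  have hi : ∀ f' : Lp ℂ 2 μ, Integrable (fun b => waveletTransform μ (haarWaveletL2 μ) f b *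
      inner ℂ f' (quasiRegular μ b (haarWaveletL2 μ))) (affHaar μ ν) := fun f' =>
    hfi.mul_bdd (hcont f').aestronglyMeasurable (Filter.Eventually.of_forall (hb f'))
  have hL : Continuous fun f' : Lp ℂ 2 μ => ∫ b, waveletTransform μ (haarWaveletL2 μ) f b *
        inner ℂ f' (quasiRegular μ b (haarWaveletL2 μ)) ∂(affHaar μ ν) := by
    refine AddMonoidHomClass.continuous_of_bound (AddMonoidHom.mk' (fun f' : Lp ℂ 2 μ =>
      ∫ b, waveletTransform μ (haarWaveletL2 μ) f b *
        inner ℂ f' (quasiRegular μ b (haarWaveletL2 μ)) ∂(affHaar μ ν)) ?_)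
      ((∫ b, ‖waveletTransform μ (haarWaveletL2 μ) f b‖ ∂(affHaar μ ν)) *
        ‖haarWaveletL2 (K := K) μ‖) ?_
    · intro g g'
      rw [← integral_add (hi g) (hi g')]
      congr 1; funext b
      rw [inner_add_left, mul_add]
    · intro g
      rw [mul_assoc, mul_comm ‖haarWaveletL2 μ‖, ← integral_mul_const]
      refine norm_integral_le_of_norm_le (hfi.norm.mul_const _)
        (Filter.Eventually.of_forall fun b => ?_)
      rw [norm_mul]
      exact mul_le_mul_of_nonneg_left (hb g b) (norm_nonneg _)
  -- Both sides are conjugate-linear and continuous in f'; for an atom the claim is the reproducing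
  -- formula after a left translation.
  refine atom_induction hμ (P := fun f' => ∫ b, waveletTransform μ (haarWaveletL2 μ) f b *
        inner ℂ f' (quasiRegular μ b (haarWaveletL2 μ)) ∂(affHaar μ ν) =
      (unitMass ν).toReal * inner ℂ f' f) ?_ ?_ ?_ ?_ ?_ f'
  · exact isClosed_eq hL (continuous_const.mul (continuous_id.inner continuous_const))
  · simp
  · intro g g' hg hg'
    rw [inner_add_left, mul_add, ← hg, ← hg', ← integral_add (hi g) (hi g')]
    congr 1; funext b
    rw [inner_add_left, mul_add]
  · intro c g hg
    rw [inner_smul_left, mul_left_comm, ← hg, ← integral_const_mul]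
    congr 1; funext b
    rw [inner_smul_left]; ring
  · intro a
    have h1 := reproducing_formula ν hμ f a
    rw [waveletTransform] at h1
    rw [← h1, ← integral_affMul_left μ ν a]
    congr 1; funext b
    rw [waveletKernel_eq_inner' hμ, inner_quasiRegular_left, ← quasiRegular_affMul,
      affInv_affMul_cancel_left]

lemma waveletTransform_eq_integral (hμ : μ (fracIdeal K 0) = 1) (hv : IsAdmissibleWeight v)
    {f : Lp ℂ 2 μ} (hf : weightedNorm μ ν v (waveletTransform μ (haarWaveletL2 μ) f) < ∞)
    (g : Lp ℂ 2 μ) (a : K × Kˣ) :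
    waveletTransform μ g f a = ((unitMass ν).toReal : ℂ)⁻¹ *
      ∫ b, waveletTransform μ (haarWaveletL2 μ) f (affMul a b) *
        star (waveletTransform μ (haarWaveletL2 μ) g b) ∂(affHaar μ ν) := by
  have hne : ((unitMass ν).toReal : ℂ) ≠ 0 := by exact_mod_cast (unitMass_toReal_pos ν).ne'
  have h1 := integral_waveletTransform_mul_inner hμ hv hf (quasiRegular μ a g)
  rw [eq_inv_mul_iff_mul_eq₀ hne, waveletTransform, ← h1, ← integral_affMul_left μ ν a]
  congr 1; funext b
  rw [inner_quasiRegular_left, ← quasiRegular_affMul, affInv_affMul_cancel_left]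
  congr 1
  exact (inner_conj_symm _ _).symm

lemma weightedNorm_waveletTransform_le (hμ : μ (fracIdeal K 0) = 1) (hv : IsAdmissibleWeight v)
    {f : Lp ℂ 2 μ} (hf : weightedNorm μ ν v (waveletTransform μ (haarWaveletL2 μ) f) < ∞)
    (g : Lp ℂ 2 μ) :
    weightedNorm μ ν v (waveletTransform μ g f) ≤
      ‖((unitMass ν).toReal : ℂ)⁻¹‖ₑ *
        weightedNorm μ ν v (waveletTransform μ (haarWaveletL2 μ) g) *
        weightedNorm μ ν v (waveletTransform μ (haarWaveletL2 μ) f) := by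
  have hne : ((unitMass ν).toReal : ℂ) ≠ 0 := by exact_mod_cast (unitMass_toReal_pos ν).ne'
  have h1 : waveletTransform μ g f = fun a => ((unitMass ν).toReal : ℂ)⁻¹ *
      ∫ b, waveletTransform μ (haarWaveletL2 μ) f (affMul a b) *
        star (waveletTransform μ (haarWaveletL2 μ) g b) ∂(affHaar μ ν) :=
    funext fun a => waveletTransform_eq_integral hμ hv hf g a
  have hm : Measurable fun a => ∫ b, waveletTransform μ (haarWaveletL2 μ) f (affMul a b) *
        star (waveletTransform μ (haarWaveletL2 μ) g b) ∂(affHaar μ ν) := by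
    have h2 : (fun a => ∫ b, waveletTransform μ (haarWaveletL2 μ) f (affMul a b) *
        star (waveletTransform μ (haarWaveletL2 μ) g b) ∂(affHaar μ ν)) =
        fun a => ((unitMass ν).toReal : ℂ) * waveletTransform μ g f a := by
      funext a
      rw [h1, mul_inv_cancel_left₀ hne]
    rw [h2]
    exact (measurable_waveletTransform hμ g f).const_mul _
  have hs : Measurable fun b => star (waveletTransform μ (haarWaveletL2 μ) g b) :=
    (continuous_star.comp (continuous_waveletTransform hμ _ g)).measurable
  rw [h1, weightedNorm_const_mul _ hv hm, mul_assoc]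
  gcongr
  refine (weightedNorm_integral_le hv (measurable_waveletTransform hμ _ _) hs).trans
    (le_of_eq ?_)
  congr 1
  rw [weightedNorm, weightedNorm]
  refine lintegral_congr fun a => ?_
  congr 1
  rw [← ofReal_norm, norm_star, ofReal_norm]

lemma weightedNorm_haarWavelet_lt_top_of_isAnalyzing (hμ : μ (fracIdeal K 0) = 1)
    (hv : IsAdmissibleWeight v) {g : Lp ℂ 2 μ} (hg : IsAnalyzing μ ν v g) :
    weightedNorm μ ν v (waveletTransform μ (haarWaveletL2 μ) g) < ∞ := by
  obtain ⟨C, hC, h⟩ := exists_weightedNorm_haarWavelet_le (ν := ν) hμ hv hg.1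
  exact (h g).trans_lt (ENNReal.mul_lt_top hC ((mem_testVectors_iff hμ hv).1 hg.2))

/-- The space of test vectors does not depend on the analyzing vector. -/
lemma mem_testVectors_iff_haarWavelet (hμ : μ (fracIdeal K 0) = 1) (hv : IsAdmissibleWeight v)
    {g : Lp ℂ 2 μ} (hg : IsAnalyzing μ ν v g) (f : Lp ℂ 2 μ) :
    f ∈ testVectors μ ν v g ↔
      weightedNorm μ ν v (waveletTransform μ (haarWaveletL2 μ) f) < ∞ := by
  rw [mem_testVectors_iff hμ hv]
  constructor
  · intro h
    obtain ⟨C, hC, hle⟩ := exists_weightedNorm_haarWavelet_le (ν := ν) hμ hv hg.1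
    exact (hle f).trans_lt (ENNReal.mul_lt_top hC h)
  · intro h
    refine (weightedNorm_waveletTransform_le hμ hv h g).trans_lt ?_
    exact ENNReal.mul_lt_top (ENNReal.mul_lt_top enorm_lt_top
      (weightedNorm_haarWavelet_lt_top_of_isAnalyzing hμ hv hg)) h

lemma weightedNorm_testToL2_lt_top (hμ : μ (fracIdeal K 0) = 1) (hv : IsAdmissibleWeight v)
    (ψ : testSpace μ) :
    weightedNorm μ ν v (waveletTransform μ (haarWaveletL2 μ) (testToL2 μ ψ)) < ∞ := by
  obtain ⟨C, hC, h0⟩ := exists_compact_waveletTransform_eq_zero ψ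
  exact weightedNorm_lt_top_of_compact hv (continuous_waveletTransform hμ _ _) hC h0

lemma waveletTransform_quasiRegular_eq_leftTrans (g f : Lp ℂ 2 μ) (a : K × Kˣ) :
    waveletTransform μ g (quasiRegular μ a f) = leftTrans a (waveletTransform μ g f) :=
  funext fun b => waveletTransform_quasiRegular_right g f a b

lemma weightedNorm_quasiRegular_le (hμ : μ (fracIdeal K 0) = 1) (hv : IsAdmissibleWeight v)
    (f : Lp ℂ 2 μ) (a : K × Kˣ) :
    weightedNorm μ ν v (waveletTransform μ (haarWaveletL2 μ) (quasiRegular μ a f)) ≤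
      ENNReal.ofReal (v a) *
        weightedNorm μ ν v (waveletTransform μ (haarWaveletL2 μ) f) := by
  rw [waveletTransform_quasiRegular_eq_leftTrans]
  exact weightedNorm_leftTrans_le hv (measurable_waveletTransform hμ _ _) a

lemma isAnalyzing_haarWaveletL2 (hμ : μ (fracIdeal K 0) = 1) (hv : IsAdmissibleWeight v) :
    IsAnalyzing μ ν v (haarWaveletL2 μ) :=
  ⟨haarWaveletL2_ne_zero hμ, (mem_testVectors_iff hμ hv).2
    (weightedNorm_waveletKernel_lt_top hμ hv)⟩

end weighted

/-! ### Atomic expansion of test vectors and of functionals on them -/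

section functional

variable [MeasurableSpace K] [BorelSpace K] {μ : Measure K} [μ.IsAddHaarMeasure] [μ.Regular]
  {ν : Measure Kˣ} [ν.IsHaarMeasure] {v : K × Kˣ → ℝ}

/-- The reproducing integrand is constant on the cosets of the stabilizer and compactly supported,
so the integral is a sum over cosets. The common mass of the cosets cancels the constant of the
reproducing formula. -/
lemma hasSum_reproducing (ν : Measure Kˣ) [ν.IsHaarMeasure] (hμ : μ (fracIdeal K 0) = 1) (f : Lp ℂ 2 μ) (a : K × Kˣ) :
    HasSum (fun i : AffCoset K => waveletTransform μ (haarWaveletL2 μ) f i.out *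
        waveletTransform μ (haarWaveletL2 μ) (quasiRegular μ i.out (haarWaveletL2 μ)) a)
      (waveletTransform μ (haarWaveletL2 μ) f a) := by
  have hne : ((unitMass ν).toReal : ℂ) ≠ 0 := by exact_mod_cast (unitMass_toReal_pos ν).ne'
  have hk : ∀ b, waveletTransform μ (haarWaveletL2 μ) (quasiRegular μ b (haarWaveletL2 μ)) a =
      waveletKernel μ (affMul (affInv a) b) := by
    intro b
    rw [waveletTransform_atom, ← waveletKernel_affInv hμ, affInv_affMul, affInv_affInv]
  have hinv : ∀ b c, cosetSetoid K b c → waveletTransform μ (haarWaveletL2 μ) f b *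
      waveletTransform μ (haarWaveletL2 μ) (quasiRegular μ b (haarWaveletL2 μ)) a =
      waveletTransform μ (haarWaveletL2 μ) f c *
      waveletTransform μ (haarWaveletL2 μ) (quasiRegular μ c (haarWaveletL2 μ)) a := by
    intro b c h
    rw [waveletTransform_haarWavelet_invariant f b c h, quasiRegular_haarWavelet_eq_of_rel h]
  have hint : Integrable (fun b => waveletTransform μ (haarWaveletL2 μ) f b *
      waveletTransform μ (haarWaveletL2 μ) (quasiRegular μ b (haarWaveletL2 μ)) a)
      (affHaar μ ν) := by
    refine (continuous_of_invariant hinv).integrable_of_hasCompactSupport ?_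
    simp only [hk]
    exact ((hasCompactSupport_waveletKernel hμ).comp_homeomorph
      (affMulHomeo (affInv a))).mul_left
  have h1 := hasSum_coset ν hμ hinv hint
  rw [← integral_affMul_left μ ν a] at h1
  simp only [hk, affInv_affMul_cancel_left, reproducing_formula ν hμ] at h1
  rw [inv_mul_cancel_left₀ hne] at h1
  simp only [hk]
  exact h1

variable (K) in
lemma isCompact_stabilizer :
    IsCompact {u : K × Kˣ | cosetSetoid K (0, 1) u} := by
  have h : {u : K × Kˣ | cosetSetoid K (0, 1) u} =
      fracIdeal K 0 ×ˢ {h : Kˣ | kabs (h : K) = kabs ((1 : Kˣ) : K)} := by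
    ext u
    rw [mem_ofPred_eq, cosetSetoid_iff_zpow (k := 0) (by simp)]
    simp [and_comm]
  rw [h]
  exact (isCompact_fracIdeal 0).prod (isCompact_unit_sphere 1)

lemma cosetSetoid_affInv_affMul {a b : K × Kˣ} (h : cosetSetoid K a b) :
    cosetSetoid K (0, 1) (affMul (affInv a) b) := by
  rw [cosetSetoid_iff] at h ⊢
  have h2 : kabs ((a.2⁻¹ * b.2 : Kˣ) : K) = 1 := by
    rw [Units.val_mul, kabs_mul, kabs_units_inv, ← h.1]
    exact inv_mul_cancel₀ (kabs_units_pos _).ne'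
  constructor
  · simpa [affMul, affInv] using h2.symm
  · have h3 : (0 : K) - (affMul (affInv a) b).1 = ((a.2⁻¹ : Kˣ) : K) * (a.1 - b.1) := by
      simp only [affMul, affInv]; ring
    rw [h3, kabs_mul, kabs_units_inv]
    simp only [Units.val_one, kabs_one]
    rw [inv_mul_le_iff₀ (kabs_units_pos _), mul_one]
    exact h.2

/-- Here b is a times an element of the compact stabilizer, on which v is bounded. Values of v at
coset representatives can thus replace v in integrals. -/
lemma exists_weight_out_le (hv : IsAdmissibleWeight v) :
    ∃ M : ℝ, ∀ a b : K × Kˣ, cosetSetoid K a b → v b ≤ M * v a := by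
  obtain ⟨M, hM⟩ := hv.bounded _ (isCompact_stabilizer K)
  refine ⟨M, fun a b h => ?_⟩
  have h1 := hv.submul a (affMul (affInv a) b)
  rw [affMul_affInv_cancel_left] at h1
  rw [mul_comm]
  exact h1.trans (mul_le_mul_of_nonneg_left
    (hM ⟨_, cosetSetoid_affInv_affMul h, rfl⟩) (hv.pos a).le)

lemma tsum_weight_lt_top (hμ : μ (fracIdeal K 0) = 1) (hv : IsAdmissibleWeight v)
    {F : K × Kˣ → ℂ} (hF : ∀ a b, cosetSetoid K a b → F a = F b)
    (h : weightedNorm μ ν v F < ∞) :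
    ∑' i : AffCoset K, ‖F i.out‖ₑ * ENNReal.ofReal (v i.out) < ∞ := by
  obtain ⟨M, hM⟩ := exists_weight_out_le hv
  have h1 := lintegral_eq_tsum_coset (μ := μ) ν hμ
    (F := fun a => ‖F a‖ₑ * ENNReal.ofReal (v (⟦a⟧ : AffCoset K).out)) (fun a b hab => by
      rw [hF a b hab, show (⟦a⟧ : AffCoset K) = ⟦b⟧ from Quotient.sound hab])
  simp only [Quotient.out_eq] at h1
  have h2 : ∫⁻ a, ‖F a‖ₑ * ENNReal.ofReal (v (⟦a⟧ : AffCoset K).out) ∂(affHaar μ ν) ≤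
      ENNReal.ofReal M * weightedNorm μ ν v F := by
    rw [weightedNorm, ← lintegral_const_mul _
      (hv.measurable_mul_enorm (continuous_of_invariant hF).measurable)]
    refine lintegral_mono fun a => ?_
    rw [mul_comm, ← mul_assoc]
    gcongr
    have h3 := hM a _ ((cosetSetoid K).symm (Quotient.mk_out a))
    refine (ENNReal.ofReal_le_ofReal h3).trans (le_of_eq ?_)
    exact ENNReal.ofReal_mul' (hv.pos a).le
  rw [h1] at h2
  have h3 : unitMass ν * ∑' i : AffCoset K, ‖F i.out‖ₑ * ENNReal.ofReal (v i.out) < ∞ :=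
    h2.trans_lt (ENNReal.mul_lt_top ENNReal.ofReal_lt_top h)
  exact (ENNReal.lt_top_of_mul_ne_top_right h3.ne (unitMass_ne_zero ν))

lemma waveletTransform_sub (g f f' : Lp ℂ 2 μ) (a : K × Kˣ) :
    waveletTransform μ g (f - f') a = waveletTransform μ g f a - waveletTransform μ g f' a :=
  inner_sub_right _ _ _

lemma waveletTransform_finset_sum {ι : Type*} (T : Finset ι) (c : ι → ℂ) (u : ι → Lp ℂ 2 μ)
    (g : Lp ℂ 2 μ) (a : K × Kˣ) :
    waveletTransform μ g (∑ i ∈ T, c i • u i) a = ∑ i ∈ T, c i * waveletTransform μ g (u i) a := by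
  rw [waveletTransform, inner_sum]
  exact Finset.sum_congr rfl fun i _ => inner_smul_right _ _ _

/-- The transform of the remainder is the tail of the series in `hasSum_reproducing`, and the atom
at i has norm at most v(i) times that of φ. The tail of a convergent series bounds the error, so the
atomic expansion converges in the norm of ℋ¹_v. -/
lemma weightedNorm_partial_sum_le (hμ : μ (fracIdeal K 0) = 1) (hv : IsAdmissibleWeight v)
    (f : Lp ℂ 2 μ) (T : Finset (AffCoset K)) :
    weightedNorm μ ν v (waveletTransform μ (haarWaveletL2 μ) (f - ∑ i ∈ T,
        waveletTransform μ (haarWaveletL2 μ) f i.out •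
          quasiRegular μ i.out (haarWaveletL2 μ))) ≤
      (∑' i : {i // i ∉ T}, ‖waveletTransform μ (haarWaveletL2 μ) f i.1.out‖ₑ *
        ENNReal.ofReal (v i.1.out)) * weightedNorm μ ν v (waveletKernel μ) := by
  have hm : ∀ i : {i : AffCoset K // i ∉ T}, Measurable fun a => ENNReal.ofReal (v a) *
      ‖waveletTransform μ (haarWaveletL2 μ) (quasiRegular μ i.1.out (haarWaveletL2 μ)) a‖ₑ :=
    fun i => hv.measurable_mul_enorm (measurable_waveletTransform hμ _ _)
  have hpt : ∀ a, ‖waveletTransform μ (haarWaveletL2 μ) (f - ∑ i ∈ T,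
        waveletTransform μ (haarWaveletL2 μ) f i.out •
          quasiRegular μ i.out (haarWaveletL2 μ)) a‖ₑ ≤
      ∑' i : {i : AffCoset K // i ∉ T}, ‖waveletTransform μ (haarWaveletL2 μ) f i.1.out‖ₑ *
        ‖waveletTransform μ (haarWaveletL2 μ)
          (quasiRegular μ i.1.out (haarWaveletL2 μ)) a‖ₑ := by
    intro a
    have hs := hasSum_reproducing ν hμ f a
    rw [waveletTransform_sub, waveletTransform_finset_sum, ← hs.tsum_eq,
      ← hs.summable.sum_add_tsum_subtype_compl T, add_sub_cancel_left]
    refine (enorm_tsum_le_tsum_enorm).trans (le_of_eq ?_)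
    exact tsum_congr fun i => enorm_mul _ _
  calc _ ≤ ∫⁻ a, ∑' i : {i : AffCoset K // i ∉ T},
        ‖waveletTransform μ (haarWaveletL2 μ) f i.1.out‖ₑ * (ENNReal.ofReal (v a) *
        ‖waveletTransform μ (haarWaveletL2 μ)
          (quasiRegular μ i.1.out (haarWaveletL2 μ)) a‖ₑ) ∂(affHaar μ ν) := by
        refine lintegral_mono fun a => ?_
        refine (mul_le_mul_right (hpt a) _).trans (le_of_eq ?_)
        rw [← ENNReal.tsum_mul_left]
        exact tsum_congr fun i => mul_left_comm _ _ _
    _ = ∑' i : {i : AffCoset K // i ∉ T}, ‖waveletTransform μ (haarWaveletL2 μ) f i.1.out‖ₑ *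
        weightedNorm μ ν v (waveletTransform μ (haarWaveletL2 μ)
          (quasiRegular μ i.1.out (haarWaveletL2 μ))) := by
        rw [lintegral_tsum fun i => ((hm i).const_mul _).aemeasurable]
        exact tsum_congr fun i => lintegral_const_mul _ (hm i)
    _ ≤ _ := by
        rw [← ENNReal.tsum_mul_right]
        refine ENNReal.tsum_le_tsum fun i => ?_
        rw [mul_assoc]
        gcongr
        exact weightedNorm_quasiRegular_le hμ hv _ _

variable {V : Submodule ℂ (Lp ℂ 2 μ)}

/-- A bounded functional may be applied termwise to the atomic expansion, which converges in norm;
conjugate-linearity conjugates the coefficients. The subspace V stands for ℋ¹_v, described by φ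
alone through `hV`. -/
lemma hasSum_functional (hμ : μ (fracIdeal K 0) = 1) (hv : IsAdmissibleWeight v)
    (hV : ∀ f, f ∈ V ↔ weightedNorm μ ν v (waveletTransform μ (haarWaveletL2 μ) f) < ∞)
    (hφ : ∀ a, quasiRegular μ a (haarWaveletL2 μ) ∈ V)
    {l : V →ₛₗ[starRingEnd ℂ] ℂ} {C : ℝ≥0∞} (hC : C < ∞)
    (hl : ∀ f : V, ‖l f‖ₑ ≤ C * weightedNorm μ ν v (waveletTransform μ (haarWaveletL2 μ) f.1))
    (f : V) :
    HasSum (fun i : AffCoset K => star (waveletTransform μ (haarWaveletL2 μ) f.1 i.out) *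
      l ⟨quasiRegular μ i.out (haarWaveletL2 μ), hφ _⟩) (l f) := by
  have hfin := tsum_weight_lt_top hμ hv
    (waveletTransform_haarWavelet_invariant f.1) ((hV f.1).1 f.2)
  have h0 := ENNReal.tendsto_tsum_compl_atTop_zero hfin.ne
  have h1 : Filter.Tendsto (fun T : Finset (AffCoset K) =>
      C * ((∑' i : {i // i ∉ T}, ‖waveletTransform μ (haarWaveletL2 μ) f.1 i.1.out‖ₑ *
        ENNReal.ofReal (v i.1.out)) * weightedNorm μ ν v (waveletKernel μ)))
      Filter.atTop (nhds 0) := by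
    have h2 := ENNReal.Tendsto.const_mul (a := C) (ENNReal.Tendsto.mul_const
      (b := weightedNorm μ ν v (waveletKernel μ)) h0
      (Or.inr (weightedNorm_waveletKernel_lt_top hμ hv).ne)) (Or.inr hC.ne)
    simpa using h2
  rw [HasSum, SummationFilter.unconditional_filter, tendsto_iff_edist_tendsto_0]
  refine tendsto_of_tendsto_of_tendsto_of_le_of_le tendsto_const_nhds h1
    (fun _ => zero_le) fun T => ?_
  let fT : V := ∑ i ∈ T, waveletTransform μ (haarWaveletL2 μ) f.1 i.out •
    (⟨quasiRegular μ i.out (haarWaveletL2 μ), hφ _⟩ : V)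
  have hfT : (fT : Lp ℂ 2 μ) = ∑ i ∈ T, waveletTransform μ (haarWaveletL2 μ) f.1 i.out •
          quasiRegular μ i.out (haarWaveletL2 μ) := by
    simp [fT]
  have hlT : l fT = ∑ i ∈ T, star (waveletTransform μ (haarWaveletL2 μ) f.1 i.out) *
      l ⟨quasiRegular μ i.out (haarWaveletL2 μ), hφ _⟩ := by
    simp only [fT, map_sum, map_smulₛₗ]
    rfl
  rw [← hlT, edist_comm, edist_eq_enorm_sub, ← map_sub]
  refine (hl _).trans ?_
  gcongr
  have := weightedNorm_partial_sum_le (ν := ν) hμ hv f.1 T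
  rw [← hfT] at this
  exact this

lemma enorm_functional_atom_le (hμ : μ (fracIdeal K 0) = 1) (hv : IsAdmissibleWeight v)
    (hφ : ∀ a, quasiRegular μ a (haarWaveletL2 μ) ∈ V)
    {l : V →ₛₗ[starRingEnd ℂ] ℂ} {C : ℝ≥0∞}
    (hl : ∀ f : V, ‖l f‖ₑ ≤ C * weightedNorm μ ν v (waveletTransform μ (haarWaveletL2 μ) f.1))
    (a : K × Kˣ) :
    ‖l ⟨quasiRegular μ a (haarWaveletL2 μ), hφ a⟩‖ₑ ≤
      C * weightedNorm μ ν v (waveletKernel μ) * ENNReal.ofReal (v a) := by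
  refine (hl _).trans ?_
  rw [mul_assoc, mul_comm (weightedNorm _ _ _ _)]
  gcongr
  exact weightedNorm_quasiRegular_le hμ hv _ _

lemma integrable_mul_of_bound (hv : IsAdmissibleWeight v) {F G : K × Kˣ → ℂ} (hF : Measurable F)
    (hG : Measurable G) (hFv : weightedNorm μ ν v F < ∞) {C : ℝ≥0∞} (hC : C < ∞)
    (hGv : ∀ a, ‖G a‖ₑ ≤ C * ENNReal.ofReal (v a)) :
    Integrable (fun a => F a * G a) (affHaar μ ν) := by
  refine ⟨(hF.mul hG).aestronglyMeasurable, ?_⟩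
  calc ∫⁻ a, ‖F a * G a‖ₑ ∂(affHaar μ ν)
      ≤ ∫⁻ a, C * (ENNReal.ofReal (v a) * ‖F a‖ₑ) ∂(affHaar μ ν) := by
        refine lintegral_mono fun a => ?_
        rw [enorm_mul, ← mul_assoc, mul_comm]
        gcongr; exact hGv a
    _ = C * weightedNorm μ ν v F := lintegral_const_mul _ (hv.measurable_mul_enorm hF)
    _ < ∞ := ENNReal.mul_lt_top hC hFv

lemma weightedNorm_star (F : K × Kˣ → ℂ) :
    weightedNorm μ ν v (fun a => star (F a)) = weightedNorm μ ν v F := by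
  rw [weightedNorm, weightedNorm]
  refine lintegral_congr fun a => ?_
  congr 1
  rw [← ofReal_norm, norm_star, ofReal_norm]

lemma functional_atom_invariant (hφ : ∀ a, quasiRegular μ a (haarWaveletL2 μ) ∈ V)
    (l : V →ₛₗ[starRingEnd ℂ] ℂ) (a b : K × Kˣ) (h : cosetSetoid K a b) :
    l ⟨quasiRegular μ a (haarWaveletL2 μ), hφ a⟩ =
      l ⟨quasiRegular μ b (haarWaveletL2 μ), hφ b⟩ := by
  congr 1
  exact Subtype.ext (quasiRegular_haarWavelet_eq_of_rel h)

/-- The reproducing formula for bounded functionals on the space of test vectors. -/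
lemma functional_eq_integral (hμ : μ (fracIdeal K 0) = 1) (hv : IsAdmissibleWeight v)
    (hV : ∀ f, f ∈ V ↔ weightedNorm μ ν v (waveletTransform μ (haarWaveletL2 μ) f) < ∞)
    (hφ : ∀ a, quasiRegular μ a (haarWaveletL2 μ) ∈ V)
    {l : V →ₛₗ[starRingEnd ℂ] ℂ} {C : ℝ≥0∞} (hC : C < ∞)
    (hl : ∀ f : V, ‖l f‖ₑ ≤ C * weightedNorm μ ν v (waveletTransform μ (haarWaveletL2 μ) f.1))
    (f : V) :
    l f = ((unitMass ν).toReal : ℂ)⁻¹ *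
      ∫ b, star (waveletTransform μ (haarWaveletL2 μ) f.1 b) *
        l ⟨quasiRegular μ b (haarWaveletL2 μ), hφ b⟩ ∂(affHaar μ ν) := by
  have hinv : ∀ a b, cosetSetoid K a b → star (waveletTransform μ (haarWaveletL2 μ) f.1 a) *
        l ⟨quasiRegular μ a (haarWaveletL2 μ), hφ a⟩ =
        star (waveletTransform μ (haarWaveletL2 μ) f.1 b) *
        l ⟨quasiRegular μ b (haarWaveletL2 μ), hφ b⟩ := by
    intro a b h
    rw [waveletTransform_haarWavelet_invariant _ a b h, functional_atom_invariant hφ l a b h]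
  refine (hasSum_functional hμ hv hV hφ hC hl f).unique (hasSum_coset ν hμ hinv ?_)
  refine integrable_mul_of_bound hv
    (continuous_star.comp (continuous_waveletTransform hμ _ f.1)).measurable
    (continuous_of_invariant (functional_atom_invariant hφ l)).measurable ?_
    (ENNReal.mul_lt_top hC (weightedNorm_waveletKernel_lt_top hμ hv))
    (enorm_functional_atom_le hμ hv hφ hl)
  exact (weightedNorm_star _).trans_lt ((hV f.1).1 f.2)

lemma functional_quasiRegular_eq_integral (hμ : μ (fracIdeal K 0) = 1)
    (hv : IsAdmissibleWeight v)
    (hV : ∀ f, f ∈ V ↔ weightedNorm μ ν v (waveletTransform μ (haarWaveletL2 μ) f) < ∞)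
    (hφ : ∀ a, quasiRegular μ a (haarWaveletL2 μ) ∈ V)
    {l : V →ₛₗ[starRingEnd ℂ] ℂ} {C : ℝ≥0∞} (hC : C < ∞)
    (hl : ∀ f : V, ‖l f‖ₑ ≤ C * weightedNorm μ ν v (waveletTransform μ (haarWaveletL2 μ) f.1))
    {g : Lp ℂ 2 μ} (hg : ∀ a, quasiRegular μ a g ∈ V) (a : K × Kˣ) :
    l ⟨quasiRegular μ a g, hg a⟩ = ((unitMass ν).toReal : ℂ)⁻¹ *
      ∫ b, l ⟨quasiRegular μ (affMul a b) (haarWaveletL2 μ), hφ _⟩ *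
        star (waveletTransform μ (haarWaveletL2 μ) g b) ∂(affHaar μ ν) := by
  rw [functional_eq_integral hμ hv hV hφ hC hl, ← integral_affMul_left μ ν a]
  congr 2; funext b
  rw [waveletTransform_quasiRegular_right, affInv_affMul_cancel_left, mul_comm]

/-- Measurability of the extended wavelet transform. -/
lemma measurable_functional_quasiRegular (hμ : μ (fracIdeal K 0) = 1)
    (hv : IsAdmissibleWeight v)
    (hV : ∀ f, f ∈ V ↔ weightedNorm μ ν v (waveletTransform μ (haarWaveletL2 μ) f) < ∞)
    (hφ : ∀ a, quasiRegular μ a (haarWaveletL2 μ) ∈ V)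
    {l : V →ₛₗ[starRingEnd ℂ] ℂ} {C : ℝ≥0∞} (hC : C < ∞)
    (hl : ∀ f : V, ‖l f‖ₑ ≤ C * weightedNorm μ ν v (waveletTransform μ (haarWaveletL2 μ) f.1))
    {g : Lp ℂ 2 μ} (hg : ∀ a, quasiRegular μ a g ∈ V) :
    Measurable fun a => l ⟨quasiRegular μ a g, hg a⟩ := by
  simp only [functional_quasiRegular_eq_integral hμ hv hV hφ hC hl hg]
  refine Measurable.const_mul ?_ _
  have hm : Measurable fun p : (K × Kˣ) × (K × Kˣ) =>
      l ⟨quasiRegular μ (affMul p.1 p.2) (haarWaveletL2 μ), hφ _⟩ *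
        star (waveletTransform μ (haarWaveletL2 μ) g p.2) :=
    (((continuous_of_invariant (functional_atom_invariant hφ l)).comp continuous_affMul).mul
      ((continuous_star.comp (continuous_waveletTransform hμ _ g)).comp
        continuous_snd)).measurable
  exact hm.stronglyMeasurable.integral_prod_right.measurable

/-- The wavelet coefficients of a functional are recovered from its transform with respect to an
arbitrary vector. -/
lemma integral_functional_mul_waveletKernel (hμ : μ (fracIdeal K 0) = 1)
    (hv : IsAdmissibleWeight v)
    (hV : ∀ f, f ∈ V ↔ weightedNorm μ ν v (waveletTransform μ (haarWaveletL2 μ) f) < ∞)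
    (hφ : ∀ a, quasiRegular μ a (haarWaveletL2 μ) ∈ V)
    {l : V →ₛₗ[starRingEnd ℂ] ℂ} {C : ℝ≥0∞} (hC : C < ∞)
    (hl : ∀ f : V, ‖l f‖ₑ ≤ C * weightedNorm μ ν v (waveletTransform μ (haarWaveletL2 μ) f.1))
    {g : Lp ℂ 2 μ} (hg : ∀ a, quasiRegular μ a g ∈ V) (a : K × Kˣ) :
    ∫ b, l ⟨quasiRegular μ (affMul a b) g, hg _⟩ * waveletKernel μ b ∂(affHaar μ ν) =
      orthConst ν * inner ℂ g (haarWaveletL2 μ) *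
        l ⟨quasiRegular μ a (haarWaveletL2 μ), hφ a⟩ := by
  have hgV : weightedNorm μ ν v (waveletTransform μ (haarWaveletL2 μ) g) < ∞ := by
    have := (hV _).1 (hg (0, 1))
    rwa [quasiRegular_one] at this
  set Λ : K × Kˣ → ℂ := fun b => l ⟨quasiRegular μ b (haarWaveletL2 μ), hφ b⟩ with hΛ
  have hΛc : Continuous Λ := continuous_of_invariant (functional_atom_invariant hφ l)
  have hΛb := enorm_functional_atom_le hμ hv hφ hl
  have hWc := continuous_waveletTransform hμ (haarWaveletL2 μ) g
  set D := C * weightedNorm μ ν v (waveletKernel μ) with hD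
  have hDt : D < ∞ := ENNReal.mul_lt_top hC (weightedNorm_waveletKernel_lt_top hμ hv)
  have hlg : ∀ c, l ⟨quasiRegular μ c g, hg c⟩ = ((unitMass ν).toReal : ℂ)⁻¹ *
      ∫ e, star (waveletTransform μ (haarWaveletL2 μ) g (affMul (affInv c) e)) * Λ e
        ∂(affHaar μ ν) := by
    intro c
    rw [functional_eq_integral hμ hv hV hφ hC hl]
    simp only [waveletTransform_quasiRegular_right, hΛ]
  have hjc : Continuous fun p : (K × Kˣ) × (K × Kˣ) =>
      star (waveletTransform μ (haarWaveletL2 μ) g (affMul (affInv (affMul a p.1)) p.2)) * Λ p.2 *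
        waveletKernel μ p.1 := by
    refine Continuous.mul (Continuous.mul ?_ (hΛc.comp continuous_snd))
      (continuous_waveletKernel.comp continuous_fst)
    refine continuous_star.comp (hWc.comp (continuous_affMul.comp (Continuous.prodMk ?_ ?_)))
    · exact continuous_affInv.comp ((continuous_affMul_left a).comp continuous_fst)
    · exact continuous_snd
  -- Absolute convergence for Fubini: Λ is O(v), the translate of W_φ g by ab costs at most v(a)v(b)
  -- in L¹_v, and the kernel of φ is in L¹_v.
  have hint : Integrable (fun p : (K × Kˣ) × (K × Kˣ) =>
      star (waveletTransform μ (haarWaveletL2 μ) g (affMul (affInv (affMul a p.1)) p.2)) * Λ p.2 *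
        waveletKernel μ p.1) ((affHaar μ ν).prod (affHaar μ ν)) := by
    refine ⟨hjc.aestronglyMeasurable, ?_⟩
    rw [HasFiniteIntegral, lintegral_prod _ hjc.enorm.measurable.aemeasurable]
    calc _ ≤ ∫⁻ b, (D * ENNReal.ofReal (v a) *
            weightedNorm μ ν v (waveletTransform μ (haarWaveletL2 μ) g)) *
            (ENNReal.ofReal (v b) * ‖waveletKernel μ b‖ₑ) ∂(affHaar μ ν) := by
          refine lintegral_mono fun b => ?_
          have h1 := weightedNorm_leftTrans_le (μ := μ) (ν := ν) hv hWc.measurable (affMul a b)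
          calc _ ≤ ∫⁻ e, (D * ‖waveletKernel μ b‖ₑ) * (ENNReal.ofReal (v e) *
                ‖leftTrans (affMul a b) (waveletTransform μ (haarWaveletL2 μ) g) e‖ₑ)
                  ∂(affHaar μ ν) := by
                refine lintegral_mono fun e => ?_
                have hs : ‖star (waveletTransform μ (haarWaveletL2 μ) g
                    (affMul (affInv (affMul a b)) e))‖ₑ =
                    ‖leftTrans (affMul a b) (waveletTransform μ (haarWaveletL2 μ) g) e‖ₑ := by
                  rw [← ofReal_norm, norm_star, ofReal_norm]; rfl
                simp only [enorm_mul, hs]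
                calc _ ≤ ‖leftTrans (affMul a b) (waveletTransform μ (haarWaveletL2 μ) g) e‖ₑ *
                      (D * ENNReal.ofReal (v e)) * ‖waveletKernel μ b‖ₑ := by
                      gcongr; exact hΛb e
                  _ = _ := by ring
            _ = (D * ‖waveletKernel μ b‖ₑ) * weightedNorm μ ν v
                  (leftTrans (affMul a b) (waveletTransform μ (haarWaveletL2 μ) g)) :=
                lintegral_const_mul _ (hv.measurable_mul_enorm
                  (hWc.comp (continuous_affMul_left _)).measurable)
            _ ≤ (D * ‖waveletKernel μ b‖ₑ) * (ENNReal.ofReal (v a) * ENNReal.ofReal (v b) *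
                  weightedNorm μ ν v (waveletTransform μ (haarWaveletL2 μ) g)) := by
                gcongr
                refine h1.trans ?_
                gcongr
                exact hv.ofReal_submul a b
            _ = _ := by ring
      _ = _ := lintegral_const_mul _ (hv.measurable_mul_enorm continuous_waveletKernel.measurable)
      _ < ∞ := ENNReal.mul_lt_top (ENNReal.mul_lt_top (ENNReal.mul_lt_top hDt
          ENNReal.ofReal_lt_top) hgV) (weightedNorm_waveletKernel_lt_top hμ hv)
  -- By conjugate symmetry the integral over b is the orthogonality relation for the L² vector
  -- π(e)φ; the functional enters only through the factor Λ e.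
  have hin : ∀ e, ∫ b, star (waveletTransform μ (haarWaveletL2 μ) g
      (affMul (affInv (affMul a b)) e)) * Λ e * waveletKernel μ b ∂(affHaar μ ν) =
      orthConst ν * inner ℂ g (haarWaveletL2 μ) *
      (star (waveletTransform μ (haarWaveletL2 μ) (quasiRegular μ a (haarWaveletL2 μ)) e) *
        Λ e) := by
    intro e
    have hs : ∀ (c : K × Kˣ) (f g : Lp ℂ 2 μ),
        star (waveletTransform μ f g (affMul (affInv c) e)) =
          waveletTransform μ g (quasiRegular μ e f) c := by
      intro c f g
      rw [← waveletTransform_quasiRegular_right, waveletTransform, waveletTransform]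
      exact inner_conj_symm _ _
    have h1 := integral_waveletTransform_affMul_mul_waveletKernel ν hμ g
      (quasiRegular μ e (haarWaveletL2 μ)) a
    have h2 : waveletTransform μ (haarWaveletL2 μ) (quasiRegular μ e (haarWaveletL2 μ)) a =
        star (waveletTransform μ (haarWaveletL2 μ) (quasiRegular μ a (haarWaveletL2 μ)) e) := by
      rw [← hs, ← waveletTransform_quasiRegular_right]
    rw [← h2]
    simp only [hs]
    calc _ = (∫ b, waveletTransform μ g (quasiRegular μ e (haarWaveletL2 μ)) (affMul a b) *
          waveletKernel μ b ∂(affHaar μ ν)) * Λ e := by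
          rw [← integral_mul_const]
          congr 1; funext b; ring
      _ = _ := by rw [h1]; ring
  calc ∫ b, l ⟨quasiRegular μ (affMul a b) g, hg _⟩ * waveletKernel μ b ∂(affHaar μ ν)
      = ((unitMass ν).toReal : ℂ)⁻¹ * ∫ b, ∫ e, star (waveletTransform μ (haarWaveletL2 μ) g
          (affMul (affInv (affMul a b)) e)) * Λ e * waveletKernel μ b
            ∂(affHaar μ ν) ∂(affHaar μ ν) := by
        rw [← integral_const_mul]
        congr 1; funext b
        rw [hlg, integral_mul_const, mul_assoc]
    _ = ((unitMass ν).toReal : ℂ)⁻¹ * ∫ e, ∫ b, star (waveletTransform μ (haarWaveletL2 μ) g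
          (affMul (affInv (affMul a b)) e)) * Λ e * waveletKernel μ b
            ∂(affHaar μ ν) ∂(affHaar μ ν) := by
        rw [integral_integral_swap hint]
    _ = _ := by
        simp only [hin]
        rw [integral_const_mul, mul_left_comm, functional_eq_integral hμ hv hV hφ hC hl
          ⟨quasiRegular μ a (haarWaveletL2 μ), hφ a⟩]

end functional

/-! ### Minkowski's integral inequality -/

section minkowski

variable {X B : Type*} [MeasurableSpace X] [MeasurableSpace B] {m : Measure X} {β : Measure B}

lemma eLpNorm_ennreal_eq {p : ℝ≥0∞} (h0 : p ≠ 0) (ht : p ≠ ∞) (f : X → ℝ≥0∞) :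
    eLpNorm f p m = (∫⁻ x, f x ^ p.toReal ∂m) ^ (1 / p.toReal) := by
  rw [eLpNorm_eq_lintegral_rpow_enorm_toReal h0 ht]
  simp only [enorm_eq_self]

lemma eLpNorm_ennreal_mono {p : ℝ≥0∞} {f g : X → ℝ≥0∞} (h : ∀ x, f x ≤ g x) :
    eLpNorm f p m ≤ eLpNorm g p m :=
  eLpNorm_mono_enorm fun x => by simpa only [enorm_eq_self] using h x

lemma eLpNorm_nnreal_mul_le (m : Measure X) (p : ℝ≥0∞) (r : ℝ≥0) (f : X → ℝ≥0∞) :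
    eLpNorm (fun x => r * f x) p m ≤ r * eLpNorm f p m := by
  refine (eLpNorm_le_nnreal_smul_eLpNorm_of_ae_le_mul' (c := r) (g := f)
    (Filter.Eventually.of_forall fun x => ?_) p).trans_eq ?_
  · simp only [enorm_eq_self]; exact le_rfl
  · exact ENNReal.smul_def _ _

lemma measurable_eLpNorm_left [SFinite m] {p : ℝ≥0∞} {F : B → X → ℝ≥0∞}
    (hF : Measurable (Function.uncurry F)) : Measurable fun b => eLpNorm (F b) p m := by
  rcases eq_or_ne p 0 with rfl | h0
  · simp
  rcases eq_or_ne p ∞ with rfl | ht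
  -- The essential supremum exceeds c exactly when the section of the set where F > c has nonzero
  -- measure, and the measure of sections is measurable.
  · refine measurable_of_Ioi fun c => ?_
    have h : (fun b => eLpNorm (F b) ∞ m) ⁻¹' Ioi c =
        {b | m {x | c < F b x} ≠ 0} := by
      ext b
      have h1 : eLpNorm (F b) ∞ m ≤ c ↔ m {x | c < F b x} = 0 := by
        have h2 : m {x | c < F b x} = 0 ↔ ∀ᵐ x ∂m, F b x ≤ c := by
          rw [ae_iff]; simp only [not_le]
        rw [h2]
        constructor
        · intro h
          filter_upwards [enorm_ae_le_eLpNormEssSup (F b) m] with x hx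
          rw [enorm_eq_self] at hx
          exact hx.trans (by rwa [eLpNorm_exponent_top] at h)
        · intro h
          rw [eLpNorm_exponent_top]
          exact eLpNormEssSup_le_of_ae_enorm_bound (by simpa only [enorm_eq_self] using h)
      rw [mem_preimage, mem_Ioi, ← not_le, h1]
      rfl
    rw [h]
    have hS : MeasurableSet {q : B × X | c < F q.1 q.2} := hF measurableSet_Ioi
    exact (measurable_measure_prodMk_left hS) (measurableSet_singleton 0).compl
  · simp only [eLpNorm_ennreal_eq h0 ht]
    exact ((hF.pow_const p.toReal).lintegral_prod_right').pow_const _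

/-- Write T^p = T^{p-1} T, bound the last factor by the integral of F, exchange the integrals and
apply Hölder. The factor A^{1/p'} can be cancelled only if it is finite, which is why a truncation T
is used. -/
lemma lintegral_rpow_truncation_le [SFinite m] [SFinite β] {p : ℝ} (hp : 1 < p)
    {F : B → X → ℝ≥0∞} (hF : Measurable (Function.uncurry F)) {T : X → ℝ≥0∞} (hT : Measurable T)
    (hTS : ∀ x, T x ≤ ∫⁻ b, F b x ∂β) (hfin : ∫⁻ x, T x ^ p ∂m ≠ ∞) :
    (∫⁻ x, T x ^ p ∂m) ^ (1 / p) ≤ ∫⁻ b, (∫⁻ x, F b x ^ p ∂m) ^ (1 / p) ∂β := by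
  have hp0 : 0 < p := zero_lt_one.trans hp
  set A := ∫⁻ x, T x ^ p ∂m with hA
  rcases eq_or_ne A 0 with h0 | h0
  · rw [h0, ENNReal.zero_rpow_of_pos (by positivity)]; exact zero_le
  set p' := p.conjExponent with hp'
  have hpq : p.HolderConjugate p' := Real.HolderConjugate.conjExponent hp
  have h1 : A ≤ A ^ (1 / p') * ∫⁻ b, (∫⁻ x, F b x ^ p ∂m) ^ (1 / p) ∂β := by
    have hmul : ∀ x, T x ^ p = T x ^ (p - 1) * T x := by
      intro x
      conv_rhs => rw [← ENNReal.rpow_one (T x)]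
      rw [← ENNReal.rpow_mul, ← ENNReal.rpow_add_of_nonneg _ _ (by linarith) zero_le_one]
      congr 1; ring
    have hm2 : Measurable fun q : X × B => T q.1 ^ (p - 1) * F q.2 q.1 :=
      ((hT.comp measurable_fst).pow_const _).mul (hF.comp measurable_swap)
    calc A ≤ ∫⁻ x, T x ^ (p - 1) * ∫⁻ b, F b x ∂β ∂m := by
          refine lintegral_mono fun x => ?_
          rw [hmul]
          gcongr
          exact hTS x
      _ = ∫⁻ x, ∫⁻ b, T x ^ (p - 1) * F b x ∂β ∂m := by
          refine lintegral_congr fun x => ?_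
          exact (lintegral_const_mul _ (hF.comp (measurable_prodMk_right (y := x)))).symm
      _ = ∫⁻ b, ∫⁻ x, T x ^ (p - 1) * F b x ∂m ∂β :=
          lintegral_lintegral_swap hm2.aemeasurable
      _ ≤ ∫⁻ b, A ^ (1 / p') * (∫⁻ x, F b x ^ p ∂m) ^ (1 / p) ∂β := by
          refine lintegral_mono fun b => ?_
          refine (ENNReal.lintegral_mul_le_Lp_mul_Lq m hpq.symm
            (hT.pow_const (p - 1)).aemeasurable
            (hF.comp measurable_prodMk_left).aemeasurable).trans (le_of_eq ?_)
          congr 2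
          refine lintegral_congr fun x => ?_
          rw [← ENNReal.rpow_mul]
          congr 1
          exact hpq.sub_one_mul_conj
      _ = _ := lintegral_const_mul' _ _ (ENNReal.rpow_ne_top_of_nonneg (by
          have := hpq.symm.pos; positivity) hfin)
  have hpos : 0 < A ^ (1 / p') := ENNReal.rpow_pos (pos_iff_ne_zero.2 h0) hfin
  have hne : A ^ (1 / p') ≠ ∞ := ENNReal.rpow_ne_top_of_nonneg (by
          have := hpq.symm.pos; positivity) hfin
  have h2 : A = A ^ (1 / p') * A ^ (1 / p) := by
    rw [← ENNReal.rpow_add _ _ h0 hfin]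
    have : 1 / p' + 1 / p = 1 := by
      have := hpq.inv_add_inv_eq_one
      simp only [one_div]; linarith
    rw [this, ENNReal.rpow_one]
  rw [h2] at h1
  nth_rewrite 2 [← h2] at h1
  exact (ENNReal.mul_le_mul_iff_right hpos.ne' hne).1 h1

/-- **Minkowski's integral inequality** for functions with values in `[0, ∞]`. -/
lemma eLpNorm_lintegral_le [SigmaFinite m] [SFinite β] {p : ℝ≥0∞} (hp : 1 ≤ p)
    {F : B → X → ℝ≥0∞} (hF : Measurable (Function.uncurry F)) :
    eLpNorm (fun x => ∫⁻ b, F b x ∂β) p m ≤ ∫⁻ b, eLpNorm (F b) p m ∂β := by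
  have hSm : Measurable fun x => ∫⁻ b, F b x ∂β :=
    (hF.comp measurable_swap).lintegral_prod_right'
  rcases eq_or_ne p ∞ with rfl | ht
  · rw [eLpNorm_exponent_top]
    refine eLpNormEssSup_le_of_ae_enorm_bound ?_
    simp only [enorm_eq_self]
    have hNm : Measurable fun b => eLpNorm (F b) ∞ m := measurable_eLpNorm_left hF
    have hS : MeasurableSet {q : B × X | F q.1 q.2 ≤ eLpNorm (F q.1) ∞ m} :=
      measurableSet_le hF (hNm.comp measurable_fst)
    have h1 : ∀ᵐ b ∂β, ∀ᵐ x ∂m, F b x ≤ eLpNorm (F b) ∞ m := by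
      refine Filter.Eventually.of_forall fun b => ?_
      filter_upwards [enorm_ae_le_eLpNormEssSup (F b) m] with x hx
      rwa [enorm_eq_self, ← eLpNorm_exponent_top] at hx
    -- For p = ∞ the inequality reduces to exchanging the two almost-everywhere quantifiers,
    -- legitimate because the set is measurable.
    have h2 : ∀ᵐ x ∂m, ∀ᵐ b ∂β, F b x ≤ eLpNorm (F b) ∞ m :=
      (Measure.ae_ae_comm hS).1 h1
    filter_upwards [h2] with x hx
    exact lintegral_mono_ae hx
  rcases eq_or_ne p 1 with rfl | h1
  · simp only [eLpNorm_one_eq_lintegral_enorm, enorm_eq_self]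
    rw [lintegral_lintegral_swap (f := fun x b => F b x) (hF.comp measurable_swap).aemeasurable]
  have h0 : p ≠ 0 := (zero_lt_one.trans_le hp).ne'
  have hp1 : 1 < p.toReal := by
    have : (1 : ℝ≥0∞) < p := lt_of_le_of_ne hp h1.symm
    rw [← ENNReal.toReal_one]
    exact (ENNReal.toReal_lt_toReal ENNReal.one_ne_top ht).2 this
  have hp0 : 0 < p.toReal := zero_lt_one.trans hp1
  simp only [eLpNorm_ennreal_eq h0 ht]
  set S : X → ℝ≥0∞ := fun x => ∫⁻ b, F b x ∂β with hSdef
  -- Cutting off in height and to sets of finite measure makes the p-th powers integrable; monotone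
  -- convergence removes the cut-off.
  let T : ℕ → X → ℝ≥0∞ := fun n => (spanningSets m n).indicator fun x => min (S x) n
  have hTm : ∀ n, Measurable (T n) := fun n =>
    (hSm.min measurable_const).indicator (measurableSet_spanningSets m n)
  have hTS : ∀ n x, T n x ≤ S x := by
    intro n x
    by_cases hx : x ∈ spanningSets m n <;> simp [T, hx]
  have hTmono : Monotone T := by
    intro i j hij x
    by_cases hx : x ∈ spanningSets m i
    · have hx' := monotone_spanningSets m hij hx
      simp only [T, indicator_of_mem hx, indicator_of_mem hx']
      exact min_le_min_left _ (by exact_mod_cast hij)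
    · simp [T, hx]
  have hTsup : ∀ x, S x ^ p.toReal = ⨆ n, T n x ^ p.toReal := by
    intro x
    refine le_antisymm ?_ (iSup_le fun n => ENNReal.rpow_le_rpow (hTS n x) hp0.le)
    rw [← ENNReal.le_rpow_inv_iff hp0]
    refine le_of_forall_lt fun c hc => ?_
    obtain ⟨n, hn⟩ := ENNReal.exists_nat_gt (hc.trans_le le_top).ne
    have hx := mem_spanningSetsIndex m x
    have hx' := monotone_spanningSets m (le_max_right n (spanningSetsIndex m x)) hx
    have : c < T (max n (spanningSetsIndex m x)) x := by
      simp only [T, indicator_of_mem hx', lt_min_iff]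
      exact ⟨hc, hn.trans_le (by exact_mod_cast le_max_left _ _)⟩
    refine this.trans_le ?_
    rw [ENNReal.le_rpow_inv_iff hp0]
    exact le_iSup (fun n => T n x ^ p.toReal) _
  have hTfin : ∀ n, ∫⁻ x, T n x ^ p.toReal ∂m ≠ ∞ := by
    intro n
    have hle : ∀ x, T n x ^ p.toReal ≤
        (spanningSets m n).indicator (fun _ => (n : ℝ≥0∞) ^ p.toReal) x := by
      intro x
      by_cases hx : x ∈ spanningSets m n
      · simp only [T, indicator_of_mem hx]
        exact ENNReal.rpow_le_rpow (min_le_right _ _) hp0.le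
      · simp [T, hx, hp0]
    refine ((lintegral_mono hle).trans_lt ?_).ne
    rw [lintegral_indicator_const (measurableSet_spanningSets m n)]
    exact ENNReal.mul_lt_top (ENNReal.rpow_lt_top_of_nonneg hp0.le (ENNReal.natCast_ne_top n))
      (measure_spanningSets_lt_top m n)
  have hsup : ∫⁻ x, S x ^ p.toReal ∂m = ⨆ n, ∫⁻ x, T n x ^ p.toReal ∂m := by
    simp only [hTsup]
    exact lintegral_iSup (fun n => (hTm n).pow_const _) fun i j hij x =>
      ENNReal.rpow_le_rpow (hTmono hij x) hp0.le
  rw [one_div, ENNReal.rpow_inv_le_iff hp0, hsup]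
  refine iSup_le fun n => ?_
  rw [← ENNReal.rpow_inv_le_iff hp0, ← one_div]
  exact lintegral_rpow_truncation_le hp1 hF (hTm n) (hTS n) (hTfin n)

end minkowski

/-! ### The mixed norm -/

section mixed

variable [MeasurableSpace K] [BorelSpace K] {μ : Measure K} [μ.IsAddHaarMeasure] [μ.Regular]
  {ν : Measure Kˣ} [ν.IsHaarMeasure] {w : K × Kˣ → ℝ} {s t : ℝ≥0∞}

lemma mixedNorm_eq (ht : t ≠ 0) (F : K × Kˣ → ℂ) :
    mixedNorm μ ν w s t F =
      eLpNorm (fun h => eLpNorm (fun x => ‖w (x, h)‖ₑ * ‖F (x, h)‖ₑ) s μ) t ν := by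
  have h1 : ∀ h : Kˣ, eLpNorm (fun x : K => (w (x, h) : ℂ) * F (x, h)) s μ =
      eLpNorm (fun x => ‖w (x, h)‖ₑ * ‖F (x, h)‖ₑ) s μ := by
    intro h
    refine eLpNorm_congr_enorm_ae (Filter.Eventually.of_forall fun x => ?_)
    rw [enorm_eq_self, enorm_mul]
    congr 1
    rw [← ofReal_norm, Complex.norm_real, ofReal_norm]
  rw [mixedNorm]
  split_ifs with h
  · simp only [h1]
    rw [h, eLpNorm_exponent_top, eLpNormEssSup_eq_essSup_enorm]
    simp only [enorm_eq_self]
  · rw [eLpNorm_ennreal_eq ht h]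
    simp only [h1]

lemma mixedNorm_mono (ht : t ≠ 0) {F G : K × Kˣ → ℂ} (h : ∀ a, ‖F a‖ₑ ≤ ‖G a‖ₑ) :
    mixedNorm μ ν w s t F ≤ mixedNorm μ ν w s t G := by
  rw [mixedNorm_eq ht, mixedNorm_eq ht]
  refine eLpNorm_ennreal_mono fun y => eLpNorm_ennreal_mono fun x => ?_
  gcongr
  exact h _

/-- Minkowski's inequality twice, first in x for fixed h and then in h. -/
lemma mixedNorm_le_lintegral {B : Type*} [MeasurableSpace B] {β : Measure B} [SFinite β]
    (hs : 1 ≤ s) (ht : 1 ≤ t) (hw : Measurable w) {c : B → ℝ≥0} (hc : Measurable c)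
    {F : B → K × Kˣ → ℂ} (hF : Measurable (Function.uncurry F)) {H : K × Kˣ → ℂ}
    (hH : ∀ a, ‖H a‖ₑ ≤ ∫⁻ b, c b * ‖F b a‖ₑ ∂β) :
    mixedNorm μ ν w s t H ≤ ∫⁻ b, c b * mixedNorm μ ν w s t (F b) ∂β := by
  have ht0 : t ≠ 0 := (zero_lt_one.trans_le ht).ne'
  have hG : Measurable fun q : (B × Kˣ) × K => ‖w (q.2, q.1.2)‖ₑ * ‖F q.1.1 (q.2, q.1.2)‖ₑ := by
    have h1 : Measurable fun q : (B × Kˣ) × K => (q.2, q.1.2) := by fun_prop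
    have h2 : Measurable fun q : (B × Kˣ) × K => (q.1.1, (q.2, q.1.2)) := by fun_prop
    exact (hw.comp h1).enorm.mul (hF.comp h2).enorm
  have hI : Measurable fun q : B × Kˣ =>
      eLpNorm (fun x => ‖w (x, q.2)‖ₑ * ‖F q.1 (x, q.2)‖ₑ) s μ :=
    measurable_eLpNorm_left (F := fun (q : B × Kˣ) (x : K) =>
      ‖w (x, q.2)‖ₑ * ‖F q.1 (x, q.2)‖ₑ) hG
  have inner : ∀ h : Kˣ, eLpNorm (fun x => ‖w (x, h)‖ₑ * ‖H (x, h)‖ₑ) s μ ≤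
      ∫⁻ b, c b * eLpNorm (fun x => ‖w (x, h)‖ₑ * ‖F b (x, h)‖ₑ) s μ ∂β := by
    intro h
    have hm : Measurable fun q : B × K => (c q.1 : ℝ≥0∞) *
        (‖w (q.2, h)‖ₑ * ‖F q.1 (q.2, h)‖ₑ) := by
      have h1 : Measurable fun q : B × K => ((q.1, h), q.2) := by fun_prop
      exact (hc.comp measurable_fst).coe_nnreal_ennreal.mul (hG.comp h1)
    calc _ ≤ eLpNorm (fun x => ∫⁻ b, c b * (‖w (x, h)‖ₑ * ‖F b (x, h)‖ₑ) ∂β) s μ := by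
          refine eLpNorm_ennreal_mono fun x => ?_
          have h2 : Measurable fun b : B => (c b : ℝ≥0∞) * ‖F b (x, h)‖ₑ :=
            hc.coe_nnreal_ennreal.mul (hF.comp (measurable_prodMk_right (y := (x, h)))).enorm
          calc _ ≤ ‖w (x, h)‖ₑ * ∫⁻ b, c b * ‖F b (x, h)‖ₑ ∂β := by
                gcongr; exact hH _
            _ = _ := by
                rw [← lintegral_const_mul _ h2]
                exact lintegral_congr fun b => mul_left_comm _ _ _
      _ ≤ ∫⁻ b, eLpNorm (fun x => c b * (‖w (x, h)‖ₑ * ‖F b (x, h)‖ₑ)) s μ ∂β :=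
          eLpNorm_lintegral_le hs hm
      _ ≤ _ := lintegral_mono fun b => eLpNorm_nnreal_mul_le _ _ _ _
  rw [mixedNorm_eq ht0]
  calc _ ≤ eLpNorm (fun h => ∫⁻ b, c b *
          eLpNorm (fun x => ‖w (x, h)‖ₑ * ‖F b (x, h)‖ₑ) s μ ∂β) t ν :=
        eLpNorm_ennreal_mono inner
    _ ≤ ∫⁻ b, eLpNorm (fun h => c b *
          eLpNorm (fun x => ‖w (x, h)‖ₑ * ‖F b (x, h)‖ₑ) s μ) t ν ∂β :=
        eLpNorm_lintegral_le ht ((hc.comp measurable_fst).coe_nnreal_ennreal.mul hI)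
    _ ≤ _ := by
        refine lintegral_mono fun b => (eLpNorm_nnreal_mul_le _ _ _ _).trans_eq ?_
        rw [mixedNorm_eq ht0]

lemma measurable_besovWeight (α : ℝ) : Measurable (besovWeight α : K × Kˣ → ℝ) :=
  ((measurable_kabs_units.comp measurable_snd).coe_nnreal_real).pow_const _

/-- Convolution of an element of `Y` with a kernel in `L¹_v`. -/
lemma mixedNorm_integral_affMul_le (hs : 1 ≤ s) (ht : 1 ≤ t) (hw : Measurable w)
    {v : K × Kˣ → ℝ} (hR : ∀ a, OpNormLE μ ν w s t (rightTrans a) (v a))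
    (hv : Measurable v) {F k : K × Kˣ → ℂ} (hF : F ∈ mixedSpace μ ν w s t) (hk : Measurable k) :
    mixedNorm μ ν w s t (fun a => ∫ b, F (affMul a b) * k b ∂(affHaar μ ν)) ≤
      weightedNorm μ ν v k * mixedNorm μ ν w s t F := by
  have hm : Measurable (Function.uncurry fun b a : K × Kˣ => F (affMul a b)) :=
    hF.1.comp (measurable_affMul.comp measurable_swap)
  have h1 := mixedNorm_le_lintegral (β := affHaar μ ν) (μ := μ) (ν := ν) hs ht hw
    (c := fun b => ‖k b‖₊) hk.nnnorm (F := fun b a => F (affMul a b)) hm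
    (H := fun a => ∫ b, F (affMul a b) * k b ∂(affHaar μ ν)) (by
      intro a
      refine (enorm_integral_le_lintegral_enorm _).trans (le_of_eq ?_)
      refine lintegral_congr fun b => ?_
      rw [enorm_mul, mul_comm]; rfl)
  refine h1.trans ?_
  have h2 : Measurable fun b => ENNReal.ofReal (v b) * ‖k b‖ₑ := hv.ennreal_ofReal.mul hk.enorm
  rw [weightedNorm, ← lintegral_mul_const _ h2]
  refine lintegral_mono fun b => ?_
  calc _ ≤ ‖k b‖ₑ * (ENNReal.ofReal (v b) * mixedNorm μ ν w s t F) := by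
        refine mul_le_mul' le_rfl (hR b F hF).2
    _ = _ := by ring

lemma mixedNorm_const_mul (ht : t ≠ 0) (c : ℂ) (F : K × Kˣ → ℂ) :
    mixedNorm μ ν w s t (fun a => c * F a) ≤ ‖c‖ₑ * mixedNorm μ ν w s t F := by
  rw [mixedNorm_eq ht, mixedNorm_eq ht]
  refine le_trans ?_ (eLpNorm_nnreal_mul_le _ _ ‖c‖₊ _)
  refine eLpNorm_ennreal_mono fun h => ?_
  refine le_trans ?_ (eLpNorm_nnreal_mul_le _ _ ‖c‖₊ _)
  refine eLpNorm_ennreal_mono fun x => ?_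
  rw [enorm_mul, mul_left_comm]; exact le_rfl

end mixed

/-! ### Comparison with the Besov norm -/

section besov

variable [MeasurableSpace K] [BorelSpace K] {μ : Measure K} [μ.IsAddHaarMeasure] [μ.Regular]
  {ν : Measure Kˣ} [ν.IsHaarMeasure] {s t : ℝ≥0∞} {α : ℝ}

lemma measure_level (k : ℤ) : ν {h : Kˣ | level h = k} = unitMass ν := by
  obtain ⟨g, hg⟩ := exists_unit_kabs_eq K k
  rw [← measure_unit_sphere ν g]
  congr 1; ext h
  rw [mem_ofPred_eq, mem_ofPred_eq, ← level_eq_iff, level_eq_of_kabs hg]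

lemma measurable_level : Measurable (level : Kˣ → ℤ) := by
  refine measurable_to_countable' fun k => ?_
  obtain ⟨g, hg⟩ := exists_unit_kabs_eq K k
  have : level ⁻¹' {k} = {h : Kˣ | kabs (h : K) = kabs (g : K)} := by
    ext h
    rw [mem_preimage, mem_singleton_iff, mem_ofPred_eq, ← level_eq_iff, level_eq_of_kabs hg]
  rw [this]
  exact (isOpen_unit_coset g).measurableSet

/-- All spheres of Kˣ have the same mass. This turns the integral over scales into the sum over k of
the Besov norm, and is the source of the factor ν(𝔇*)^{1/t}. -/
lemma map_level : Measure.map (level : Kˣ → ℤ) ν = unitMass ν • Measure.count := by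
  refine Measure.ext_of_singleton fun k => ?_
  rw [Measure.map_apply measurable_level (measurableSet_singleton k), Measure.smul_apply,
    Measure.count_singleton, smul_eq_mul, mul_one]
  exact measure_level k

lemma eLpNorm_comp_level (f : ℤ → ℝ≥0∞) :
    eLpNorm (fun h : Kˣ => f (level h)) t ν =
      unitMass ν ^ (1 / t.toReal) * eLpNorm f t Measure.count := by
  have h1 := eLpNorm_map_measure (μ := ν) (p := t) (f := (level : Kˣ → ℤ)) (g := f)
    (measurable_of_countable f).aestronglyMeasurable measurable_level.aemeasurable
  rw [map_level, eLpNorm_smul_measure_of_ne_zero (unitMass_ne_zero ν)] at h1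
  simp only [one_div, smul_eq_mul] at h1 ⊢
  rw [← ENNReal.toReal_inv]
  exact h1.symm

lemma besovNorm_eq (ht : t ≠ 0) (f : TestDual μ) :
    besovNorm μ α s t f = eLpNorm (fun k : ℤ => ENNReal.ofReal ((resCard K : ℝ) ^ ((k : ℝ) * α)) *
      eLpNorm (convKernel μ f k) s μ) t Measure.count := by
  rw [besovNorm]
  split_ifs with h
  · rw [h, eLpNorm_exponent_top, eLpNormEssSup_eq_iSup (by simp)]
    simp only [enorm_eq_self]
  · rw [eLpNorm_ennreal_eq ht h, lintegral_count]
    congr 1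
    refine tsum_congr fun k => ?_
    rw [ENNReal.mul_rpow_of_nonneg _ _ ENNReal.toReal_nonneg,
      ENNReal.ofReal_rpow_of_pos (Real.rpow_pos_of_pos (resCard_real_pos K) _), ← Real.rpow_mul
      (resCard_real_pos K).le]

/-- The wavelet coefficients of `f` have norm `ν(𝔇*)^{1/t} ‖f‖` in `L^{s,t}_w`. -/
lemma mixedNorm_atom (ht : t ≠ 0) (f : TestDual μ) :
    mixedNorm μ ν (besovWeight α) s t (fun a => f (atom μ a)) =
      unitMass ν ^ (1 / t.toReal) * besovNorm μ α s t f := by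
  rw [mixedNorm_eq ht, besovNorm_eq ht, ← eLpNorm_comp_level]
  congr 1; funext h
  have h1 : ∀ x : K, ‖besovWeight α (x, h)‖ₑ * ‖f (atom μ (x, h))‖ₑ =
      ‖(((resCard K : ℝ) ^ ((level h : ℝ) * α) : ℝ) • convKernel μ f (level h) x)‖ₑ := by
    intro x
    have hf : f (atom μ (x, h)) = ((actFactor ((x, h) : K × Kˣ) * kabs (h : K) : ℝ) : ℂ) *
        convKernel μ f (level h) x := by
      rw [atom, map_smul]; rfl
    have hp := kabs_units_pos_real h
    rw [hf, enorm_mul, ← mul_assoc, enorm_smul]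
    congr 1
    rw [← ofReal_norm (Complex.ofReal _), Complex.norm_real, ofReal_norm, ← enorm_mul]
    congr 1
    -- The exponents of |h| add up to (-α - 1/2) - 1/2 + 1 = -α, and |h| = q^{-k}.
    rw [besovWeight, actFactor, ← mul_assoc, ← Real.rpow_add hp, ← Real.rpow_add_one hp.ne',
      kabs_eq_level, ← Real.rpow_intCast, ← Real.rpow_mul (resCard_real_pos K).le]
    congr 1
    push_cast; ring
  simp only [h1]
  rw [← Real.enorm_of_nonneg (Real.rpow_pos_of_pos (resCard_real_pos K) _).le]
  rw [← eLpNorm_const_smul]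
  exact eLpNorm_congr_enorm_ae (Filter.Eventually.of_forall fun x => by
    rw [enorm_eq_self]; rfl)

/-! ### The stabilizer of the wavelet and pointwise bounds in Y -/

variable (K) in
/-- The stabilizer `𝔇 ⋊ 𝔇*` of the wavelet. -/
def stabilizer : Set (K × Kˣ) := {u | cosetSetoid K (0, 1) u}

lemma mem_stabilizer {u : K × Kˣ} :
    u ∈ stabilizer K ↔ kabs (u.2 : K) = 1 ∧ u.1 ∈ fracIdeal K 0 := by
  rw [stabilizer, mem_ofPred_eq, cosetSetoid_iff_zpow (k := 0) (by simp)]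
  simp

lemma measurableSet_stabilizer : MeasurableSet (stabilizer K) :=
  (isOpen_cosetSetoid _).measurableSet

lemma mixedNorm_stabilizer (hμ : μ (fracIdeal K 0) = 1) (hs : s ≠ 0) (ht : t ≠ 0) :
    mixedNorm μ ν (besovWeight α) s t ((stabilizer K).indicator fun _ => 1) =
      unitMass ν ^ (1 / t.toReal) := by
  have hin : ∀ h : Kˣ, eLpNorm (fun x => ‖besovWeight α (x, h)‖ₑ *
      ‖(stabilizer K).indicator (fun _ => (1 : ℂ)) (x, h)‖ₑ) s μ =
      {h : Kˣ | kabs (h : K) = 1}.indicator (fun _ => (1 : ℝ≥0∞)) h := by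
    intro h
    by_cases hh : kabs (h : K) = 1
    · rw [indicator_of_mem (by exact hh)]
      have h1 := eLpNorm_indicator_const' (μ := μ) (p := s) (c := (1 : ℂ))
        (measurableSet_fracIdeal (K := K) 0) (by rw [hμ]; exact one_ne_zero) hs
      rw [hμ, ENNReal.one_rpow, mul_one, enorm_one] at h1
      rw [← h1]
      refine eLpNorm_congr_enorm_ae (Filter.Eventually.of_forall fun x => ?_)
      have h2 : (stabilizer K).indicator (fun _ => (1 : ℂ)) (x, h) =
          (fracIdeal K 0).indicator (fun _ => (1 : ℂ)) x := by
        refine indicator_one_congr ?_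
        rw [mem_stabilizer]; exact and_iff_right hh
      rw [enorm_eq_self, h2, besovWeight, hh]
      simp
    · rw [indicator_of_notMem (by exact hh)]
      have h2 : ∀ x, (stabilizer K).indicator (fun _ => (1 : ℂ)) (x, h) = 0 := fun x =>
        indicator_of_notMem (fun h' => hh (mem_stabilizer.1 h').1) _
      simp [h2]
  rw [mixedNorm_eq ht]
  simp only [hin]
  rw [eLpNorm_indicator_const' measurableSet_unit_sphere (unitMass_ne_zero ν) ht]
  simp [unitMass]

lemma stabilizer_mem_mixedSpace (hμ : μ (fracIdeal K 0) = 1) (hs : s ≠ 0) (ht : t ≠ 0) :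
    (stabilizer K).indicator (fun _ => 1) ∈ mixedSpace μ ν (besovWeight α) s t := by
  refine ⟨measurable_const.indicator measurableSet_stabilizer, ?_⟩
  rw [mixedNorm_stabilizer hμ hs ht]
  exact ENNReal.rpow_lt_top_of_nonneg (by positivity) (unitMass_ne_top ν)

lemma mixedNorm_stabilizer_ne_zero (hμ : μ (fracIdeal K 0) = 1) (hs : s ≠ 0) (ht : t ≠ 0) :
    mixedNorm μ ν (besovWeight α) s t ((stabilizer K).indicator fun _ => 1) ≠ 0 := by
  rw [mixedNorm_stabilizer hμ hs ht]
  exact (ENNReal.rpow_pos (pos_iff_ne_zero.2 (unitMass_ne_zero ν)) (unitMass_ne_top ν)).ne'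

/-- A control weight is admissible. -/
lemma IsControlWeight.isAdmissibleWeight {v : K × Kˣ → ℝ}
    (hv : IsControlWeight μ ν (besovWeight α) s t v) (hμ : μ (fracIdeal K 0) = 1) (hs : s ≠ 0)
    (ht : t ≠ 0) : IsAdmissibleWeight v where
  measurable := hv.measurable
  bounded := hv.bounded
  submul := hv.submul
  symm := hv.symm
  one_le a := by
    have hF := stabilizer_mem_mixedSpace (μ := μ) (ν := ν) (α := α) hμ hs ht
    set F : K × Kˣ → ℂ := (stabilizer K).indicator fun _ => 1
    have hN0 : mixedNorm μ ν (besovWeight α) s t F ≠ 0 := mixedNorm_stabilizer_ne_zero hμ hs ht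
    have h1 := hv.left a F hF
    have h2 := hv.left_inv a _ h1.1
    have h3 : leftTrans (affInv a) (leftTrans a F) = F := by
      funext b
      simp only [leftTrans, affInv_affInv, affInv_affMul_cancel_left]
    rw [h3] at h2
    -- Translating back and forth by a fixes F, whose norm is neither 0 nor ∞, so v(a)² ≥ 1.
    have h4 : mixedNorm μ ν (besovWeight α) s t F * 1 ≤
        mixedNorm μ ν (besovWeight α) s t F * ENNReal.ofReal (v a * v a) := by
      rw [mul_one, ENNReal.ofReal_mul (hv.pos a).le]
      refine (h2.2.trans (mul_le_mul' le_rfl h1.2)).trans (le_of_eq ?_)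
      ring
    have h5 := (ENNReal.mul_le_mul_iff_right hN0 hF.2.ne).1 h4
    rw [ENNReal.one_le_ofReal] at h5
    nlinarith [hv.pos a]

/-- Point evaluations of functions in `Y` that are constant on the cosets of the stabilizer. -/
lemma enorm_le_of_invariant {v : K × Kˣ → ℝ}
    (hv : IsControlWeight μ ν (besovWeight α) s t v) (hμ : μ (fracIdeal K 0) = 1) (hs : s ≠ 0)
    (ht : t ≠ 0) {F : K × Kˣ → ℂ} (hF : F ∈ mixedSpace μ ν (besovWeight α) s t)
    (hinv : ∀ a b, cosetSetoid K a b → F a = F b) (a : K × Kˣ) :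
    ‖F a‖ₑ ≤ (unitMass ν ^ (1 / t.toReal))⁻¹ * mixedNorm μ ν (besovWeight α) s t F *
      ENNReal.ofReal (v a) := by
  set N := unitMass ν ^ (1 / t.toReal) with hN
  have hN0 : N ≠ 0 :=
    (ENNReal.rpow_pos (pos_iff_ne_zero.2 (unitMass_ne_zero ν)) (unitMass_ne_top ν)).ne'
  have hNt : N ≠ ∞ := ENNReal.rpow_ne_top_of_nonneg (by positivity) (unitMass_ne_top ν)
  have h1 := (hv.left_inv a F hF).2
  -- F equals F(a) on the coset of a, so the translate of F by a⁻¹ dominates the constant |F(a)| on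
  -- the stabilizer, whose indicator has norm N.
  have hle : ∀ b, ‖F a * (stabilizer K).indicator (fun _ => 1) b‖ₑ ≤
      ‖leftTrans (affInv a) F b‖ₑ := by
    intro b
    by_cases hb : b ∈ stabilizer K
    · rw [indicator_of_mem hb, mul_one]
      simp only [leftTrans, affInv_affInv]
      rw [hinv a (affMul a b)]
      rw [cosetSetoid_iff]
      have hb' := mem_stabilizer.1 hb
      refine ⟨by simp [affMul, kabs_mul, hb'.1], ?_⟩
      have : a.1 - (affMul a b).1 = -((a.2 : K) * b.1) := by simp [affMul]
      rw [this, kabs_neg, kabs_mul]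
      refine mul_le_of_le_one_right' ?_
      have := hb'.2
      rw [mem_fracIdeal] at this
      simpa using this
    · rw [indicator_of_notMem hb]; simp
  have h2 : ‖F a‖ₑ * N ≤ ENNReal.ofReal (v a) * mixedNorm μ ν (besovWeight α) s t F := by
    refine le_trans ?_ h1
    refine le_trans ?_ (mixedNorm_mono ht hle)
    rw [hN, ← mixedNorm_stabilizer (μ := μ) (α := α) hμ hs ht]
    rcases eq_or_ne (F a) 0 with h0 | h0
    · simp [h0]
    -- Homogeneity is available as an upper bound only; applied to the inverse scalar it gives the
    -- lower bound needed here.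
    have h3 := mixedNorm_const_mul (μ := μ) (ν := ν) (w := besovWeight α) (s := s) ht (F a)⁻¹
      (fun b => F a * (stabilizer K).indicator (fun _ => 1) b)
    simp only [inv_mul_cancel_left₀ h0] at h3
    calc _ ≤ ‖F a‖ₑ * (‖(F a)⁻¹‖ₑ * mixedNorm μ ν (besovWeight α) s t
          (fun b => F a * (stabilizer K).indicator (fun _ => 1) b)) := by gcongr
      _ = _ := by
          rw [← mul_assoc, ← enorm_mul, mul_inv_cancel₀ h0, enorm_one, one_mul]
  calc ‖F a‖ₑ = N⁻¹ * (‖F a‖ₑ * N) := by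
        rw [mul_comm ‖F a‖ₑ, ← mul_assoc, ENNReal.inv_mul_cancel hN0 hNt, one_mul]
    _ ≤ N⁻¹ * (ENNReal.ofReal (v a) * mixedNorm μ ν (besovWeight α) s t F) := by gcongr
    _ = _ := by ring

end besov

/-! ### Existence of control weights -/

section weight

variable [MeasurableSpace K] [BorelSpace K] {μ : Measure K} [μ.IsAddHaarMeasure] [μ.Regular]
  {ν : Measure Kˣ} [ν.IsHaarMeasure] {s t : ℝ≥0∞} {α : ℝ}

lemma eLpNorm_affineHomeo (a : K × Kˣ) (f : K → ℝ≥0∞) :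
    eLpNorm (fun x => f (affineHomeo a x)) s μ =
      (kabs (a.2 : K) ^ (1 / s).toReal : ℝ≥0) * eLpNorm f s μ := by
  have h1 := (affineHomeo a).measurableEmbedding.eLpNorm_map_measure (μ := μ) (g := f) (p := s)
  have h0 : (kabs (a.2 : K) : ℝ≥0∞) ≠ 0 := by exact_mod_cast (kabs_units_pos a.2).ne'
  rw [map_affineHomeo, eLpNorm_smul_measure_of_ne_zero h0, smul_eq_mul,
    ← ENNReal.coe_rpow_of_ne_zero (kabs_units_pos a.2).ne'] at h1
  exact h1.symm

lemma eLpNorm_mul_left_units (k : Kˣ) (f : Kˣ → ℝ≥0∞) :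
    eLpNorm (fun h => f (k * h)) t ν = eLpNorm f t ν := by
  have h1 := (Homeomorph.mulLeft k).measurableEmbedding.eLpNorm_map_measure (μ := ν) (g := f)
    (p := t)
  have h2 : Measure.map (Homeomorph.mulLeft k) ν = ν := map_mul_left_eq_self ν k
  rw [h2] at h1
  exact h1.symm

lemma mixedNorm_le_of_slices {w : K × Kˣ → ℝ} (ht : t ≠ 0) {F G : K × Kˣ → ℂ} (k : Kˣ) (c : ℝ≥0)
    (h : ∀ h : Kˣ, eLpNorm (fun x => ‖w (x, h)‖ₑ * ‖G (x, h)‖ₑ) s μ ≤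
      c * eLpNorm (fun x => ‖w (x, k * h)‖ₑ * ‖F (x, k * h)‖ₑ) s μ) :
    mixedNorm μ ν w s t G ≤ c * mixedNorm μ ν w s t F := by
  rw [mixedNorm_eq ht, mixedNorm_eq ht, ← eLpNorm_mul_left_units k
    (fun h => eLpNorm (fun x => ‖w (x, h)‖ₑ * ‖F (x, h)‖ₑ) s μ)]
  exact (eLpNorm_ennreal_mono h).trans (eLpNorm_nnreal_mul_le _ _ _ _)

lemma besovWeight_mul (k h : Kˣ) (x z : K) : ‖besovWeight α (x, h)‖ₑ =
    (kabs (k : K) ^ (α + 1 / 2) : ℝ≥0) * ‖besovWeight α (z, k * h)‖ₑ := by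
  have h1 := kabs_units_pos_real k
  have h2 := kabs_units_pos_real h
  have h3 : ((kabs (k : K) ^ (α + 1 / 2) : ℝ≥0) : ℝ≥0∞) =
      ‖((kabs (k : K) : ℝ) ^ (α + 1 / 2) : ℝ)‖ₑ := by
    rw [Real.enorm_of_nonneg (by positivity), ← NNReal.coe_rpow, ENNReal.ofReal_coe_nnreal]
  rw [h3, ← enorm_mul, besovWeight, besovWeight, Units.val_mul, kabs_mul, NNReal.coe_mul,
    Real.mul_rpow h1.le h2.le, ← mul_assoc, ← Real.rpow_add h1]
  ring_nf
  simp

/-- The exponent 1/s comes from the dilation in x, read as 0 for s = ∞, and -α - 1/2 from the change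
of the weight. For right translations the first coordinate is only translated, and the weight alone
contributes. -/
lemma mixedNorm_leftTrans (ht : t ≠ 0) (a : K × Kˣ) (F : K × Kˣ → ℂ) :
    mixedNorm μ ν (besovWeight α) s t (leftTrans a F) ≤
      (kabs (a.2 : K) ^ ((1 / s).toReal - α - 1 / 2) : ℝ≥0) *
        mixedNorm μ ν (besovWeight α) s t F := by
  refine mixedNorm_le_of_slices ht a.2⁻¹ _ fun h => ?_
  have h1 : ∀ x : K, ‖besovWeight α (x, h)‖ₑ * ‖leftTrans a F (x, h)‖ₑ =
      (fun z : K => (kabs ((a.2⁻¹ : Kˣ) : K) ^ (α + 1 / 2) : ℝ≥0) *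
        (‖besovWeight α (z, a.2⁻¹ * h)‖ₑ * ‖F (z, a.2⁻¹ * h)‖ₑ)) (affineHomeo a x) := by
    intro x
    simp only
    rw [← mul_assoc, ← besovWeight_mul a.2⁻¹ h x, leftTrans, affMul, affInv, affineHomeo_apply,
      mul_sub, sub_eq_add_neg]
  simp only [h1]
  rw [eLpNorm_affineHomeo a (fun z : K => (kabs ((a.2⁻¹ : Kˣ) : K) ^ (α + 1 / 2) : ℝ≥0) *
        (‖besovWeight α (z, a.2⁻¹ * h)‖ₑ * ‖F (z, a.2⁻¹ * h)‖ₑ))]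
  have hc : kabs (a.2 : K) ^ ((1 / s).toReal - α - 1 / 2) =
      kabs (a.2 : K) ^ (1 / s).toReal * kabs ((a.2⁻¹ : Kˣ) : K) ^ (α + 1 / 2) := by
    rw [kabs_units_inv, NNReal.inv_rpow, ← NNReal.rpow_neg,
      ← NNReal.rpow_add (kabs_units_pos a.2).ne']
    ring_nf
  rw [hc, ENNReal.coe_mul, mul_assoc]
  gcongr
  exact eLpNorm_nnreal_mul_le _ _ _ _

lemma mixedNorm_rightTrans (ht : t ≠ 0) (a : K × Kˣ) (F : K × Kˣ → ℂ) :
    mixedNorm μ ν (besovWeight α) s t (rightTrans a F) ≤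
      (kabs (a.2 : K) ^ (α + 1 / 2) : ℝ≥0) * mixedNorm μ ν (besovWeight α) s t F := by
  refine mixedNorm_le_of_slices ht a.2 _ fun h => ?_
  have h1 : ∀ x : K, ‖besovWeight α (x, h)‖ₑ * ‖rightTrans a F (x, h)‖ₑ =
      (fun z : K => (kabs (a.2 : K) ^ (α + 1 / 2) : ℝ≥0) *
        (‖besovWeight α (z, a.2 * h)‖ₑ * ‖F (z, a.2 * h)‖ₑ))
        (affineHomeo (-((h : K) * a.1), 1) x) := by
    intro x
    simp only
    rw [← mul_assoc, ← besovWeight_mul a.2 h x, rightTrans, affMul, affineHomeo_apply]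
    simp [mul_comm a.2, add_comm]
  simp only [h1]
  rw [eLpNorm_affineHomeo _ (fun z : K => (kabs (a.2 : K) ^ (α + 1 / 2) : ℝ≥0) *
        (‖besovWeight α (z, a.2 * h)‖ₑ * ‖F (z, a.2 * h)‖ₑ))]
  simp only [Units.val_one, kabs_one, NNReal.one_rpow, ENNReal.coe_one, one_mul]
  exact eLpNorm_nnreal_mul_le _ _ _ _

/-- A symmetric submultiplicative function of `r > 0` that dominates `r^σ`, `r^{-σ}` and `r^τ`. -/
def powerSum (σ τ r : ℝ) : ℝ := r ^ σ + r ^ (-σ) + r ^ τ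

lemma powerSum_pos (σ τ : ℝ) {r : ℝ} (hr : 0 < r) : 0 < powerSum σ τ r := by
  unfold powerSum; positivity

lemma powerSum_mul_le (σ τ : ℝ) {r r' : ℝ} (hr : 0 < r) (hr' : 0 < r') :
    powerSum σ τ (r * r') ≤ powerSum σ τ r * powerSum σ τ r' := by
  unfold powerSum
  simp only [Real.mul_rpow hr.le hr'.le]
  have h := fun e => Real.rpow_pos_of_pos hr e
  have h' := fun e => Real.rpow_pos_of_pos hr' e
  have e1 := mul_pos (h σ) (h' (-σ))
  have e2 := mul_pos (h σ) (h' τ)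
  have e3 := mul_pos (h (-σ)) (h' σ)
  have e4 := mul_pos (h (-σ)) (h' τ)
  have e5 := mul_pos (h τ) (h' σ)
  have e6 := mul_pos (h τ) (h' (-σ))
  nlinarith

variable (K) in
/-- The explicit control weight. -/
def powerWeight (σ τ : ℝ) (a : K × Kˣ) : ℝ :=
  powerSum σ τ (kabs (a.2 : K)) + kabs (a.2 : K) * powerSum σ τ (kabs (a.2 : K) : ℝ)⁻¹

lemma continuous_powerWeight (σ τ : ℝ) : Continuous (powerWeight K σ τ) := by
  have h : Continuous fun a : K × Kˣ => (kabs (a.2 : K) : ℝ) :=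
    NNReal.continuous_coe.comp (continuous_kabs_units.comp continuous_snd)
  have hne : ∀ a : K × Kˣ, (kabs (a.2 : K) : ℝ) ≠ 0 := fun a => (kabs_units_pos_real a.2).ne'
  have hp : ∀ e : ℝ, Continuous fun a : K × Kˣ => (kabs (a.2 : K) : ℝ) ^ e := fun e =>
    h.rpow_const fun a => Or.inl (hne a)
  have hp' : ∀ e : ℝ, Continuous fun a : K × Kˣ => ((kabs (a.2 : K) : ℝ)⁻¹) ^ e := fun e =>
    (h.inv₀ hne).rpow_const fun a => Or.inl (inv_ne_zero (hne a))
  unfold powerWeight powerSum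
  exact (((hp _).add (hp _)).add (hp _)).add (h.mul (((hp' _).add (hp' _)).add (hp' _)))

lemma opNormLE_of_le {w : K × Kˣ → ℝ} {A : (K × Kˣ → ℂ) → (K × Kˣ → ℂ)} {c : ℝ≥0} {d : ℝ}
    (hm : ∀ F, Measurable F → Measurable (A F))
    (hA : ∀ F, mixedNorm μ ν w s t (A F) ≤ c * mixedNorm μ ν w s t F) (hcd : (c : ℝ) ≤ d) :
    OpNormLE μ ν w s t A d := by
  refine fun F hF => ⟨⟨hm F hF.1, (hA F).trans_lt (ENNReal.mul_lt_top ENNReal.coe_lt_top hF.2)⟩,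
    (hA F).trans ?_⟩
  gcongr
  rw [← ENNReal.ofReal_coe_nnreal]
  exact ENNReal.ofReal_le_ofReal hcd

/-- With r = |h|, the powers r^σ and r^{-σ} bound the left translations by a and a⁻¹, and r^τ the
right translation by a. The summand r p(1/r), with p the sum of these powers, bounds the right
translation by a⁻¹ times Δ(a⁻¹) = r, and also produces the required symmetry. -/
lemma isControlWeight_powerWeight (ht : t ≠ 0) : IsControlWeight μ ν (besovWeight α) s t
    (powerWeight K ((1 / s).toReal - α - 1 / 2) (α + 1 / 2)) := by
  set σ := (1 / s).toReal - α - 1 / 2 with hσ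
  set τ := α + 1 / 2 with hτ
  have hr : ∀ a : K × Kˣ, (0 : ℝ) < kabs (a.2 : K) := fun a => kabs_units_pos_real a.2
  have hfst : ∀ a : K × Kˣ, powerSum σ τ (kabs (a.2 : K)) ≤ powerWeight K σ τ a := by
    intro a
    have := mul_pos (hr a) (powerSum_pos σ τ (inv_pos.2 (hr a)))
    unfold powerWeight; linarith
  have hsnd : ∀ a : K × Kˣ, kabs (a.2 : K) * powerSum σ τ (kabs (a.2 : K) : ℝ)⁻¹ ≤
      powerWeight K σ τ a := by
    intro a
    have := powerSum_pos σ τ (hr a)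
    unfold powerWeight; linarith
  have hpos : ∀ a : K × Kˣ, 0 < powerWeight K σ τ a := fun a =>
    (powerSum_pos σ τ (hr a)).trans_le (hfst a)
  have hs1 : ∀ r : ℝ, 0 < r → r ^ σ ≤ powerSum σ τ r ∧ r ^ (-σ) ≤ powerSum σ τ r ∧
      r ^ τ ≤ powerSum σ τ r := by
    intro r hr
    have h1 := Real.rpow_pos_of_pos hr σ
    have h2 := Real.rpow_pos_of_pos hr (-σ)
    have h3 := Real.rpow_pos_of_pos hr τ
    unfold powerSum
    exact ⟨by linarith, by linarith, by linarith⟩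
  have hL : ∀ (a : K × Kˣ) (F : K × Kˣ → ℂ), Measurable F → Measurable (leftTrans a F) :=
    fun a F hF => hF.comp (measurable_affMul_left _)
  have hR : ∀ (a : K × Kˣ) (F : K × Kˣ → ℂ), Measurable F → Measurable (rightTrans a F) :=
    fun a F hF => hF.comp (measurable_affMul_right a)
  have hinv : ∀ a : K × Kˣ, (kabs ((affInv a).2 : K) : ℝ) = (kabs (a.2 : K) : ℝ)⁻¹ := by
    intro a
    rw [affInv, kabs_units_inv, NNReal.coe_inv]
  refine ⟨hpos, (continuous_powerWeight σ τ).measurable, fun C hC =>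
    (hC.image (continuous_powerWeight σ τ)).bddAbove, fun a b => ?_, fun a => ?_, fun a => ?_,
    fun a => ?_, fun a => ?_, fun a => ?_⟩
  · have h1 : (kabs ((affMul a b).2 : K) : ℝ) = kabs (a.2 : K) * kabs (b.2 : K) := by
      simp [affMul, kabs_mul]
    have h2 := powerSum_mul_le σ τ (hr a) (hr b)
    have h3 := powerSum_mul_le σ τ (inv_pos.2 (hr a)) (inv_pos.2 (hr b))
    have p1 := powerSum_pos σ τ (hr a)
    have p2 := powerSum_pos σ τ (hr b)
    have p3 := mul_pos (hr a) (powerSum_pos σ τ (inv_pos.2 (hr a)))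
    have p4 := mul_pos (hr b) (powerSum_pos σ τ (inv_pos.2 (hr b)))
    unfold powerWeight
    rw [h1, mul_inv]
    have h4 : (kabs (a.2 : K) : ℝ) * kabs (b.2 : K) *
        powerSum σ τ ((kabs (a.2 : K) : ℝ)⁻¹ * (kabs (b.2 : K) : ℝ)⁻¹) ≤
        (kabs (a.2 : K) * powerSum σ τ (kabs (a.2 : K) : ℝ)⁻¹) *
          (kabs (b.2 : K) * powerSum σ τ (kabs (b.2 : K) : ℝ)⁻¹) := by
      refine (mul_le_mul_of_nonneg_left h3 (mul_pos (hr a) (hr b)).le).trans (le_of_eq ?_)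
      ring
    nlinarith [mul_pos p1 p4, mul_pos p3 p2]
  · refine opNormLE_of_le (hL a) (mixedNorm_leftTrans ht a) ?_
    rw [NNReal.coe_rpow]
    exact (hs1 _ (hr a)).1.trans (hfst a)
  · refine opNormLE_of_le (hL _) (mixedNorm_leftTrans ht _) ?_
    rw [NNReal.coe_rpow, hinv, Real.inv_rpow (hr a).le, ← Real.rpow_neg (hr a).le]
    exact (hs1 _ (hr a)).2.1.trans (hfst a)
  · refine opNormLE_of_le (hR a) (mixedNorm_rightTrans ht a) ?_
    rw [NNReal.coe_rpow]
    exact (hs1 _ (hr a)).2.2.trans (hfst a)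
  · refine opNormLE_of_le (hR _) (mixedNorm_rightTrans ht _) ?_
    rw [NNReal.coe_rpow, hinv, affMod_affInv, le_div_iff₀ (hr a), mul_comm]
    exact (mul_le_mul_of_nonneg_left (hs1 _ (inv_pos.2 (hr a))).2.2 (hr a).le).trans (hsnd a)
  · rw [affMod_affInv]
    unfold powerWeight
    rw [hinv, inv_inv, add_mul, mul_comm _ (kabs (a.2 : K) : ℝ),
      mul_right_comm, inv_mul_cancel₀ (hr a).ne', one_mul, add_comm]

end weight

/-! ### Coorbit spaces and Besov spaces -/

section coorbit

variable [MeasurableSpace K] [BorelSpace K] {μ : Measure K} [μ.IsAddHaarMeasure] [μ.Regular]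
  {ν : Measure Kˣ} [ν.IsHaarMeasure] {v w : K × Kˣ → ℝ} {s t : ℝ≥0∞} {α : ℝ} {g₀ g : Lp ℂ 2 μ}

/-- The norms of ℋ¹_v built with g₀ and with φ are equivalent, so continuity may be tested with φ;
`mem_reservoir_of_bound` is the converse. -/
lemma exists_bound_of_mem_reservoir (hμ : μ (fracIdeal K 0) = 1) (hv : IsAdmissibleWeight v)
    (hg₀ : IsAnalyzing μ ν v g₀) {l : testVectors μ ν v g₀ →ₛₗ[starRingEnd ℂ] ℂ}
    (hl : l ∈ reservoir μ ν v g₀) : ∃ C : ℝ≥0∞, C < ∞ ∧ ∀ f : testVectors μ ν v g₀,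
      ‖l f‖ₑ ≤ C * weightedNorm μ ν v (waveletTransform μ (haarWaveletL2 μ) f.1) := by
  obtain ⟨C, hC⟩ := hl
  refine ⟨ENNReal.ofReal C * (‖((unitMass ν).toReal : ℂ)⁻¹‖ₑ *
    weightedNorm μ ν v (waveletTransform μ (haarWaveletL2 μ) g₀)), ENNReal.mul_lt_top
      ENNReal.ofReal_lt_top (ENNReal.mul_lt_top enorm_lt_top
        (weightedNorm_haarWavelet_lt_top_of_isAnalyzing hμ hv hg₀)), fun f => ?_⟩
  calc ‖l f‖ₑ ≤ ENNReal.ofReal (C * testVectorNorm μ ν v g₀ f.1) := by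
        rw [← ofReal_norm]; exact ENNReal.ofReal_le_ofReal (hC f)
    _ = ENNReal.ofReal C * weightedNorm μ ν v (waveletTransform μ g₀ f.1) := by
        rw [testVectorNorm_eq hμ hv, ENNReal.ofReal_mul' ENNReal.toReal_nonneg,
          ENNReal.ofReal_toReal ((mem_testVectors_iff hμ hv).1 f.2).ne]
    _ ≤ _ := by
        rw [mul_assoc]
        gcongr
        exact weightedNorm_waveletTransform_le hμ hv
          ((mem_testVectors_iff_haarWavelet hμ hv hg₀ _).1 f.2) g₀

lemma mem_reservoir_of_bound (hμ : μ (fracIdeal K 0) = 1) (hv : IsAdmissibleWeight v)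
    (hg₀ : IsAnalyzing μ ν v g₀) {l : testVectors μ ν v g₀ →ₛₗ[starRingEnd ℂ] ℂ} {C : ℝ≥0∞}
    (hC : C < ∞) (hl : ∀ f : testVectors μ ν v g₀,
      ‖l f‖ₑ ≤ C * weightedNorm μ ν v (waveletTransform μ (haarWaveletL2 μ) f.1)) :
    l ∈ reservoir μ ν v g₀ := by
  obtain ⟨D, hD, h⟩ := exists_weightedNorm_haarWavelet_le (ν := ν) hμ hv hg₀.1
  refine ⟨(C * D).toReal, fun f => ?_⟩
  have hfin := (mem_testVectors_iff hμ hv).1 f.2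
  rw [testVectorNorm_eq hμ hv, ← ENNReal.toReal_mul, ← toReal_enorm]
  refine ENNReal.toReal_mono (ENNReal.mul_lt_top (ENNReal.mul_lt_top hC hD) hfin).ne ?_
  refine (hl f).trans ?_
  rw [mul_assoc]
  gcongr
  exact h _

lemma quasiRegular_mem_testVectors (hμ : μ (fracIdeal K 0) = 1) (hv : IsAdmissibleWeight v)
    (hg₀ : IsAnalyzing μ ν v g₀) (hg : IsAnalyzing μ ν v g) (a : K × Kˣ) :
    quasiRegular μ a g ∈ testVectors μ ν v g₀ := by
  rw [mem_testVectors_iff_haarWavelet hμ hv hg₀]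
  exact (weightedNorm_quasiRegular_le hμ hv _ _).trans_lt (ENNReal.mul_lt_top
    ENNReal.ofReal_lt_top (weightedNorm_haarWavelet_lt_top_of_isAnalyzing hμ hv hg))

lemma testToL2_mem_testVectors (hμ : μ (fracIdeal K 0) = 1) (hv : IsAdmissibleWeight v)
    (hg₀ : IsAnalyzing μ ν v g₀) (ψ : testSpace μ) : testToL2 μ ψ ∈ testVectors μ ν v g₀ :=
  (mem_testVectors_iff_haarWavelet hμ hv hg₀ _).2 (weightedNorm_testToL2_lt_top hμ hv ψ)

lemma measurable_extWavelet (hμ : μ (fracIdeal K 0) = 1) (hv : IsAdmissibleWeight v)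
    (hg₀ : IsAnalyzing μ ν v g₀) {l : testVectors μ ν v g₀ →ₛₗ[starRingEnd ℂ] ℂ}
    (hl : l ∈ reservoir μ ν v g₀) (hg : ∀ a, quasiRegular μ a g ∈ testVectors μ ν v g₀) :
    Measurable (extWavelet hg l) := by
  obtain ⟨C, hC, hb⟩ := exists_bound_of_mem_reservoir hμ hv hg₀ hl
  exact measurable_functional_quasiRegular hμ hv (mem_testVectors_iff_haarWavelet hμ hv hg₀)
    (quasiRegular_mem_testVectors hμ hv hg₀ (isAnalyzing_haarWaveletL2 hμ hv)) hC hb hg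

/-- The transform with respect to the Haar wavelet controls all other transforms. -/
lemma mixedNorm_extWavelet_le (hμ : μ (fracIdeal K 0) = 1) (hs : 1 ≤ s) (ht : 1 ≤ t)
    (hw : Measurable w) (hR : ∀ a, OpNormLE μ ν w s t (rightTrans a) (v a))
    (hv : IsAdmissibleWeight v) (hg₀ : IsAnalyzing μ ν v g₀)
    {l : testVectors μ ν v g₀ →ₛₗ[starRingEnd ℂ] ℂ} (hl : l ∈ reservoir μ ν v g₀)
    (hg : ∀ a, quasiRegular μ a g ∈ testVectors μ ν v g₀)
    (hφ : ∀ a, quasiRegular μ a (haarWaveletL2 μ) ∈ testVectors μ ν v g₀)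
    (hY : extWavelet hφ l ∈ mixedSpace μ ν w s t) :
    mixedNorm μ ν w s t (extWavelet hg l) ≤ ‖((unitMass ν).toReal : ℂ)⁻¹‖ₑ *
      weightedNorm μ ν v (waveletTransform μ (haarWaveletL2 μ) g) *
        mixedNorm μ ν w s t (extWavelet hφ l) := by
  obtain ⟨C, hC, hb⟩ := exists_bound_of_mem_reservoir hμ hv hg₀ hl
  have h1 : extWavelet hg l = fun a => ((unitMass ν).toReal : ℂ)⁻¹ *
      ∫ b, extWavelet hφ l (affMul a b) *
        star (waveletTransform μ (haarWaveletL2 μ) g b) ∂(affHaar μ ν) := by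
    funext a
    exact functional_quasiRegular_eq_integral hμ hv
      (mem_testVectors_iff_haarWavelet hμ hv hg₀) hφ hC hb hg a
  rw [h1]
  refine (mixedNorm_const_mul (zero_lt_one.trans_le ht).ne' _ _).trans ?_
  rw [mul_assoc]
  gcongr
  refine (mixedNorm_integral_affMul_le hs ht hw hR hv.measurable hY
    (continuous_star.comp (continuous_waveletTransform hμ _ g)).measurable).trans_eq ?_
  congr 1
  exact weightedNorm_star _

/-- Conversely, every analyzing vector controls the transform with respect to the Haar wavelet. -/
lemma exists_mixedNorm_extWavelet_haarWavelet_le (hμ : μ (fracIdeal K 0) = 1) (hs : 1 ≤ s)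
    (ht : 1 ≤ t) (hw : Measurable w) (hR : ∀ a, OpNormLE μ ν w s t (rightTrans a) (v a))
    (hv : IsAdmissibleWeight v) (hg₀ : IsAnalyzing μ ν v g₀) (hg0 : g ≠ 0)
    (hg : ∀ a, quasiRegular μ a g ∈ testVectors μ ν v g₀)
    (hφ : ∀ a, quasiRegular μ a (haarWaveletL2 μ) ∈ testVectors μ ν v g₀) :
    ∃ D : ℝ≥0∞, D < ∞ ∧ ∀ l ∈ reservoir μ ν v g₀, extWavelet hg l ∈ mixedSpace μ ν w s t →
      mixedNorm μ ν w s t (extWavelet hφ l) ≤ D * mixedNorm μ ν w s t (extWavelet hg l) := by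
  obtain ⟨c, hc⟩ := exists_waveletTransform_ne_zero hμ hg0
  set d : ℂ := orthConst ν * inner ℂ (quasiRegular μ c g) (haarWaveletL2 μ) with hd
  have hd0 : d ≠ 0 := mul_ne_zero (orthConst_ne_zero ν) hc
  refine ⟨‖d⁻¹‖ₑ * (weightedNorm μ ν v (waveletKernel μ) * ENNReal.ofReal (v c)),
    ENNReal.mul_lt_top enorm_lt_top (ENNReal.mul_lt_top
      (weightedNorm_waveletKernel_lt_top hμ hv) ENNReal.ofReal_lt_top), fun l hl hY => ?_⟩
  obtain ⟨C, hC, hb⟩ := exists_bound_of_mem_reservoir hμ hv hg₀ hl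
  have hgc : ∀ a, quasiRegular μ a (quasiRegular μ c g) ∈ testVectors μ ν v g₀ := by
    intro a
    rw [← quasiRegular_affMul]
    exact hg _
  have hYc := hR c _ hY
  have hr : ∀ a, rightTrans c (extWavelet hg l) a =
      l ⟨quasiRegular μ a (quasiRegular μ c g), hgc a⟩ := by
    intro a
    simp only [rightTrans, extWavelet, quasiRegular_affMul]
  have h1 : extWavelet hφ l = fun a => d⁻¹ *
      ∫ b, rightTrans c (extWavelet hg l) (affMul a b) * waveletKernel μ b ∂(affHaar μ ν) := by
    funext a
    simp only [hr]
    rw [integral_functional_mul_waveletKernel hμ hv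
      (mem_testVectors_iff_haarWavelet hμ hv hg₀) hφ hC hb hgc a, ← hd, inv_mul_cancel_left₀ hd0]
    rfl
  rw [h1]
  refine (mixedNorm_const_mul (zero_lt_one.trans_le ht).ne' _ _).trans ?_
  rw [mul_assoc, mul_assoc]
  gcongr
  refine (mixedNorm_integral_affMul_le hs ht hw hR hv.measurable hYc.1
    continuous_waveletKernel.measurable).trans ?_
  gcongr
  exact hYc.2

/-! ### Restriction of functionals to 𝒮₀(K) and its inverse -/

lemma toTestDual_atom (hS : ∀ ψ : testSpace μ, testToL2 μ ψ ∈ testVectors μ ν v g₀)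
    (hφ : ∀ a, quasiRegular μ a (haarWaveletL2 μ) ∈ testVectors μ ν v g₀)
    (l : testVectors μ ν v g₀ →ₛₗ[starRingEnd ℂ] ℂ) (a : K × Kˣ) :
    toTestDual hS l (atom μ a) = extWavelet hφ l a := by
  change l _ = l _
  congr 1
  apply Subtype.ext
  change testToL2 μ _ = quasiRegular μ a (haarWaveletL2 μ)
  rw [← testToL2_atom]
  congr 1
  exact Subtype.ext (funext fun y => star_atom a y)

lemma mixedNorm_extWavelet_haarWavelet (ht : t ≠ 0)
    (hS : ∀ ψ : testSpace μ, testToL2 μ ψ ∈ testVectors μ ν v g₀)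
    (hφ : ∀ a, quasiRegular μ a (haarWaveletL2 μ) ∈ testVectors μ ν v g₀)
    (l : testVectors μ ν v g₀ →ₛₗ[starRingEnd ℂ] ℂ) :
    mixedNorm μ ν (besovWeight α) s t (extWavelet hφ l) =
      unitMass ν ^ (1 / t.toReal) * besovNorm μ α s t (toTestDual hS l) := by
  rw [← mixedNorm_atom ht]
  congr 1; funext a
  exact (toTestDual_atom hS hφ l a).symm

/-- The restriction to 𝒮₀(K) contains the values on atoms, since atoms are real and the conjugation
is harmless. By the atomic expansion these values determine the functional. -/
lemma toTestDual_injOn (hμ : μ (fracIdeal K 0) = 1) (hv : IsAdmissibleWeight v)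
    (hg₀ : IsAnalyzing μ ν v g₀)
    (hS : ∀ ψ : testSpace μ, testToL2 μ ψ ∈ testVectors μ ν v g₀) :
    Set.InjOn (toTestDual hS) (reservoir μ ν v g₀) := by
  intro l hl l' hl' h
  have hφ := quasiRegular_mem_testVectors hμ hv hg₀ (isAnalyzing_haarWaveletL2 hμ hv)
  have hV := mem_testVectors_iff_haarWavelet hμ hv hg₀
  obtain ⟨C, hC, hb⟩ := exists_bound_of_mem_reservoir hμ hv hg₀ hl
  obtain ⟨C', hC', hb'⟩ := exists_bound_of_mem_reservoir hμ hv hg₀ hl'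
  ext f
  have h1 := hasSum_functional hμ hv hV hφ hC hb f
  have h2 := hasSum_functional hμ hv hV hφ hC' hb' f
  refine h1.unique ?_
  convert h2 using 3 with i
  have e1 := toTestDual_atom hS hφ l i.out
  have e2 := toTestDual_atom hS hφ l' i.out
  rw [h] at e1
  exact e1.symm.trans e2

variable (μ) in
/-- The inclusion `𝒮₀(K) ⊆ L²(K)` as a linear map. -/
def testToL2Linear : testSpace μ →ₗ[ℂ] Lp ℂ 2 μ where
  toFun := testToL2 μ
  map_add' _ _ := MemLp.toLp_add _ _
  map_smul' _ _ := MemLp.toLp_const_smul _ _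

lemma testToL2_injective : Function.Injective (testToL2Linear μ) := by
  rw [← LinearMap.ker_eq_bot, LinearMap.ker_eq_bot']
  intro χ h
  have h1 : (testToL2 μ χ : K → ℂ) =ᵐ[μ] (0 : K → ℂ) := by
    have h' : testToL2 μ χ = 0 := h
    rw [h']
    exact Lp.coeFn_zero _ _ _
  have h2 : χ.1 =ᵐ[μ] (0 : K → ℂ) := (coeFn_testToL2 χ).symm.trans h1
  exact Subtype.ext ((χ.2.1.continuous.ae_eq_iff_eq μ continuous_const).1 h2)

/-- Every function in `𝒮₀(K)` is a finite combination of atoms. -/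
lemma exists_finite_atomic_expansion (ν : Measure Kˣ) [ν.IsHaarMeasure]
    (hμ : μ (fracIdeal K 0) = 1) (ψ : testSpace μ) :
    ∃ T : Finset (AffCoset K),
      (∀ i ∉ T, waveletTransform μ (haarWaveletL2 μ) (testToL2 μ ψ) i.out = 0) ∧
      ψ = ∑ i ∈ T, waveletTransform μ (haarWaveletL2 μ) (testToL2 μ ψ) i.out • atom μ i.out := by
  obtain ⟨C, hC, h0⟩ := exists_compact_waveletTransform_eq_zero ψ
  -- The quotient is discrete because the cosets are open, so a compact set meets only finitely many
  -- of them.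
  have hfin : ((fun a : K × Kˣ => (⟦a⟧ : AffCoset K)) '' C).Finite := by
    let _ : TopologicalSpace (AffCoset K) := ⊥
    have : DiscreteTopology (AffCoset K) := ⟨rfl⟩
    have hc : Continuous fun a : K × Kˣ => (⟦a⟧ : AffCoset K) :=
      continuous_of_invariant fun a b h => Quotient.sound h
    exact (hC.image hc).finite_of_discrete
  refine ⟨hfin.toFinset, fun i hi => ?_, ?_⟩
  · refine h0 _ fun h => hi ?_
    rw [Set.Finite.mem_toFinset]
    exact ⟨i.out, h, Quotient.out_eq i⟩
  · set T := hfin.toFinset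
    have hT : ∀ i ∉ T, waveletTransform μ (haarWaveletL2 μ) (testToL2 μ ψ) i.out = 0 := by
      intro i hi
      refine h0 _ fun h => hi ?_
      rw [Set.Finite.mem_toFinset]
      exact ⟨i.out, h, Quotient.out_eq i⟩
    apply testToL2_injective
    rw [← sub_eq_zero]
    -- The identity is tested on wavelet transforms, where the reproducing series has only the
    -- finitely many terms in T.
    refine eq_zero_of_waveletTransform_eq_zero hμ fun a => ?_
    have h1 := hasSum_reproducing ν hμ (testToL2 μ ψ) a
    have h2 := h1.unique (hasSum_sum_of_ne_finset_zero (s := T) fun i hi => by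
      rw [hT i hi, zero_mul])
    rw [map_sum, waveletTransform_sub, sub_eq_zero]
    refine h2.trans ?_
    simp only [map_smul]
    rw [waveletTransform, inner_sum]
    refine Finset.sum_congr rfl fun i _ => ?_
    rw [inner_smul_right]
    congr 1
    rw [waveletTransform, ← testToL2_atom i.out]
    rfl

lemma star_waveletTransform_conj (ψ : testSpace μ) (a : K × Kˣ) :
    star (waveletTransform μ (haarWaveletL2 μ)
      (testToL2 μ ⟨fun y => star (ψ.1 y), conj_mem μ ψ.2⟩) a) =
      waveletTransform μ (haarWaveletL2 μ) (testToL2 μ ψ) a := by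
  rw [waveletTransform, waveletTransform, ← testToL2_atom, inner_testToL2_testToL2,
    inner_testToL2_testToL2]
  have h : ∀ F : K → ℂ, star (∫ x, F x ∂μ) = ∫ x, star (F x) ∂μ := fun F => integral_conj.symm
  rw [h]
  congr 1; funext y
  simp only [star_mul', star_star, star_atom]

/-- The conjugate-linear functional with prescribed wavelet coefficients. -/
lemma exists_functional (hμ : μ (fracIdeal K 0) = 1) (hv : IsAdmissibleWeight v)
    (hg₀ : IsAnalyzing μ ν v g₀)
    (hS : ∀ ψ : testSpace μ, testToL2 μ ψ ∈ testVectors μ ν v g₀) (f : TestDual μ)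
    {C : ℝ≥0∞} (hC : C < ∞) (hf : ∀ a, ‖f (atom μ a)‖ₑ ≤ C * ENNReal.ofReal (v a)) :
    ∃ l ∈ reservoir μ ν v g₀, toTestDual hS l = f := by
  have hinv : ∀ a b, cosetSetoid K a b → f (atom μ a) = f (atom μ b) := fun a b h => by
    rw [atom_eq_of_rel h]
  have hfm : Measurable fun a => f (atom μ a) := (continuous_of_invariant hinv).measurable
  have hVm : ∀ ψ : Lp ℂ 2 μ, Measurable fun a =>
      star (waveletTransform μ (haarWaveletL2 μ) ψ a) := fun ψ =>
    (continuous_star.comp (continuous_waveletTransform hμ _ ψ)).measurable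
  have hint : ∀ ψ : testVectors μ ν v g₀, Integrable (fun a =>
      star (waveletTransform μ (haarWaveletL2 μ) ψ.1 a) * f (atom μ a)) (affHaar μ ν) := by
    intro ψ
    refine integrable_mul_of_bound hv (hVm ψ.1) hfm ?_ hC hf
    rw [weightedNorm_star]
    exact (mem_testVectors_iff_haarWavelet hμ hv hg₀ _).1 ψ.2
  -- The formula is forced by `functional_eq_integral`; the bound on the coefficients makes the
  -- integral converge.
  let l : testVectors μ ν v g₀ →ₛₗ[starRingEnd ℂ] ℂ :=
    { toFun := fun ψ => ((unitMass ν).toReal : ℂ)⁻¹ * ∫ a,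
        star (waveletTransform μ (haarWaveletL2 μ) ψ.1 a) * f (atom μ a) ∂(affHaar μ ν)
      map_add' := fun ψ χ => by
        rw [← mul_add, ← integral_add (hint ψ) (hint χ)]
        congr 2; funext a
        simp only [waveletTransform, Submodule.coe_add, inner_add_right, star_add, add_mul]
      map_smul' := fun c ψ => by
        rw [smul_eq_mul, mul_left_comm]
        congr 1
        rw [← integral_const_mul]
        congr 1; funext a
        simp only [waveletTransform, Submodule.coe_smul, inner_smul_right, star_mul']
        rw [mul_assoc]; rfl }
  refine ⟨l, mem_reservoir_of_bound hμ hv hg₀ (C := ‖((unitMass ν).toReal : ℂ)⁻¹‖ₑ * C)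
    (ENNReal.mul_lt_top enorm_lt_top hC) fun ψ => ?_, LinearMap.ext fun ψ => ?_⟩
  · change ‖((unitMass ν).toReal : ℂ)⁻¹ * _‖ₑ ≤ _
    rw [enorm_mul, mul_assoc]
    gcongr
    refine (enorm_integral_le_lintegral_enorm _).trans ?_
    rw [← weightedNorm_star, weightedNorm, ← lintegral_const_mul _
      (hv.measurable_mul_enorm (hVm ψ.1))]
    refine lintegral_mono fun a => ?_
    rw [enorm_mul, ← mul_assoc, mul_comm]
    gcongr
    exact hf a
  -- On 𝒮₀(K) the integral becomes a finite sum over cosets, to which linearity of f applies; no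
  -- continuity of f is needed.
  · obtain ⟨T, hT, hψ⟩ := exists_finite_atomic_expansion ν hμ ψ
    have h1 : toTestDual hS l ψ = ((unitMass ν).toReal : ℂ)⁻¹ * ∫ a,
        waveletTransform μ (haarWaveletL2 μ) (testToL2 μ ψ) a * f (atom μ a) ∂(affHaar μ ν) := by
      simp only [← star_waveletTransform_conj ψ]
      rfl
    have h2 : HasSum (fun i : AffCoset K =>
        waveletTransform μ (haarWaveletL2 μ) (testToL2 μ ψ) i.out * f (atom μ i.out))
        (toTestDual hS l ψ) := by
      rw [h1]
      refine hasSum_coset ν hμ (F := fun a =>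
        waveletTransform μ (haarWaveletL2 μ) (testToL2 μ ψ) a * f (atom μ a)) (fun a b h => ?_) ?_
      · rw [waveletTransform_haarWavelet_invariant _ a b h, hinv a b h]
      · have := hint ⟨testToL2 μ ⟨fun y => star (ψ.1 y), conj_mem μ ψ.2⟩, hS _⟩
        simpa only [star_waveletTransform_conj ψ] using this
    have h3 := h2.unique (hasSum_sum_of_ne_finset_zero (s := T) fun i hi => by
      rw [hT i hi, zero_mul])
    rw [h3]
    conv_rhs => rw [hψ]
    rw [map_sum]
    simp only [map_smul, smul_eq_mul]

end coorbit

end LocalFieldWavelet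

end

/-! ### The main theorem -/

theorem theorem7p1 {K : Type*} [Field K] [ValuativeRel K] [TopologicalSpace K]
    [IsNonarchimedeanLocalField K] [MeasurableSpace K] [BorelSpace K]
    (μ : Measure K) [μ.IsAddHaarMeasure] [μ.Regular] (hμ : μ (fracIdeal K 0) = 1)
    (ν : Measure Kˣ) [ν.IsHaarMeasure] [ν.Regular]
    (s t : ℝ≥0∞) (hs : 1 ≤ s) (ht : 1 ≤ t) (α : ℝ) :
    (∃ v : K × Kˣ → ℝ, IsControlWeight μ ν (besovWeight α) s t v) ∧
    ∀ v : K × Kˣ → ℝ, IsControlWeight μ ν (besovWeight α) s t v →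
      IsAnalyzing μ ν v (haarWaveletL2 μ) ∧
      ∀ g₀ : Lp ℂ 2 μ, IsAnalyzing μ ν v g₀ →
        ∃ hS : ∀ ψ : testSpace μ, testToL2 μ ψ ∈ testVectors μ ν v g₀,
          ∀ g : Lp ℂ 2 μ, IsAnalyzing μ ν v g →
            ∃ hg : ∀ a, quasiRegular μ a g ∈ testVectors μ ν v g₀,
              Set.BijOn (toTestDual hS) (coorbitSpace hg (besovWeight α) s t)
                (besovSpace μ α s t) ∧
              (∃ c C : ℝ, 0 < c ∧ 0 < C ∧
                ∀ l ∈ coorbitSpace hg (besovWeight α) s t,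
                  ENNReal.ofReal c * besovNorm μ α s t (toTestDual hS l) ≤
                      coorbitNorm hg (besovWeight α) s t l ∧
                  coorbitNorm hg (besovWeight α) s t l ≤
                    ENNReal.ofReal C * besovNorm μ α s t (toTestDual hS l)) ∧
              (g = haarWaveletL2 μ →
                ∀ l ∈ coorbitSpace hg (besovWeight α) s t,
                  coorbitNorm hg (besovWeight α) s t l =
                    ν {h : Kˣ | kabs (h : K) = 1} ^ (1 / t.toReal) *
                      besovNorm μ α s t (toTestDual hS l)) := by
  have hs0 : s ≠ 0 := (zero_lt_one.trans_le hs).ne'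
  have ht0 : t ≠ 0 := (zero_lt_one.trans_le ht).ne'
  refine ⟨⟨_, isControlWeight_powerWeight ht0⟩, fun v hc => ?_⟩
  have hv : IsAdmissibleWeight v := hc.isAdmissibleWeight hμ hs0 ht0
  have hφa : IsAnalyzing μ ν v (haarWaveletL2 μ) := isAnalyzing_haarWaveletL2 hμ hv
  refine ⟨hφa, fun g₀ hg₀ => ⟨testToL2_mem_testVectors hμ hv hg₀, fun g hga =>
    ⟨quasiRegular_mem_testVectors hμ hv hg₀ hga, ?_⟩⟩⟩
  have hS := testToL2_mem_testVectors hμ hv hg₀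
  have hg := quasiRegular_mem_testVectors hμ hv hg₀ hga
  have hφ := quasiRegular_mem_testVectors hμ hv hg₀ hφa
  have hw : Measurable (besovWeight α : K × Kˣ → ℝ) := measurable_besovWeight α
  set N := unitMass ν ^ (1 / t.toReal) with hN
  have hN0 : N ≠ 0 :=
    (ENNReal.rpow_pos (pos_iff_ne_zero.2 (unitMass_ne_zero ν)) (unitMass_ne_top ν)).ne'
  have hNt : N ≠ ∞ := ENNReal.rpow_ne_top_of_nonneg (by positivity) (unitMass_ne_top ν)
  obtain ⟨D, hD, hDle⟩ := exists_mixedNorm_extWavelet_haarWavelet_le hμ hs ht hw hc.right hv hg₀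
    hga.1 hg hφ
  have hEt : ‖((unitMass ν).toReal : ℂ)⁻¹‖ₑ *
      weightedNorm μ ν v (waveletTransform μ (haarWaveletL2 μ) g) < ∞ :=
    ENNReal.mul_lt_top enorm_lt_top (weightedNorm_haarWavelet_lt_top_of_isAnalyzing hμ hv hga)
  set E := ‖((unitMass ν).toReal : ℂ)⁻¹‖ₑ *
      weightedNorm μ ν v (waveletTransform μ (haarWaveletL2 μ) g) with hE
  have hnorm := fun l => mixedNorm_extWavelet_haarWavelet (α := α) (s := s) ht0 hS hφ l
  have hlow : ∀ l ∈ coorbitSpace hg (besovWeight α) s t,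
      N * besovNorm μ α s t (toTestDual hS l) ≤ D * coorbitNorm hg (besovWeight α) s t l := by
    intro l hl
    rw [hN, ← hnorm]
    exact hDle l hl.1 hl.2
  have hup : ∀ l ∈ reservoir μ ν v g₀, besovNorm μ α s t (toTestDual hS l) < ∞ →
      coorbitNorm hg (besovWeight α) s t l ≤ E * N * besovNorm μ α s t (toTestDual hS l) := by
    intro l hl hb
    rw [mul_assoc, hN, ← hnorm]
    refine mixedNorm_extWavelet_le hμ hs ht hw hc.right hv hg₀ hl hg hφ
      ⟨measurable_extWavelet hμ hv hg₀ hl hφ, ?_⟩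
    rw [hnorm]
    exact ENNReal.mul_lt_top hNt.lt_top hb
  -- An infinite Besov norm would make the left side of `hlow` infinite, while its right side is
  -- finite on the coorbit space.
  have hmaps : ∀ l ∈ coorbitSpace hg (besovWeight α) s t,
      besovNorm μ α s t (toTestDual hS l) < ∞ := by
    intro l hl
    by_contra h
    rw [not_lt, top_le_iff] at h
    have h1 := hlow l hl
    rw [h, ENNReal.mul_top hN0, top_le_iff] at h1
    exact (ENNReal.mul_lt_top hD hl.2.2).ne h1
  refine ⟨⟨hmaps, (toTestDual_injOn hμ hv hg₀ hS).mono fun l hl => hl.1, fun f hf => ?_⟩, ?_, ?_⟩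
  -- Surjectivity: the coefficients of f lie in Y, hence are O(v) pointwise, and so come from a
  -- functional in the reservoir; `hup` places it in the coorbit space of g.
  · have hinv : ∀ a b, cosetSetoid K a b → f (atom μ a) = f (atom μ b) := fun a b h => by
      rw [atom_eq_of_rel h]
    have hfY : mixedNorm μ ν (besovWeight α) s t (fun a => f (atom μ a)) < ∞ := by
      rw [mixedNorm_atom ht0]
      exact ENNReal.mul_lt_top hNt.lt_top hf
    obtain ⟨l, hl, hlf⟩ := exists_functional hμ hv hg₀ hS f
      (ENNReal.mul_lt_top (ENNReal.inv_lt_top.2 (pos_iff_ne_zero.2 hN0)) hfY)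
      (enorm_le_of_invariant hc hμ hs0 ht0 ⟨(continuous_of_invariant hinv).measurable, hfY⟩ hinv)
    have hb : besovNorm μ α s t (toTestDual hS l) < ∞ := by rw [hlf]; exact hf
    exact ⟨l, ⟨hl, measurable_extWavelet hμ hv hg₀ hl hg, (hup l hl hb).trans_lt
      (ENNReal.mul_lt_top (ENNReal.mul_lt_top hEt hNt.lt_top) hb)⟩, hlf⟩
  · have hD1 : D + 1 ≠ 0 := by simp
    have hDt : D + 1 ≠ ∞ := ENNReal.add_ne_top.2 ⟨hD.ne, ENNReal.one_ne_top⟩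
    have hc0 : N / (D + 1) ≠ 0 := ENNReal.div_ne_zero.2 ⟨hN0, hDt⟩
    have hct : N / (D + 1) ≠ ∞ := ENNReal.div_ne_top hNt hD1
    have hCt : E * N + 1 ≠ ∞ :=
      ENNReal.add_ne_top.2 ⟨ENNReal.mul_ne_top hEt.ne hNt, ENNReal.one_ne_top⟩
    -- The summands 1 keep the denominator away from 0 and make the upper constant positive without
    -- examining D or E.
    refine ⟨(N / (D + 1)).toReal, (E * N + 1).toReal, ENNReal.toReal_pos hc0 hct,
      ENNReal.toReal_pos (by simp) hCt, fun l hl => ⟨?_, ?_⟩⟩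
    · rw [ENNReal.ofReal_toReal hct, div_eq_mul_inv, mul_right_comm, ← div_eq_mul_inv]
      refine ENNReal.div_le_of_le_mul' ((hlow l hl).trans ?_)
      gcongr
      exact le_self_add
    · rw [ENNReal.ofReal_toReal hCt]
      refine (hup l hl.1 (hmaps l hl)).trans ?_
      gcongr
      exact le_self_add
  · rintro rfl l -
    exact hnorm l
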